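/- Let $N\in\mathbb N$, let $\Omega\subseteq\mathbb R^N$ be a measurable set with Lebesgue measure, let $p\in(1,\infty)$ and consider the complex space $X=L^p(\Omega)$. For $\varphi\in(0,\pi)$ let $\Sigma_\varphi=\{z\in\mathbb C\setminus\{0\}:|\arg z|<\varphi\}$. A closed densely defined operator $A$ on $X$ with dense range is called sectorial if there is $\varphi\in(0,\frac\pi2)$ such that $\sigma(A)\subseteq\overline{\Sigma_\varphi}$ and $\sup_{\lambda\notin\overline{\Sigma_\varphi}}\|\lambda R(\lambda,A)\|<\infty$, where $R(\lambda,A)=(\lambda-A)^{-1}$. A set $\mathcal T$ of bounded operators on $X$ is called $\mathcal R$-bounded if there is $K\ge 0$ such that $\mathbb E\|\sum_{k=1}^n\epsilon_kT_kx_k\|\le K\,\mathbb E\|\sum_{k=1}^n\epsilon_kx_k\|$ for all $n\in\mathbb N$, $T_1,\dots,T_n\in\mathcal T$, $x_1,\dots,x_n\in X$, where $\epsilon_1,\dots,\epsilon_n$ are independent Rademacher variables. Let $(A(t))_{t\in[0,T]}$ be a family of sectorial operators on $L^p(\Omega)$, and denote by $(e^{-sA(t)})_{s\ge0}$ the $C_0$-semigroup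 generated by $-A(t)$. Suppose that: (i) there is $\varphi\in(0,\frac\pi2)$ such that $\sigma(A(t))\subseteq\overline{\Sigma_\varphi}$ for all $t\in[0,T]$ and $\sup_{t\in[0,T]}\sup_{\lambda\notin\overline{\Sigma_\varphi}}\|\lambda R(\lambda,A(t))\|<\infty$; (ii) for all $t\in[0,T]$ and $s>0$ the operator $e^{-sA(t)}$ is given by a measurable kernel $k_t(\cdot,\cdot,s)$, i.e. $(e^{-sA(t)}f)(x)=\int_\Omega k_t(x,y,s)f(y)\,dy$ for every $f\in L^p(\Omega)$ and almost every $x\in\Omega$ (with absolutely convergent integral), and there are constants $C\ge0$, $\beta>0$, $\omega_1\in\mathbb R$ such that for all $t\in[0,T]$ and $s>0$ $$|k_t(x,y,s)|\le C s^{-N/2}e^{\omega_1 s}\exp\Bigl(-\frac{|x-y|^2}{4\beta s}\Bigr)\qquad\text{for almost every }(x,y)\in\Omega\times\Omega.$$ Then there is $\theta\in(\varphi,\frac\pi2)$ such that for every $\omega\ge\max\{\omega_1,0\}$ one has $\sigma(A(t)+\omega)\subseteq\overline{\Sigma_\theta}$ for all $t\in[0,T]$ and the set $$\{\lambda R(\lambda,A(t)+\omega):\lambda\notin\overline{\Sigma_\theta},\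 t\in[0,T]\}$$ is $\mathcal R$-bounded. -/

import Mathlib

open MeasureTheory Filter Topology Set
open scoped ENNReal Real

noncomputable section

namespace KernelRBound

/-- The open sector `Σ_φ = {z ≠ 0 : |arg z| < φ}`. -/
def sector (φ : ℝ) : Set ℂ := {z | z ≠ 0 ∧ |Complex.arg z| < φ}

section Operators

variable {X : Type*} [NormedAddCommGroup X] [NormedSpace ℂ X]

/-- `R` is a bounded two-sided inverse of `z - A : D(A) → X`. -/
def IsResolventAt (A : X →ₗ.[ℂ] X) (z : ℂ) (R : X →L[ℂ] X) : Prop :=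
  (∀ x : X, ∃ h : R x ∈ A.domain, z • R x - A ⟨R x, h⟩ = x) ∧
    ∀ y : A.domain, R (z • (y : X) - A y) = y

/-- The resolvent set `ρ(A)` of a possibly unbounded operator. -/
def resolventSet (A : X →ₗ.[ℂ] X) : Set ℂ := {z | ∃ R : X →L[ℂ] X, IsResolventAt A z R}

/-- The spectrum `σ(A) = ℂ \ ρ(A)`. -/
def spectrum (A : X →ₗ.[ℂ] X) : Set ℂ := (resolventSet A)ᶜ

open Classical in
/-- The resolvent `R(z, A) = (z - A)⁻¹` for `z ∈ ρ(A)` (and the value `0` on the spectrum). -/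
def resolvent (A : X →ₗ.[ℂ] X) (z : ℂ) : X →L[ℂ] X :=
  if h : ∃ R : X →L[ℂ] X, IsResolventAt A z R then h.choose else 0

/-- The operator `A + ω` with domain `D(A)`. -/
def addScalar (A : X →ₗ.[ℂ] X) (ω : ℝ) : X →ₗ.[ℂ] X :=
  ((ω : ℂ) • (LinearMap.id : X →ₗ[ℂ] X)) +ᵥ A

/-- A sectorial operator: closed, densely defined, with dense range, and with spectrum in
a closed sector of half-angle `φ < π / 2` outside of which `‖z R(z, A)‖` is bounded. -/
def IsSectorial (A : X →ₗ.[ℂ] X) : Prop :=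
  A.IsClosed ∧ Dense (A.domain : Set X) ∧ DenseRange (fun y : A.domain => A y) ∧
    ∃ φ ∈ Ioo 0 (π / 2), spectrum A ⊆ closure (sector φ) ∧
      ∃ M : ℝ, ∀ z ∉ closure (sector φ), ‖z • resolvent A z‖ ≤ M

/-- `(S s)_{s ≥ 0}` is a `C₀`-semigroup (the values at negative times play no role). -/
def IsC0Semigroup (S : ℝ → X →L[ℂ] X) : Prop :=
  S 0 = ContinuousLinearMap.id ℂ X ∧
    (∀ s r : ℝ, 0 ≤ s → 0 ≤ r → S (s + r) = (S s).comp (S r)) ∧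
    ∀ x : X, Tendsto (fun s => S s x) (𝓝[>] 0) (𝓝 x)

/-- `G` is the infinitesimal generator of `S`: its graph consists of the pairs `(x, y)` such
that `(S s x - x) / s` converges to `y` as `s → 0+`. -/
def IsGeneratorOf (G : X →ₗ.[ℂ] X) (S : ℝ → X →L[ℂ] X) : Prop :=
  ∀ x y : X, (x, y) ∈ G.graph ↔
    Tendsto (fun s : ℝ => (s : ℂ)⁻¹ • (S s x - x)) (𝓝[>] 0) (𝓝 y)

/-- The expectation of `F (ε₁, …, εₙ)` for independent Rademacher variables `ε₁, …, εₙ`,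
i.e. the mean over all choices of signs. -/
def rademacherMean {n : ℕ} (F : (Fin n → ℤˣ) → ℝ) : ℝ := (∑ ε, F ε) / 2 ^ n

/-- `𝓡`-boundedness of a set of bounded operators. -/
def IsRBounded (𝒯 : Set (X →L[ℂ] X)) : Prop :=
  ∃ C : ℝ, 0 ≤ C ∧ ∀ (n : ℕ) (T : Fin n → X →L[ℂ] X) (x : Fin n → X), (∀ k, T k ∈ 𝒯) →
    rademacherMean (fun ε => ‖∑ k, (ε k : ℤ) • T k (x k)‖) ≤
      C * rademacherMean (fun ε => ‖∑ k, (ε k : ℤ) • x k‖)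

end Operators

/-- The operator `B` on `L^p(α, μ)` is given by the measurable kernel `k`: for every `f` and
almost every `x`, `(B f)(x) = ∫ k(x, y) f(y) dμ(y)`, the integral being absolutely convergent. -/
def IsGivenByKernel {α : Type*} [MeasurableSpace α] {μ : Measure α} {p : ℝ≥0∞} [Fact (1 ≤ p)]
    (B : Lp ℂ p μ →L[ℂ] Lp ℂ p μ) (k : α → α → ℂ) : Prop :=
  AEStronglyMeasurable (Function.uncurry k) (μ.prod μ) ∧
    ∀ f : Lp ℂ p μ, ∀ᵐ x ∂μ,
      Integrable (fun y => k x y * f y) μ ∧ B f x = ∫ y, k x y * f y ∂μ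

end KernelRBound

end

/-! By Khintchine's inequality, `𝓡`-boundedness in `L^p` is a square function estimate. Such an
estimate holds for all operators dominated pointwise by `K` times a Gaussian average, uniformly in
the width of the Gaussian: for `p > 2` the maximal inequality for Gaussian averages yields it, after
testing against a function of the dual exponent of `p / 2`; the case `p = 2` is trivial, and `p < 2`
follows by duality.

Put `U(s) = e^{-ωs} e^{-sA(t)}`, a semigroup with generator `-A`, where `A = A(t) + ω`. The kernel
bound makes `U(s)` Gauss dominated, and so is `s A U(s)`, by a Landau argument: up to a remainder of
second order, `h s A U(s)` is the difference `U(s) - U((1 + h)s)`, and the remainder is factored as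
`L¹ → L^p → L^p → L^∞` with the help of `U(s/3)`. Choosing the step `h` as a Gaussian in the
distance makes both contributions Gaussian.

For `r = m / |z|`, the Laplace transform of `U`, cut off at `r`, gives
`z (z + A)⁻¹ = z ∫₀ʳ e^{-zs} U(s) ds + e^{-zr} U(r) - (e^{-zr} / z) A U(r) z (z + A)⁻¹`. If
`Re z ≥ -|z| / m`, then the first two terms are `𝓡`-bounded, whereas the last one is an element of
an `𝓡`-bounded set independent of `m`, times `e / m`, applied to the left-hand side. For large `m`
it can be absorbed, and `θ` is any angle with `cos θ ≤ 1 / m`. -/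

noncomputable section

namespace KernelRBound

section Rademacher

variable {n : ℕ} {X : Type*} [NormedAddCommGroup X]

theorem rademacherMean_mono {F G : (Fin n → ℤˣ) → ℝ} (h : ∀ ε, F ε ≤ G ε) :
    rademacherMean F ≤ rademacherMean G :=
  div_le_div_of_nonneg_right (Finset.sum_le_sum fun ε _ => h ε) (by positivity)

theorem rademacherMean_nonneg {F : (Fin n → ℤˣ) → ℝ} (h : ∀ ε, 0 ≤ F ε) :
    0 ≤ rademacherMean F :=
  div_nonneg (Finset.sum_nonneg fun ε _ => h ε) (by positivity)

theorem rademacherMean_add (F G : (Fin n → ℤˣ) → ℝ) :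
    rademacherMean (fun ε => F ε + G ε) = rademacherMean F + rademacherMean G := by
  simp only [rademacherMean, Finset.sum_add_distrib, add_div]

theorem rademacherMean_const_mul (c : ℝ) (F : (Fin n → ℤˣ) → ℝ) :
    rademacherMean (fun ε => c * F ε) = c * rademacherMean F := by
  simp only [rademacherMean, ← Finset.mul_sum, mul_div_assoc]

theorem rademacherMean_sum {ι : Type*} (s : Finset ι) (F : ι → (Fin n → ℤˣ) → ℝ) :
    rademacherMean (fun ε => ∑ i ∈ s, F i ε) = ∑ i ∈ s, rademacherMean (F i) := by
  simp only [rademacherMean, ← Finset.sum_div]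
  rw [Finset.sum_comm]

theorem sum_inv_two_pow : ∑ _ε : Fin n → ℤˣ, ((2 : ℝ≥0∞) ^ n)⁻¹ = 1 := by
  simp only [Finset.sum_const, Finset.card_univ, Fintype.card_fun, Fintype.card_units_int,
    Fintype.card_fin, nsmul_eq_mul]
  push_cast
  exact ENNReal.mul_inv_cancel (by simp) (by simp)

theorem ofReal_rademacherMean {F : (Fin n → ℤˣ) → ℝ} (hF : ∀ ε, 0 ≤ F ε) :
    ENNReal.ofReal (rademacherMean F) = ∑ ε, (2 ^ n)⁻¹ * ENNReal.ofReal (F ε) := by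
  rw [rademacherMean, ENNReal.ofReal_div_of_pos (by positivity),
    ENNReal.ofReal_sum_of_nonneg fun ε _ => hF ε, ENNReal.ofReal_pow (by norm_num),
    ENNReal.ofReal_ofNat, ← Finset.mul_sum, ENNReal.div_eq_inv_mul]

/-- The Rademacher sum `∑ εₖ xₖ`, as a function of the signs. -/
def rademacherSum (x : Fin n → X) (ε : Fin n → ℤˣ) : X := ∑ k, (ε k : ℤ) • x k

theorem rademacherSum_add (x y : Fin n → X) (ε : Fin n → ℤˣ) :
    rademacherSum (x + y) ε = rademacherSum x ε + rademacherSum y ε := by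
  simp only [rademacherSum, Pi.add_apply, smul_add, Finset.sum_add_distrib]

theorem rademacherSum_smul [NormedSpace ℝ X] (c : ℝ) (x : Fin n → X) (ε : Fin n → ℤˣ) :
    rademacherSum (c • x) ε = c • rademacherSum x ε := by
  simp only [rademacherSum, Finset.smul_sum, Pi.smul_apply, smul_comm c]

theorem map_rademacherSum {Y : Type*} [NormedAddCommGroup Y] (f : X →+ Y) (x : Fin n → X)
    (ε : Fin n → ℤˣ) : f (rademacherSum x ε) = rademacherSum (fun k => f (x k)) ε := by
  simp only [rademacherSum, map_sum, map_zsmul]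

end Rademacher

section Khintchine

variable {n : ℕ}

theorem rademacherMean_exp_rademacherSum (a : Fin n → ℝ) :
    rademacherMean (fun ε => Real.exp (rademacherSum a ε)) = ∏ k, Real.cosh (a k) := by
  have sum_units (k : Fin n) : ∑ u : ℤˣ, Real.exp ((u : ℤ) • a k) = 2 * Real.cosh (a k) := by
    rw [show (Finset.univ : Finset ℤˣ) = {1, -1} from rfl, Finset.sum_pair (by decide),
      Real.cosh_eq]
    simp only [Units.val_one, one_smul, Units.val_neg, neg_smul]
    ring
  have sum_signs : ∑ ε : Fin n → ℤˣ, Real.exp (rademacherSum a ε) =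
      ∏ k, ∑ u : ℤˣ, Real.exp ((u : ℤ) • a k) := by
    simp_rw [rademacherSum, Real.exp_sum]
    rw [Finset.prod_univ_sum, Fintype.piFinset_univ]
  rw [rademacherMean, sum_signs, div_eq_iff (by positivity), mul_comm]
  simp only [sum_units, Finset.prod_mul_distrib, Finset.prod_const, Finset.card_univ,
    Fintype.card_fin]

theorem rademacherMean_exp_rademacherSum_le (a : Fin n → ℝ) :
    rademacherMean (fun ε => Real.exp (rademacherSum a ε)) ≤ Real.exp ((∑ k, a k ^ 2) / 2) := by
  rw [rademacherMean_exp_rademacherSum, Finset.sum_div, Real.exp_sum]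
  gcongr with k
  exact Real.cosh_le_exp_half_sq _

theorem rademacherMean_exp_abs_rademacherSum_le (a : Fin n → ℝ) :
    rademacherMean (fun ε => Real.exp |rademacherSum a ε|) ≤
      2 * Real.exp ((∑ k, a k ^ 2) / 2) := by
  have hneg (ε : Fin n → ℤˣ) : -rademacherSum a ε = rademacherSum (-a) ε := by
    simp only [rademacherSum, Pi.neg_apply, smul_neg, Finset.sum_neg_distrib]
  calc rademacherMean (fun ε => Real.exp |rademacherSum a ε|)
      ≤ rademacherMean (fun ε => Real.exp (rademacherSum a ε) +
          Real.exp (rademacherSum (-a) ε)) :=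
        rademacherMean_mono fun ε => (Real.exp_abs_le _).trans_eq (by rw [hneg])
    _ ≤ Real.exp ((∑ k, a k ^ 2) / 2) + Real.exp ((∑ k, (-a) k ^ 2) / 2) := by
        rw [rademacherMean_add]
        gcongr <;> exact rademacherMean_exp_rademacherSum_le _
    _ = 2 * Real.exp ((∑ k, a k ^ 2) / 2) := by
        simp only [Pi.neg_apply, neg_sq, two_mul]

theorem rpow_le_rpow_mul_exp {r x : ℝ} (hr : 0 < r) (hx : 0 ≤ x) :
    x ^ r ≤ r ^ r * Real.exp x := by
  have hle : x ≤ r * Real.exp (x / r) := by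
    calc x = r * (x / r) := by field_simp
      _ ≤ r * Real.exp (x / r) := by
        gcongr
        linarith [Real.add_one_le_exp (x / r)]
  calc x ^ r ≤ (r * Real.exp (x / r)) ^ r := by gcongr
    _ = r ^ r * Real.exp x := by
        rw [Real.mul_rpow hr.le (Real.exp_pos _).le, ← Real.exp_mul, div_mul_cancel₀ _ hr.ne']

theorem rademacherMean_abs_rademacherSum_rpow_le {r : ℝ} (hr : 0 < r) (a : Fin n → ℝ) :
    rademacherMean (fun ε => |rademacherSum a ε| ^ r) ≤
      r ^ r * (2 * Real.exp (1 / 2)) * (∑ k, a k ^ 2) ^ (r / 2) := by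
  have hsum : 0 ≤ ∑ k, a k ^ 2 := Finset.sum_nonneg fun k _ => sq_nonneg _
  rcases hsum.eq_or_lt with h0 | hpos
  · have ha : a = 0 := by
      ext k
      simpa using (Finset.sum_eq_zero_iff_of_nonneg fun k _ => sq_nonneg (a k)).1 h0.symm k
    simp only [rademacherMean, rademacherSum, ha, Pi.zero_apply, smul_zero,
      Finset.sum_const_zero, abs_zero, Real.zero_rpow hr.ne', zero_div]
    positivity
  obtain ⟨σ, hσ, hσ2⟩ : ∃ σ > 0, σ ^ 2 = ∑ k, a k ^ 2 :=
    ⟨√(∑ k, a k ^ 2), Real.sqrt_pos.2 hpos, Real.sq_sqrt hsum⟩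
  have hσr : (∑ k, a k ^ 2) ^ (r / 2) = σ ^ r := by
    rw [← hσ2, ← Real.rpow_natCast, ← Real.rpow_mul hσ.le]
    congr 1
    push_cast
    ring
  have hnormalized : ∑ k, (σ⁻¹ • a) k ^ 2 = 1 := by
    simp only [Pi.smul_apply, smul_eq_mul, mul_pow, ← Finset.mul_sum, ← hσ2]
    field_simp
  have hscale (ε : Fin n → ℤˣ) : |rademacherSum a ε| = σ * |rademacherSum (σ⁻¹ • a) ε| := by
    rw [rademacherSum_smul, smul_eq_mul, abs_mul, abs_of_pos (inv_pos.2 hσ),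
      mul_inv_cancel_left₀ hσ.ne']
  calc rademacherMean (fun ε => |rademacherSum a ε| ^ r)
      ≤ rademacherMean (fun ε => σ ^ r * r ^ r * Real.exp |rademacherSum (σ⁻¹ • a) ε|) := by
        refine rademacherMean_mono fun ε => ?_
        rw [hscale, Real.mul_rpow hσ.le (abs_nonneg _), mul_assoc]
        gcongr
        exact rpow_le_rpow_mul_exp hr (abs_nonneg _)
    _ ≤ σ ^ r * r ^ r * (2 * Real.exp (1 / 2)) := by
        rw [rademacherMean_const_mul]
        gcongr
        simpa only [hnormalized] using rademacherMean_exp_abs_rademacherSum_le (σ⁻¹ • a)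
    _ = r ^ r * (2 * Real.exp (1 / 2)) * (∑ k, a k ^ 2) ^ (r / 2) := by
        rw [hσr]
        ring

theorem norm_rpow_le_two_rpow_mul {r : ℝ} (hr : 0 < r) (z : ℂ) :
    ‖z‖ ^ r ≤ 2 ^ r * (|z.re| ^ r + |z.im| ^ r) := by
  have hmax : ‖z‖ ≤ 2 * max |z.re| |z.im| :=
    (Complex.norm_le_abs_re_add_abs_im z).trans
      (by linarith [le_max_left |z.re| |z.im|, le_max_right |z.re| |z.im|])
  calc ‖z‖ ^ r ≤ (2 * max |z.re| |z.im|) ^ r := by gcongr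
    _ = 2 ^ r * max (|z.re| ^ r) (|z.im| ^ r) := by
        rw [Real.mul_rpow zero_le_two (by positivity),
          (Real.monotoneOn_rpow_Ici_of_exponent_nonneg hr.le).map_max (abs_nonneg z.re)
            (abs_nonneg z.im)]
    _ ≤ 2 ^ r * (|z.re| ^ r + |z.im| ^ r) := by
        gcongr
        exact max_le_add_of_nonneg (by positivity) (by positivity)

/-- The constant of `khintchine_upper` for the moment of order `r`. -/
def khintchineConst (r : ℝ) : ℝ := 2 ^ r * (r ^ r * (4 * Real.exp (1 / 2)))

theorem khintchineConst_pos {r : ℝ} (hr : 0 < r) : 0 < khintchineConst r := by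
  unfold khintchineConst
  positivity

theorem khintchine_upper {r : ℝ} (hr : 0 < r) (z : Fin n → ℂ) :
    rademacherMean (fun ε => ‖rademacherSum z ε‖ ^ r) ≤
      khintchineConst r * (∑ k, ‖z k‖ ^ 2) ^ (r / 2) := by
  have hbound (a : Fin n → ℝ) (ha : ∀ k, |a k| ≤ ‖z k‖) :
      rademacherMean (fun ε => |rademacherSum a ε| ^ r) ≤
        r ^ r * (2 * Real.exp (1 / 2)) * (∑ k, ‖z k‖ ^ 2) ^ (r / 2) := by
    refine (rademacherMean_abs_rademacherSum_rpow_le hr a).trans ?_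
    simp_rw [← sq_abs (a _)]
    gcongr with k
    exact ha k
  have hre (ε : Fin n → ℤˣ) :
      (rademacherSum z ε).re = rademacherSum (fun k => (z k).re) ε :=
    map_rademacherSum Complex.reAddGroupHom z ε
  have him (ε : Fin n → ℤˣ) :
      (rademacherSum z ε).im = rademacherSum (fun k => (z k).im) ε :=
    map_rademacherSum Complex.imAddGroupHom z ε
  calc rademacherMean (fun ε => ‖rademacherSum z ε‖ ^ r)
      ≤ rademacherMean (fun ε => 2 ^ r * (|rademacherSum (fun k => (z k).re) ε| ^ r +
          |rademacherSum (fun k => (z k).im) ε| ^ r)) := by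
        refine rademacherMean_mono fun ε => ?_
        rw [← hre, ← him]
        exact norm_rpow_le_two_rpow_mul hr _
    _ ≤ 2 ^ r * (r ^ r * (2 * Real.exp (1 / 2)) * (∑ k, ‖z k‖ ^ 2) ^ (r / 2) +
          r ^ r * (2 * Real.exp (1 / 2)) * (∑ k, ‖z k‖ ^ 2) ^ (r / 2)) := by
        rw [rademacherMean_const_mul, rademacherMean_add]
        gcongr
        · exact hbound _ fun k => Complex.abs_re_le_norm _
        · exact hbound _ fun k => Complex.abs_im_le_norm _
    _ = khintchineConst r * (∑ k, ‖z k‖ ^ 2) ^ (r / 2) := by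
        rw [khintchineConst]
        ring

theorem rademacherMean_mul_eq_ite (j k : Fin n) :
    rademacherMean (fun ε => ((ε j * ε k : ℤˣ) : ℤ)) = if j = k then 1 else 0 := by
  split_ifs with hjk
  · subst hjk
    simp [rademacherMean]
  -- Flipping the sign `ε j` changes the sign of the summand.
  have hflip := Fintype.sum_equiv (Equiv.mulLeft (Pi.mulSingle j (-1) : Fin n → ℤˣ))
    (fun ε : Fin n → ℤˣ => -(((ε j * ε k : ℤˣ) : ℤ) : ℝ))
    (fun ε : Fin n → ℤˣ => (((ε j * ε k : ℤˣ) : ℤ) : ℝ)) (fun ε => by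
      simp [Pi.mulSingle_eq_of_ne (Ne.symm hjk)])
  rw [Finset.sum_neg_distrib] at hflip
  rw [rademacherMean, self_eq_neg.1 hflip.symm, zero_div]

theorem rademacherMean_norm_rademacherSum_sq {H : Type*} [NormedAddCommGroup H]
    [InnerProductSpace ℝ H] (x : Fin n → H) :
    rademacherMean (fun ε => ‖rademacherSum x ε‖ ^ 2) = ∑ k, ‖x k‖ ^ 2 := by
  have hexpand (ε : Fin n → ℤˣ) : ‖rademacherSum x ε‖ ^ 2 =
      ∑ j, ∑ k, inner ℝ (x j) (x k) * ((ε j * ε k : ℤˣ) : ℤ) := by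
    rw [← real_inner_self_eq_norm_sq, rademacherSum, sum_inner]
    refine Finset.sum_congr rfl fun j _ => ?_
    rw [inner_sum]
    refine Finset.sum_congr rfl fun k _ => ?_
    rw [← Int.cast_smul_eq_zsmul ℝ, ← Int.cast_smul_eq_zsmul ℝ, real_inner_smul_left,
      real_inner_smul_right]
    push_cast
    ring
  simp_rw [hexpand, rademacherMean_sum, rademacherMean_const_mul, rademacherMean_mul_eq_ite,
    mul_ite, mul_one, mul_zero, Finset.sum_ite_eq, Finset.mem_univ, if_true,
    real_inner_self_eq_norm_sq]

theorem sq_le_mul_add_pow_four_div {t L : ℝ} (ht : 0 ≤ t) (hL : 0 < L) :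
    t ^ 2 ≤ L * t + t ^ 4 / L ^ 2 := by
  rcases le_total t L with h | h
  · calc t ^ 2 = t * t := sq t
      _ ≤ L * t := by gcongr
      _ ≤ L * t + t ^ 4 / L ^ 2 := le_add_of_nonneg_right (by positivity)
  · calc t ^ 2 = t ^ 2 * L ^ 2 / L ^ 2 := by field_simp
      _ ≤ t ^ 2 * t ^ 2 / L ^ 2 := by gcongr
      _ = t ^ 4 / L ^ 2 := by ring
      _ ≤ L * t + t ^ 4 / L ^ 2 := le_add_of_nonneg_left (by positivity)

theorem le_mul_rademacherMean_of_fourth_moment_le {F : (Fin n → ℤˣ) → ℝ} {σ K : ℝ}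
    (hF : ∀ ε, 0 ≤ F ε) (hσ : 0 ≤ σ) (hK : 0 < K) (h2 : rademacherMean (fun ε => F ε ^ 2) = σ ^ 2)
    (h4 : rademacherMean (fun ε => F ε ^ 4) ≤ K * σ ^ 4) :
    σ ≤ 2 * √(2 * K) * rademacherMean F := by
  rcases hσ.eq_or_lt with rfl | hpos
  · have := rademacherMean_nonneg hF
    positivity
  set L := √(2 * K) * σ
  have hL : 0 < L := by positivity
  have hL2 : L ^ 2 = 2 * K * σ ^ 2 := by rw [mul_pow, Real.sq_sqrt (by positivity)]
  have hhalf : σ ^ 2 ≤ L * rademacherMean F + σ ^ 2 / 2 := by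
    calc σ ^ 2 = rademacherMean (fun ε => F ε ^ 2) := h2.symm
      _ ≤ rademacherMean (fun ε => L * F ε + (L ^ 2)⁻¹ * F ε ^ 4) :=
        rademacherMean_mono fun ε =>
          (sq_le_mul_add_pow_four_div (hF ε) hL).trans_eq (by rw [div_eq_inv_mul])
      _ ≤ L * rademacherMean F + (L ^ 2)⁻¹ * (K * σ ^ 4) := by
        rw [rademacherMean_add, rademacherMean_const_mul, rademacherMean_const_mul]
        gcongr
      _ = L * rademacherMean F + σ ^ 2 / 2 := by
        rw [hL2]
        field_simp
  refine le_of_mul_le_mul_left ?_ hpos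
  calc σ * σ ≤ 2 * (L * rademacherMean F) := by linarith
    _ = σ * (2 * √(2 * K) * rademacherMean F) := by ring

theorem khintchine_lower (z : Fin n → ℂ) :
    √(∑ k, ‖z k‖ ^ 2) ≤
      2 * √(2 * khintchineConst 4) * rademacherMean (fun ε => ‖rademacherSum z ε‖) := by
  have hsum : 0 ≤ ∑ k, ‖z k‖ ^ 2 := Finset.sum_nonneg fun k _ => by positivity
  refine le_mul_rademacherMean_of_fourth_moment_le (fun ε => norm_nonneg _) (Real.sqrt_nonneg _)
    (khintchineConst_pos four_pos) ?_ ?_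
  · rw [rademacherMean_norm_rademacherSum_sq, Real.sq_sqrt hsum]
  · have h4 := khintchine_upper (r := (4 : ℕ)) (by norm_num) z
    simp only [Real.rpow_natCast] at h4
    refine h4.trans_eq ?_
    rw [show √(∑ k, ‖z k‖ ^ 2) ^ 4 = (√(∑ k, ‖z k‖ ^ 2) ^ 2) ^ 2 by ring, Real.sq_sqrt hsum,
      show ((4 : ℕ) : ℝ) / 2 = (2 : ℕ) by norm_num, Real.rpow_natCast, Nat.cast_ofNat]

end Khintchine

section SquareFunction

open scoped NNReal

theorem exists_khintchine_upper_enorm {r : ℝ} (hr : 0 < r) :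
    ∃ C : ℝ≥0, ∀ (n : ℕ) (z : Fin n → ℂ),
      ∑ ε, (2 ^ n)⁻¹ * ‖rademacherSum z ε‖ₑ ^ r ≤ C * (∑ k, ‖z k‖ₑ ^ 2) ^ (r / 2) := by
  refine ⟨(khintchineConst r).toNNReal, fun n z => ?_⟩
  have h := ENNReal.ofReal_le_ofReal (khintchine_upper hr z)
  have hsum : 0 ≤ ∑ k, ‖z k‖ ^ 2 := Finset.sum_nonneg fun k _ => by positivity
  rw [ofReal_rademacherMean fun ε => by positivity,
    ENNReal.ofReal_mul (khintchineConst_pos hr).le,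
    ← ENNReal.ofReal_rpow_of_nonneg hsum (by positivity),
    ENNReal.ofReal_sum_of_nonneg fun _ _ => by positivity] at h
  simp only [← ENNReal.ofReal_rpow_of_nonneg (norm_nonneg _) hr.le,
    ENNReal.ofReal_pow (norm_nonneg _), ofReal_norm] at h
  exact h

theorem exists_khintchine_lower_enorm :
    ∃ C : ℝ≥0, ∀ (n : ℕ) (z : Fin n → ℂ),
      (∑ k, ‖z k‖ₑ ^ 2) ^ (1 / 2 : ℝ) ≤ C * ∑ ε, (2 ^ n)⁻¹ * ‖rademacherSum z ε‖ₑ := by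
  refine ⟨(2 * √(2 * khintchineConst 4)).toNNReal, fun n z => ?_⟩
  have h := ENNReal.ofReal_le_ofReal (khintchine_lower z)
  have hsum : 0 ≤ ∑ k, ‖z k‖ ^ 2 := Finset.sum_nonneg fun k _ => by positivity
  rw [ENNReal.ofReal_mul (by positivity), ofReal_rademacherMean fun _ => norm_nonneg _,
    Real.sqrt_eq_rpow, ← ENNReal.ofReal_rpow_of_nonneg hsum (by positivity),
    ENNReal.ofReal_sum_of_nonneg fun _ _ => by positivity] at h
  simp only [ENNReal.ofReal_pow (norm_nonneg _), ofReal_norm] at h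
  exact h

variable {n : ℕ} {α : Type*} [MeasurableSpace α] {ν : Measure α} {p : ℝ≥0∞}

/-- The `L^p(ν)`-norm of the square function `(∑ₖ fₖ²)^{1/2}` of nonnegative functions `fₖ`, for
`p < ∞`. -/
def sqNorm (p : ℝ≥0∞) (ν : Measure α) (f : Fin n → α → ℝ≥0∞) : ℝ≥0∞ :=
  (∫⁻ x, (∑ k, f k x ^ 2) ^ (p.toReal / 2) ∂ν) ^ (1 / p.toReal)

variable [Fact (1 ≤ p)]

theorem coeFn_rademacherSum (ε : Fin n → ℤˣ) (f : Fin n → Lp ℂ p ν) :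
    ⇑(rademacherSum f ε : Lp ℂ p ν) =ᵐ[ν] fun x => rademacherSum (fun k => f k x) ε := by
  have hterm (k : Fin n) : ⇑((ε k : ℤ) • f k) =ᵐ[ν] fun x => (ε k : ℤ) • f k x := by
    rw [← Int.cast_smul_eq_zsmul ℂ]
    filter_upwards [Lp.coeFn_smul ((ε k : ℤ) : ℂ) (f k)] with x hx
    rw [hx, Pi.smul_apply, Int.cast_smul_eq_zsmul ℂ]
  filter_upwards [Lp.coeFn_finsetSum Finset.univ fun k => (ε k : ℤ) • f k,
    eventually_all.2 hterm] with x hsum hx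
  rw [rademacherSum, hsum, Finset.sum_apply]
  exact Finset.sum_congr rfl fun k _ => hx k

theorem one_le_toReal (hp : p ≠ ∞) : 1 ≤ p.toReal := by
  rw [← ENNReal.toReal_one]
  exact ENNReal.toReal_mono hp Fact.out

theorem enorm_rpow_toReal (hp : p ≠ ∞) (f : Lp ℂ p ν) :
    ‖f‖ₑ ^ p.toReal = ∫⁻ x, ‖f x‖ₑ ^ p.toReal ∂ν := by
  have hp0 : p ≠ 0 := (zero_lt_one.trans_le Fact.out).ne'
  rw [Lp.enorm_def, eLpNorm_eq_lintegral_rpow_enorm_toReal hp0 hp, ← ENNReal.rpow_mul,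
    one_div_mul_cancel (ENNReal.toReal_pos hp0 hp).ne', ENNReal.rpow_one]

/-- Jensen's inequality moves the power `p` inside the mean, and Fubini reduces to the scalar
Khintchine inequality. -/
theorem exists_rademacherMean_le_sqNorm (hp : p ≠ ∞) (ν : Measure α) :
    ∃ C : ℝ≥0, ∀ (n : ℕ) (f : Fin n → Lp ℂ p ν),
      ENNReal.ofReal (rademacherMean fun ε => ‖rademacherSum f ε‖) ≤
        C * sqNorm p ν (fun k x => ‖f k x‖ₑ) := by
  have hr : 0 < p.toReal := zero_lt_one.trans_le (one_le_toReal hp)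
  obtain ⟨C, hC⟩ := exists_khintchine_upper_enorm hr
  refine ⟨C ^ (1 / p.toReal), fun n f => ?_⟩
  have hmeas (ε : Fin n → ℤˣ) : AEMeasurable (fun x => ‖rademacherSum f ε x‖ₑ ^ p.toReal) ν :=
    (Lp.aestronglyMeasurable _).enorm.pow_const _
  have hmeas_sq : AEMeasurable (fun x => (∑ k, ‖f k x‖ₑ ^ 2) ^ (p.toReal / 2)) ν :=
    (Finset.aemeasurable_fun_sum _ fun k _ =>
      (Lp.aestronglyMeasurable _).enorm.pow_const _).pow_const _
  have hpow : ENNReal.ofReal (rademacherMean fun ε => ‖rademacherSum f ε‖) ^ p.toReal ≤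
      C * ∫⁻ x, (∑ k, ‖f k x‖ₑ ^ 2) ^ (p.toReal / 2) ∂ν := by
    calc ENNReal.ofReal (rademacherMean fun ε => ‖rademacherSum f ε‖) ^ p.toReal
        ≤ ∑ ε, (2 ^ n)⁻¹ * ‖rademacherSum f ε‖ₑ ^ p.toReal := by
          rw [ofReal_rademacherMean fun _ => norm_nonneg _]
          simp only [ofReal_norm]
          exact ENNReal.rpow_arith_mean_le_arith_mean_rpow _ _ _ sum_inv_two_pow
            (one_le_toReal hp)
      _ = ∫⁻ x, ∑ ε, (2 ^ n)⁻¹ * ‖rademacherSum f ε x‖ₑ ^ p.toReal ∂ν := by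
          rw [lintegral_finsetSum' _ fun ε _ => (hmeas ε).const_mul _]
          simp only [enorm_rpow_toReal hp, lintegral_const_mul'' _ (hmeas _)]
      _ ≤ ∫⁻ x, C * (∑ k, ‖f k x‖ₑ ^ 2) ^ (p.toReal / 2) ∂ν := by
          refine lintegral_mono_ae ?_
          filter_upwards [eventually_all.2 fun ε => coeFn_rademacherSum ε f] with x hx
          simp only [hx]
          exact hC n _
      _ = C * ∫⁻ x, (∑ k, ‖f k x‖ₑ ^ 2) ^ (p.toReal / 2) ∂ν := lintegral_const_mul'' _ hmeas_sq
  rw [sqNorm, ENNReal.coe_rpow_of_nonneg _ (by positivity),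
    ← ENNReal.mul_rpow_of_nonneg _ _ (by positivity), one_div, ENNReal.le_rpow_inv_iff hr]
  exact hpow

/-- By the scalar Khintchine inequality the square function is pointwise dominated by the mean of
`|∑ εₖ fₖ|`, to which the triangle inequality in `L^p` applies. -/
theorem exists_sqNorm_le_rademacherMean (hp : p ≠ ∞) (ν : Measure α) :
    ∃ C : ℝ≥0, ∀ (n : ℕ) (f : Fin n → Lp ℂ p ν),
      sqNorm p ν (fun k x => ‖f k x‖ₑ) ≤
        C * ENNReal.ofReal (rademacherMean fun ε => ‖rademacherSum f ε‖) := by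
  have hp1 : 1 ≤ p := Fact.out
  have hp0 : p ≠ 0 := (zero_lt_one.trans_le hp1).ne'
  obtain ⟨C, hC⟩ := exists_khintchine_lower_enorm
  refine ⟨C, fun n f => ?_⟩
  set g : (Fin n → ℤˣ) → α → ℝ := fun ε => (2 ^ n : ℝ)⁻¹ • fun x => ‖rademacherSum f ε x‖
  have htwo : ‖(2 ^ n : ℝ)⁻¹‖ₑ = (2 ^ n)⁻¹ := by
    rw [Real.enorm_eq_ofReal (by positivity), ENNReal.ofReal_inv_of_pos (by positivity),
      ENNReal.ofReal_pow zero_le_two, ENNReal.ofReal_ofNat]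
  have hg_meas (ε : Fin n → ℤˣ) : AEStronglyMeasurable (g ε) ν :=
    (Lp.aestronglyMeasurable _).norm.const_smul _
  have hg_norm (ε : Fin n → ℤˣ) : eLpNorm (g ε) p ν = (2 ^ n)⁻¹ * ‖rademacherSum f ε‖ₑ := by
    rw [eLpNorm_const_smul, htwo, eLpNorm_norm, Lp.enorm_def]
  have hle : ∀ᵐ x ∂ν,
      ‖(∑ k, ‖f k x‖ₑ ^ 2) ^ (1 / 2 : ℝ)‖ₑ ≤ C * ‖(∑ ε, g ε) x‖ₑ := by
    filter_upwards [eventually_all.2 fun ε => coeFn_rademacherSum ε f] with x hx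
    have hnonneg (ε) (_ : ε ∈ Finset.univ) : 0 ≤ g ε x :=
      mul_nonneg (by positivity) (norm_nonneg _)
    rw [enorm_eq_self, Finset.sum_apply, Real.enorm_eq_ofReal (Finset.sum_nonneg hnonneg),
      ENNReal.ofReal_sum_of_nonneg hnonneg]
    simp only [← Real.enorm_eq_ofReal (hnonneg _ (Finset.mem_univ _))]
    simp only [g, Pi.smul_apply, enorm_smul, htwo, enorm_norm, hx]
    exact hC n _
  calc sqNorm p ν (fun k x => ‖f k x‖ₑ)
      = eLpNorm (fun x => (∑ k, ‖f k x‖ₑ ^ 2) ^ (1 / 2 : ℝ)) p ν := by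
        simp only [eLpNorm_eq_lintegral_rpow_enorm_toReal hp0 hp, enorm_eq_self,
          ← ENNReal.rpow_mul, one_div_mul_eq_div, sqNorm]
    _ ≤ C * eLpNorm (∑ ε, g ε) p ν := eLpNorm_le_nnreal_smul_eLpNorm_of_ae_le_mul' hle p
    _ ≤ C * ∑ ε, eLpNorm (g ε) p ν := by
        gcongr
        exact eLpNorm_sum_le (fun ε _ => hg_meas ε) hp1
    _ = C * ENNReal.ofReal (rademacherMean fun ε => ‖rademacherSum f ε‖) := by
        simp only [hg_norm, ofReal_rademacherMean fun _ => norm_nonneg _, ofReal_norm]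

end SquareFunction

section RadNorm

variable {X : Type*} [NormedAddCommGroup X] {n : ℕ}

/-- The norm of the Rademacher sum `∑ εₖ xₖ` in `L¹`. -/
def radNorm (x : Fin n → X) : ℝ := rademacherMean fun ε => ‖rademacherSum x ε‖

theorem radNorm_nonneg (x : Fin n → X) : 0 ≤ radNorm x :=
  rademacherMean_nonneg fun _ => norm_nonneg _

theorem radNorm_add_le (x y : Fin n → X) : radNorm (x + y) ≤ radNorm x + radNorm y := by
  rw [radNorm, radNorm, radNorm, ← rademacherMean_add]
  refine rademacherMean_mono fun ε => ?_
  rw [rademacherSum_add]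
  exact norm_add_le _ _

theorem continuous_radNorm : Continuous (radNorm : (Fin n → X) → ℝ) := by
  unfold radNorm rademacherMean rademacherSum
  fun_prop

variable [NormedSpace ℝ X]

theorem radNorm_smul (c : ℝ) (x : Fin n → X) : radNorm (c • x) = |c| * radNorm x := by
  simp only [radNorm, rademacherSum_smul, norm_smul, Real.norm_eq_abs, rademacherMean_const_mul]

theorem convexOn_radNorm : ConvexOn ℝ univ (radNorm : (Fin n → X) → ℝ) := by
  refine ⟨convex_univ, fun x _ y _ a b ha hb _ => (radNorm_add_le _ _).trans_eq ?_⟩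
  rw [radNorm_smul, radNorm_smul, abs_of_nonneg ha, abs_of_nonneg hb, smul_eq_mul, smul_eq_mul]

theorem radNorm_le_of_mem_closure_convexHull {C : ℝ} {s : Fin n → Set X}
    (hs : ∀ y : Fin n → X, (∀ k, y k ∈ s k) → radNorm y ≤ C) {y : Fin n → X}
    (hy : ∀ k, y k ∈ closure (convexHull ℝ (s k))) : radNorm y ≤ C := by
  have hconvex : Convex ℝ {y : Fin n → X | radNorm y ≤ C} := by
    simpa using convexOn_radNorm.convex_le C
  have hsubset : closure (convexHull ℝ (univ.pi s)) ⊆ {y : Fin n → X | radNorm y ≤ C} :=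
    closure_minimal (convexHull_min (fun y hy => hs y fun k => hy k trivial) hconvex)
      (isClosed_le continuous_radNorm continuous_const)
  rw [convexHull_pi, closure_pi_set] at hsubset
  exact hsubset fun k _ => hy k

end RadNorm

section BallMaximal

open Metric Module

variable {E : Type*} [NormedAddCommGroup E] [NormedSpace ℝ E] [FiniteDimensional ℝ E]
  [MeasurableSpace E] [BorelSpace E] (μ : Measure E) [μ.IsAddHaarMeasure]

theorem measure_ball_four_mul_le {F : E → ℝ≥0∞} {c : ℝ≥0∞} (hc0 : c ≠ 0) (hc : c ≠ ∞) {x : E}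
    {r : ℝ} (hr : c * μ (ball x r) ≤ ∫⁻ y in ball x r, F y ∂μ) :
    μ (ball x (4 * r)) ≤ 4 ^ finrank ℝ E * c⁻¹ * ∫⁻ y in ball x r, F y ∂μ := by
  rw [Measure.addHaar_ball_mul_of_pos _ _ (by norm_num : (0 : ℝ) < 4),
    ENNReal.ofReal_pow (by norm_num), ENNReal.ofReal_ofNat, mul_assoc,
    ← Measure.addHaar_ball_center μ x]
  gcongr
  rw [← ENNReal.div_eq_inv_mul, ENNReal.le_div_iff_mul_le (Or.inl hc0) (Or.inl hc), mul_comm]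
  exact hr

/-- The radii are bounded by `R` because the Vitali covering lemma needs a bound. -/
theorem measure_exists_lt_lintegral_ball_le_of_radius_le {F : E → ℝ≥0∞} {c : ℝ≥0∞}
    (hc0 : c ≠ 0) (hc : c ≠ ∞) (R : ℝ) :
    μ {x | ∃ r > 0, r ≤ R ∧ c * μ (ball x r) < ∫⁻ y in ball x r, F y ∂μ} ≤
      4 ^ finrank ℝ E * c⁻¹ * ∫⁻ x, F x ∂μ := by
  set s := {x | ∃ r > 0, r ≤ R ∧ c * μ (ball x r) < ∫⁻ y in ball x r, F y ∂μ}
  choose! r hr0 hrR hr using fun (x : E) (hx : x ∈ s) => hx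
  obtain ⟨u, hus, hdisj, hcover⟩ := Vitali.exists_disjoint_subfamily_covering_enlargement_ball
    s id r R hrR 4 (by norm_num)
  change u.PairwiseDisjoint fun x => ball x (r x) at hdisj
  have hu : u.Countable := hdisj.countable_of_isOpen (fun _ _ => isOpen_ball)
    fun x hx => nonempty_ball.2 (hr0 x (hus hx))
  have hs : s ⊆ ⋃ x ∈ u, ball x (4 * r x) := fun x hx => by
    obtain ⟨y, hy, hxy⟩ := hcover x hx
    exact mem_biUnion hy (hxy (mem_ball_self (hr0 x hx)))
  calc μ s ≤ ∑' x : u, μ (ball (x : E) (4 * r x)) :=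
        (measure_mono hs).trans (measure_biUnion_le _ hu _)
    _ ≤ ∑' x : u, 4 ^ finrank ℝ E * c⁻¹ * ∫⁻ y in ball (x : E) (r x), F y ∂μ :=
        ENNReal.tsum_le_tsum fun x => measure_ball_four_mul_le μ hc0 hc (hr x (hus x.2)).le
    _ = 4 ^ finrank ℝ E * c⁻¹ * ∫⁻ y in ⋃ x ∈ u, ball x (r x), F y ∂μ := by
        rw [ENNReal.tsum_mul_left, lintegral_biUnion hu (fun _ _ => measurableSet_ball) hdisj]
    _ ≤ 4 ^ finrank ℝ E * c⁻¹ * ∫⁻ x, F x ∂μ := by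
        gcongr
        exact Measure.restrict_le_self

theorem measure_exists_lt_lintegral_ball_le {F : E → ℝ≥0∞} {c : ℝ≥0∞} (hc0 : c ≠ 0)
    (hc : c ≠ ∞) :
    μ {x | ∃ r > 0, c * μ (ball x r) < ∫⁻ y in ball x r, F y ∂μ} ≤
      4 ^ finrank ℝ E * c⁻¹ * ∫⁻ x, F x ∂μ := by
  set s : ℕ → Set E := fun R =>
    {x | ∃ r > 0, r ≤ (R : ℝ) ∧ c * μ (ball x r) < ∫⁻ y in ball x r, F y ∂μ}
  have hs : Monotone s := fun R R' h x ⟨r, hr, hrR, hx⟩ =>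
    ⟨r, hr, hrR.trans (mod_cast h), hx⟩
  have hsubset : {x | ∃ r > 0, c * μ (ball x r) < ∫⁻ y in ball x r, F y ∂μ} ⊆ ⋃ R, s R := by
    rintro x ⟨r, hr, hx⟩
    obtain ⟨R, hR⟩ := exists_nat_ge r
    exact mem_iUnion.2 ⟨R, r, hr, hR, hx⟩
  refine (measure_mono hsubset).trans ?_
  rw [hs.measure_iUnion]
  exact iSup_le fun R => measure_exists_lt_lintegral_ball_le_of_radius_le μ hc0 hc R

end BallMaximal

section GaussAverage

open Metric Module

variable {E : Type*} [NormedAddCommGroup E]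

/-- The Gaussian `exp (-|x|² / b)`. -/
def gauss (b : ℝ) (x : E) : ℝ≥0∞ := ENNReal.ofReal (Real.exp (-(‖x‖ ^ 2 / b)))

theorem gauss_neg (b : ℝ) (x : E) : gauss b (-x) = gauss b x := by rw [gauss, norm_neg, gauss]

theorem gauss_sub_comm (b : ℝ) (x y : E) : gauss b (x - y) = gauss b (y - x) := by
  rw [← neg_sub, gauss_neg]

theorem gauss_le_one {b : ℝ} (hb : 0 ≤ b) (x : E) : gauss b x ≤ 1 := by
  rw [gauss, ENNReal.ofReal_le_one, Real.exp_le_one_iff, neg_nonpos]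
  positivity

theorem gauss_mono {b c : ℝ} (hb : 0 < b) (hbc : b ≤ c) (x : E) : gauss b x ≤ gauss c x := by
  unfold gauss
  gcongr

variable [MeasurableSpace E] [BorelSpace E]

@[fun_prop]
theorem measurable_gauss (b : ℝ) : Measurable (gauss b : E → ℝ≥0∞) := by
  unfold gauss
  fun_prop

variable [InnerProductSpace ℝ E] [FiniteDimensional ℝ E] {b : ℝ}

variable (E) in
/-- The total mass of the Gaussian `exp (-|x|² / b)`. -/
def gaussMass (b : ℝ) : ℝ≥0∞ := ∫⁻ x : E, gauss b x

variable (E) in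
theorem gaussMass_eq (hb : 0 < b) :
    gaussMass E b = ENNReal.ofReal ((π * b) ^ (finrank ℝ E / 2 : ℝ)) := by
  have hintegral :=
    GaussianFourier.integral_rexp_neg_mul_sq_norm (V := E) (b := b⁻¹) (by positivity)
  have hintegrable : Integrable fun v : E => Real.exp (-b⁻¹ * ‖v‖ ^ 2) :=
    Integrable.of_integral_ne_zero (hintegral ▸ by positivity)
  rw [← div_inv_eq_mul, ← hintegral, ofReal_integral_eq_lintegral_ofReal hintegrable
    (ae_of_all _ fun _ => (Real.exp_pos _).le)]
  simp only [gaussMass, gauss, div_eq_inv_mul, neg_mul]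

variable (E) in
theorem gaussMass_ne_zero (hb : 0 < b) : gaussMass E b ≠ 0 := by
  rw [gaussMass_eq E hb, ENNReal.ofReal_ne_zero_iff]
  positivity

variable (E) in
theorem gaussMass_ne_top (hb : 0 < b) : gaussMass E b ≠ ∞ := by
  rw [gaussMass_eq E hb]
  exact ENNReal.ofReal_ne_top

theorem lintegral_gauss_sub (b : ℝ) (x : E) : ∫⁻ y, gauss b (x - y) = gaussMass E b :=
  lintegral_sub_left_eq_self (gauss b) x

/-- The average of `F` around `x` with Gaussian weight `exp (-|x - y|² / b)`. -/
def gaussAvg (b : ℝ) (F : E → ℝ≥0∞) (x : E) : ℝ≥0∞ :=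
  (gaussMass E b)⁻¹ * ∫⁻ y, gauss b (x - y) * F y

/-- The probability measure with respect to which `gaussAvg b F x` is the mean of `F`. -/
def gaussMeasure (b : ℝ) (x : E) : Measure E :=
  (gaussMass E b)⁻¹ • volume.withDensity fun y => gauss b (x - y)

theorem isProbabilityMeasure_gaussMeasure (hb : 0 < b) (x : E) :
    IsProbabilityMeasure (gaussMeasure b x) := by
  constructor
  rw [gaussMeasure, Measure.smul_apply, withDensity_apply _ MeasurableSet.univ,
    setLIntegral_univ, lintegral_gauss_sub, smul_eq_mul,
    ENNReal.inv_mul_cancel (gaussMass_ne_zero E hb) (gaussMass_ne_top E hb)]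

theorem gaussAvg_eq_lintegral {F : E → ℝ≥0∞} (hF : Measurable F) (x : E) :
    gaussAvg b F x = ∫⁻ y, F y ∂gaussMeasure b x := by
  rw [gaussMeasure, lintegral_smul_measure,
    lintegral_withDensity_eq_lintegral_mul _ (by fun_prop) hF]
  rfl

theorem gaussAvg_const (hb : 0 < b) (c : ℝ≥0∞) (x : E) : gaussAvg b (fun _ => c) x = c := by
  have := isProbabilityMeasure_gaussMeasure hb x
  rw [gaussAvg_eq_lintegral measurable_const, lintegral_const, measure_univ, mul_one]

theorem gaussAvg_mono {F G : E → ℝ≥0∞} (h : ∀ y, F y ≤ G y) (x : E) :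
    gaussAvg b F x ≤ gaussAvg b G x := by
  unfold gaussAvg
  gcongr with y
  exact h y

theorem gaussAvg_add {F G : E → ℝ≥0∞} (hF : Measurable F) (x : E) :
    gaussAvg b (fun y => F y + G y) x = gaussAvg b F x + gaussAvg b G x := by
  simp only [gaussAvg, mul_add]
  rw [lintegral_add_left (by fun_prop), mul_add]

theorem gaussAvg_le_inv_gaussMass_mul (hb : 0 ≤ b) (F : E → ℝ≥0∞) (x : E) :
    gaussAvg b F x ≤ (gaussMass E b)⁻¹ * ∫⁻ y, F y := by
  unfold gaussAvg
  gcongr with y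
  exact mul_le_of_le_one_left zero_le (gauss_le_one hb _)

@[fun_prop]
theorem measurable_gaussAvg {F : E → ℝ≥0∞} (hF : Measurable F) : Measurable (gaussAvg b F) :=
  (Measurable.lintegral_prod_right' (f := fun z : E × E => gauss b (z.1 - z.2) * F z.2)
    (by fun_prop)).const_mul _

theorem lintegral_gaussAvg_mul {F G : E → ℝ≥0∞} (hF : Measurable F) (hG : Measurable G) :
    ∫⁻ x, gaussAvg b F x * G x = ∫⁻ x, F x * gaussAvg b G x := by
  have hiterated {F' G' : E → ℝ≥0∞} (hF' : Measurable F') (hG' : Measurable G') :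
      ∫⁻ x, gaussAvg b F' x * G' x =
        (gaussMass E b)⁻¹ * ∫⁻ x, ∫⁻ y, gauss b (x - y) * F' y * G' x := by
    have hmeas : Measurable fun z : E × E => gauss b (z.1 - z.2) * F' z.2 * G' z.1 := by
      fun_prop
    rw [← lintegral_const_mul _ hmeas.lintegral_prod_right']
    refine lintegral_congr fun x => ?_
    dsimp only
    rw [gaussAvg, lintegral_mul_const _ (by fun_prop), mul_assoc]
  have hmeas : Measurable fun z : E × E => gauss b (z.1 - z.2) * F z.2 * G z.1 := by fun_prop
  simp only [mul_comm (F _)]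
  rw [hiterated hF hG, hiterated hG hF, lintegral_lintegral_swap hmeas.aemeasurable]
  congr 1
  refine lintegral_congr fun x => lintegral_congr fun y => ?_
  rw [gauss_sub_comm, mul_right_comm]

theorem lintegral_gaussAvg (hb : 0 < b) {F : E → ℝ≥0∞} (hF : Measurable F) :
    ∫⁻ x, gaussAvg b F x = ∫⁻ x, F x := by
  simpa only [gaussAvg_const hb, mul_one] using
    lintegral_gaussAvg_mul (b := b) hF (measurable_const (a := (1 : ℝ≥0∞)))

theorem gaussAvg_rpow_le {r : ℝ} (hb : 0 < b) (hr : 1 ≤ r) {F : E → ℝ≥0∞} (hF : Measurable F)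
    (x : E) : gaussAvg b F x ^ r ≤ gaussAvg b (fun y => F y ^ r) x := by
  have := isProbabilityMeasure_gaussMeasure hb x
  have hr0 : 0 < r := by positivity
  have h := eLpNorm'_le_eLpNorm'_of_exponent_le one_pos hr (gaussMeasure b x)
    hF.aestronglyMeasurable
  simp only [eLpNorm'_eq_lintegral_enorm, enorm_eq_self, ENNReal.rpow_one, div_one] at h
  rw [gaussAvg_eq_lintegral hF, gaussAvg_eq_lintegral (by fun_prop)]
  rwa [one_div, ENNReal.le_rpow_inv_iff hr0] at h

theorem lintegral_gaussAvg_rpow_le {r : ℝ} (hb : 0 < b) (hr : 1 ≤ r) {F : E → ℝ≥0∞}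
    (hF : Measurable F) : ∫⁻ x, gaussAvg b F x ^ r ≤ ∫⁻ x, F x ^ r :=
  (lintegral_mono fun x => gaussAvg_rpow_le hb hr hF x).trans
    (lintegral_gaussAvg hb (by fun_prop)).le

/-- The layer cake formula writes a Gaussian average as a superposition of integrals over
balls. -/
theorem lintegral_gauss_mul (hb : 0 < b) {F : E → ℝ≥0∞} (hF : Measurable F) (x : E) :
    ∫⁻ y, gauss b (x - y) * F y =
      ∫⁻ t in Ioi (0 : ℝ), ∫⁻ y in ball x √(b * -Real.log t), F y := by
  have hlevel {t : ℝ} (ht : 0 < t) :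
      {y | t < Real.exp (-(‖x - y‖ ^ 2 / b))} = ball x √(b * -Real.log t) := by
    ext y
    rw [mem_ofPred_eq, mem_ball, dist_comm, dist_eq_norm, ← Real.log_lt_iff_lt_exp ht,
      Real.lt_sqrt (norm_nonneg _), lt_neg, div_lt_iff₀ hb, mul_comm b]
  calc ∫⁻ y, gauss b (x - y) * F y
      = ∫⁻ y, gauss b (x - y) ∂volume.withDensity F := by
        rw [lintegral_withDensity_eq_lintegral_mul _ hF (by fun_prop)]
        simp only [Pi.mul_apply, mul_comm]
    _ = ∫⁻ t in Ioi 0, volume.withDensity F {y | t < Real.exp (-(‖x - y‖ ^ 2 / b))} :=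
        lintegral_eq_lintegral_meas_lt _ (ae_of_all _ fun _ => (Real.exp_pos _).le)
          (by fun_prop)
    _ = ∫⁻ t in Ioi 0, ∫⁻ y in ball x √(b * -Real.log t), F y := by
        refine setLIntegral_congr_fun measurableSet_Ioi fun t ht => ?_
        rw [hlevel ht, withDensity_apply _ measurableSet_ball]

theorem exists_lt_lintegral_ball_of_lt_gaussAvg (hb : 0 < b) {F : E → ℝ≥0∞}
    (hF : Measurable F) {x : E} {c : ℝ≥0∞} (hc : c < gaussAvg b F x) :
    ∃ r > 0, c * volume (ball x r) < ∫⁻ y in ball x r, F y := by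
  by_contra! hball
  refine hc.not_ge ?_
  rw [← gaussAvg_const hb c x, gaussAvg, gaussAvg, lintegral_gauss_mul hb hF,
    lintegral_gauss_mul hb measurable_const]
  refine mul_le_mul_right (lintegral_mono fun t => ?_) _
  rw [setLIntegral_const]
  rcases (Real.sqrt_nonneg (b * -Real.log t)).eq_or_lt with h | h
  · rw [← h, ball_zero, setLIntegral_empty]
    exact zero_le
  · exact hball _ h

theorem volume_exists_lt_gaussAvg_le {ι : Type*} {b : ι → ℝ} (hb : ∀ i, 0 < b i)
    {F : E → ℝ≥0∞} (hF : Measurable F) {c : ℝ≥0∞} (hc0 : c ≠ 0) (hc : c ≠ ∞) :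
    volume {x : E | ∃ i, c < gaussAvg (b i) F x} ≤ 4 ^ finrank ℝ E * c⁻¹ * ∫⁻ x, F x :=
  (measure_mono fun _ hx => hx.elim fun i hi =>
    exists_lt_lintegral_ball_of_lt_gaussAvg (hb i) hF hi).trans
    (measure_exists_lt_lintegral_ball_le volume hc0 hc)

end GaussAverage

section LayerCake

theorem lintegral_Ioo_rpow {s r : ℝ} (hs : 0 ≤ s) (hr : 0 < r) :
    ∫⁻ t in Ioo 0 s, ENNReal.ofReal (t ^ (r - 1)) = ENNReal.ofReal s ^ r / ENNReal.ofReal r := by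
  have hintegrable : IntegrableOn (fun t : ℝ => t ^ (r - 1)) (Ioc 0 s) :=
    (intervalIntegrable_iff_integrableOn_Ioc_of_le hs).1
      (intervalIntegral.intervalIntegrable_rpow' (by linarith))
  rw [setLIntegral_congr Ioo_ae_eq_Ioc, ← ofReal_integral_eq_lintegral_ofReal hintegrable
      (ae_restrict_of_forall_mem measurableSet_Ioc fun t ht => Real.rpow_nonneg ht.1.le _),
    ← intervalIntegral.integral_of_le hs, integral_rpow (Or.inl (by linarith)),
    sub_add_cancel, Real.zero_rpow hr.ne', sub_zero, ENNReal.ofReal_div_of_pos hr,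
    ENNReal.ofReal_rpow_of_nonneg hs hr.le]

theorem lintegral_Ioi_rpow {r : ℝ} (hr : 0 < r) :
    ∫⁻ t in Ioi (0 : ℝ), ENNReal.ofReal (t ^ (r - 1)) = ∞ := by
  have hlim : Tendsto (fun s : ℝ => ENNReal.ofReal s ^ r / ENNReal.ofReal r) atTop (𝓝 ∞) := by
    have h : Tendsto (fun s : ℝ => ENNReal.ofReal (s ^ r / r)) atTop (𝓝 ∞) :=
      ENNReal.tendsto_ofReal_atTop.comp ((tendsto_rpow_atTop hr).atTop_div_const hr)
    refine h.congr' ?_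
    filter_upwards [eventually_ge_atTop 0] with s hs
    rw [ENNReal.ofReal_div_of_pos hr, ENNReal.ofReal_rpow_of_nonneg hs hr.le]
  refine top_le_iff.1 (le_of_tendsto hlim ?_)
  filter_upwards [eventually_ge_atTop 0] with s hs
  rw [← lintegral_Ioo_rpow hs hr]
  exact lintegral_mono_set Ioo_subset_Ioi_self

theorem lintegral_indicator_lt_rpow (a : ℝ≥0∞) {r : ℝ} (hr : 0 < r) :
    ∫⁻ t in Ioi (0 : ℝ), {t : ℝ | ENNReal.ofReal t < a}.indicator
      (fun t => ENNReal.ofReal (t ^ (r - 1))) t = a ^ r / ENNReal.ofReal r := by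
  rw [setLIntegral_indicator (measurableSet_lt ENNReal.measurable_ofReal measurable_const)]
  induction a using ENNReal.recTopCoe with
  | top =>
    simp only [ENNReal.ofReal_lt_top, ofPred_true, univ_inter]
    rw [lintegral_Ioi_rpow hr, ENNReal.top_rpow_of_pos hr,
      ENNReal.top_div_of_ne_top ENNReal.ofReal_ne_top]
  | coe a =>
    have hset : {t : ℝ | ENNReal.ofReal t < a} ∩ Ioi 0 = Ioo 0 (a : ℝ) := by
      ext t
      rw [mem_inter_iff, and_comm]
      refine and_congr_right fun ht => ?_
      rw [mem_ofPred_eq, ENNReal.ofReal_lt_iff_lt_toReal (mem_Ioi.1 ht).le ENNReal.coe_ne_top,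
        ENNReal.coe_toReal]
    rw [hset, lintegral_Ioo_rpow a.coe_nonneg hr, ENNReal.ofReal_coe_nnreal]

theorem lintegral_mul_rpow_eq_lintegral_meas_lt {α : Type*} [MeasurableSpace α] {μ : Measure α}
    [SFinite μ] {f M : α → ℝ≥0∞} (hf : Measurable f) (hM : Measurable M) {r : ℝ} (hr : 0 < r) :
    ∫⁻ x, f x * M x ^ r ∂μ = ENNReal.ofReal r * ∫⁻ t in Ioi (0 : ℝ),
      ENNReal.ofReal (t ^ (r - 1)) * ∫⁻ x in {x | ENNReal.ofReal t < M x}, f x ∂μ := by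
  set k : α × ℝ → ℝ≥0∞ := {z | ENNReal.ofReal z.2 < M z.1}.indicator
    fun z => f z.1 * ENNReal.ofReal (z.2 ^ (r - 1))
  have hk : Measurable k :=
    Measurable.indicator (by fun_prop) (measurableSet_lt (by fun_prop) (by fun_prop))
  have hk_snd (x : α) : f x * M x ^ r = ENNReal.ofReal r * ∫⁻ t in Ioi (0 : ℝ), k (x, t) := by
    have h : ∀ t, k (x, t) = f x * {t : ℝ | ENNReal.ofReal t < M x}.indicator
        (fun t => ENNReal.ofReal (t ^ (r - 1))) t := fun t => by
      simp only [k, indicator, mem_ofPred_eq, mul_ite, mul_zero]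
    simp only [h]
    rw [lintegral_const_mul, lintegral_indicator_lt_rpow _ hr, mul_left_comm,
      ENNReal.mul_div_cancel (by simpa using hr) ENNReal.ofReal_ne_top]
    exact Measurable.indicator (by fun_prop) (measurableSet_lt (by fun_prop) (by fun_prop))
  have hk_fst (t : ℝ) : ∫⁻ x, k (x, t) ∂μ =
      ENNReal.ofReal (t ^ (r - 1)) * ∫⁻ x in {x | ENNReal.ofReal t < M x}, f x ∂μ := by
    rw [← lintegral_const_mul _ hf,
      ← lintegral_indicator (measurableSet_lt measurable_const hM)]
    refine lintegral_congr fun x => ?_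
    simp only [k, indicator, mem_ofPred_eq, mul_comm]
  simp only [hk_snd, ← hk_fst]
  rw [lintegral_const_mul _ hk.lintegral_prod_right',
    lintegral_lintegral_swap (f := fun x t => k (x, t)) hk.aemeasurable]

/-- Marcinkiewicz interpolation between weak `(1, 1)` and `L^∞`. -/
theorem lintegral_rpow_le_of_measure_lt_le {α : Type*} [MeasurableSpace α] {μ : Measure α}
    [SFinite μ] {g M : α → ℝ≥0∞} (hg : Measurable g) (hM : Measurable M) {D : ℝ≥0∞} {q : ℝ}
    (hq : 1 < q)
    (hweak : ∀ t : ℝ, 0 < t → μ {x | ENNReal.ofReal t < M x} ≤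
      D * (ENNReal.ofReal t)⁻¹ * ∫⁻ x in {x | ENNReal.ofReal t < 2 * g x}, g x ∂μ) :
    ∫⁻ x, M x ^ q ∂μ ≤
      ENNReal.ofReal q * D * (2 ^ (q - 1) / ENNReal.ofReal (q - 1)) * ∫⁻ x, g x ^ q ∂μ := by
  have hq1 : 0 < q - 1 := sub_pos.2 hq
  have hmeas : Measurable fun t : ℝ => ENNReal.ofReal (t ^ (q - 1 - 1)) *
      ∫⁻ x in {x | ENNReal.ofReal t < 2 * g x}, g x ∂μ := by
    refine Measurable.mul (by fun_prop) (Antitone.measurable fun s t hst => ?_)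
    exact lintegral_mono_set fun x hx => (ENNReal.ofReal_le_ofReal hst).trans_lt hx
  have hpow (x : α) : g x * (2 * g x) ^ (q - 1) = 2 ^ (q - 1) * g x ^ q := by
    have h := ENNReal.rpow_add_of_nonneg (x := g x) 1 (q - 1) zero_le_one hq1.le
    rw [add_sub_cancel, ENNReal.rpow_one] at h
    rw [ENNReal.mul_rpow_of_nonneg _ _ hq1.le, h, mul_left_comm]
  have hcut := lintegral_mul_rpow_eq_lintegral_meas_lt (μ := μ) hg (hg.const_mul 2) hq1
  simp only [hpow] at hcut
  rw [lintegral_const_mul _ (by fun_prop)] at hcut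
  calc ∫⁻ x, M x ^ q ∂μ
      = ENNReal.ofReal q * ∫⁻ t in Ioi (0 : ℝ),
          ENNReal.ofReal (t ^ (q - 1)) * μ {x | ENNReal.ofReal t < M x} := by
        simpa only [one_mul, setLIntegral_one] using
          lintegral_mul_rpow_eq_lintegral_meas_lt (μ := μ) (f := fun _ => 1) measurable_const hM
            (by positivity)
    _ ≤ ENNReal.ofReal q * ∫⁻ t in Ioi (0 : ℝ), D * (ENNReal.ofReal (t ^ (q - 1 - 1)) *
          ∫⁻ x in {x | ENNReal.ofReal t < 2 * g x}, g x ∂μ) := by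
        gcongr ENNReal.ofReal q * ?_
        refine setLIntegral_mono' measurableSet_Ioi fun t (ht : 0 < t) => ?_
        grw [hweak t ht]
        rw [Real.rpow_sub_one ht.ne' (q - 1), ENNReal.ofReal_div_of_pos ht, div_eq_mul_inv]
        exact le_of_eq (by ring)
    _ = ENNReal.ofReal q * D * (2 ^ (q - 1) / ENNReal.ofReal (q - 1)) *
          ∫⁻ x, g x ^ q ∂μ := by
        rw [lintegral_const_mul _ hmeas, mul_assoc, mul_assoc, ← ENNReal.mul_div_right_comm,
          hcut, ENNReal.mul_div_right_comm,
          ENNReal.div_self (by simpa using hq) ENNReal.ofReal_ne_top, one_mul]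

end LayerCake

section Maximal

open scoped NNReal
open Module

variable {E : Type*} [NormedAddCommGroup E] [InnerProductSpace ℝ E] [FiniteDimensional ℝ E]
  [MeasurableSpace E] [BorelSpace E]

/-- The part of `g` below height `t / 2` contributes at most `t / 2` to each average. -/
theorem volume_lt_iSup_gaussAvg_le {ι : Type*} {b : ι → ℝ} (hb : ∀ i, 0 < b i) {g : E → ℝ≥0∞}
    (hg : Measurable g) {t : ℝ} (ht : 0 < t) :
    volume {x : E | ENNReal.ofReal t < ⨆ i, gaussAvg (b i) g x} ≤
      4 ^ finrank ℝ E * 2 * (ENNReal.ofReal t)⁻¹ *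
        ∫⁻ x in {x | ENNReal.ofReal t < 2 * g x}, g x := by
  set c := ENNReal.ofReal (t / 2)
  have htc : ENNReal.ofReal t = 2 * c := by
    rw [← ENNReal.ofReal_ofNat, ← ENNReal.ofReal_mul zero_le_two, mul_div_cancel₀ t two_ne_zero]
  have hc : c ≠ 0 := by simpa [c] using ht
  set s := {x | ENNReal.ofReal t < 2 * g x}
  have hs : MeasurableSet s := measurableSet_lt measurable_const (by fun_prop)
  have hg_le (y : E) : g y ≤ s.indicator g y + c := by
    by_cases hy : y ∈ s
    · rw [indicator_of_mem hy]
      exact le_self_add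
    · rw [indicator_of_notMem hy, zero_add,
        ← ENNReal.mul_le_mul_iff_right two_ne_zero ENNReal.ofNat_ne_top, ← htc]
      exact not_lt.1 hy
  have hsubset : {x : E | ENNReal.ofReal t < ⨆ i, gaussAvg (b i) g x} ⊆
      {x | ∃ i, c < gaussAvg (b i) (s.indicator g) x} := fun x hx => by
    obtain ⟨i, hi⟩ := lt_iSup_iff.1 (mem_ofPred_eq ▸ hx)
    refine ⟨i, lt_of_add_lt_add_right (a := c) ?_⟩
    calc c + c = ENNReal.ofReal t := by rw [htc, two_mul]
      _ < gaussAvg (b i) g x := hi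
      _ ≤ gaussAvg (b i) (s.indicator g) x + c := by
        conv_rhs => rw [← gaussAvg_const (hb i) c x, ← gaussAvg_add (hg.indicator hs)]
        exact gaussAvg_mono hg_le x
  calc volume {x : E | ENNReal.ofReal t < ⨆ i, gaussAvg (b i) g x}
      ≤ 4 ^ finrank ℝ E * c⁻¹ * ∫⁻ x, s.indicator g x :=
        (measure_mono hsubset).trans
          (volume_exists_lt_gaussAvg_le hb (hg.indicator hs) hc ENNReal.ofReal_ne_top)
    _ = 4 ^ finrank ℝ E * 2 * (ENNReal.ofReal t)⁻¹ * ∫⁻ x in s, g x := by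
        rw [lintegral_indicator hs, htc, ENNReal.mul_inv (Or.inl two_ne_zero) (Or.inr hc),
          mul_assoc _ 2, ← mul_assoc 2, ENNReal.mul_inv_cancel two_ne_zero ENNReal.ofNat_ne_top,
          one_mul]

variable (E) in
theorem exists_lintegral_iSup_gaussAvg_le {q : ℝ} (hq : 1 < q) :
    ∃ C : ℝ≥0, ∀ {n : ℕ} {b : Fin n → ℝ} {g : E → ℝ≥0∞}, (∀ k, 0 < b k) → Measurable g →
      ∫⁻ x, (⨆ k, gaussAvg (b k) g x) ^ q ≤ C * ∫⁻ x, g x ^ q := by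
  set C : ℝ≥0∞ := ENNReal.ofReal q * (4 ^ finrank ℝ E * 2) *
    (2 ^ (q - 1) / ENNReal.ofReal (q - 1))
  have hC : C ≠ ∞ := by
    have hpow : (2 : ℝ≥0∞) ^ (q - 1) ≠ ∞ :=
      ENNReal.rpow_ne_top_of_nonneg (sub_pos.2 hq).le ENNReal.ofNat_ne_top
    have hq1 : ENNReal.ofReal (q - 1) ≠ 0 := by simpa using hq
    finiteness
  refine ⟨C.toNNReal, fun hb hg => ?_⟩
  rw [ENNReal.coe_toNNReal hC]
  exact lintegral_rpow_le_of_measure_lt_le hg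
    (Measurable.iSup fun k => measurable_gaussAvg hg) hq
    fun t ht => volume_lt_iSup_gaussAvg_le hb hg ht

end Maximal

section SquareSum

variable {ι : Type*} [Fintype ι]

theorem sq_rpow_half (a : ℝ≥0∞) (r : ℝ) : (a ^ 2) ^ (r / 2) = a ^ r := by
  rw [← ENNReal.rpow_natCast, ← ENNReal.rpow_mul, Nat.cast_ofNat, mul_div_cancel₀ r two_ne_zero]

theorem sum_rpow_le_sum_mul_rpow (c : ι → ℝ≥0∞) {r : ℝ} (hr : 0 < r) :
    (∑ i, c i) ^ r ≤ ∑ i, (Fintype.card ι * c i) ^ r := by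
  rcases isEmpty_or_nonempty ι with h | h
  · simp only [Finset.univ_eq_empty, Finset.sum_empty, ENNReal.zero_rpow_of_pos hr, le_refl]
  obtain ⟨j, -, hj⟩ := Finset.exists_max_image Finset.univ c Finset.univ_nonempty
  calc (∑ i, c i) ^ r ≤ (Fintype.card ι * c j) ^ r := by
        gcongr
        rw [← nsmul_eq_mul]
        exact Finset.sum_le_card_nsmul Finset.univ c (c j) hj
    _ ≤ ∑ i, (Fintype.card ι * c i) ^ r :=
        Finset.single_le_sum (f := fun i => (Fintype.card ι * c i) ^ r) (fun _ _ => zero_le)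
          (Finset.mem_univ j)

theorem lintegral_sum_sq_rpow_ne_top_iff {α : Type*} [MeasurableSpace α] {μ : Measure α}
    {p : ℝ} (hp : 0 < p) {F : ι → α → ℝ≥0∞} (hF : ∀ i, Measurable (F i)) :
    ∫⁻ x, (∑ i, F i x ^ 2) ^ (p / 2) ∂μ ≠ ∞ ↔ ∀ i, ∫⁻ x, F i x ^ p ∂μ ≠ ∞ := by
  constructor
  · refine fun h i => ne_top_of_le_ne_top h (lintegral_mono fun x => ?_)
    rw [← sq_rpow_half]
    gcongr
    exact Finset.single_le_sum (f := fun i => F i x ^ 2) (fun _ _ => zero_le) (Finset.mem_univ i)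
  · intro h
    have hle : ∫⁻ x, (∑ i, F i x ^ 2) ^ (p / 2) ∂μ ≤
        ∑ i, (Fintype.card ι : ℝ≥0∞) ^ (p / 2) * ∫⁻ x, F i x ^ p ∂μ := by
      simp only [← lintegral_const_mul _ ((hF _).pow_const p)]
      rw [← lintegral_finsetSum _ fun i _ => by fun_prop]
      refine lintegral_mono fun x => (sum_rpow_le_sum_mul_rpow _ (half_pos hp)).trans_eq ?_
      simp only [ENNReal.mul_rpow_of_nonneg _ _ (half_pos hp).le, sq_rpow_half]
    exact ne_top_of_le_ne_top (ENNReal.sum_ne_top.2 fun i _ => ENNReal.mul_ne_top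
      (ENNReal.rpow_ne_top_of_nonneg (half_pos hp).le (ENNReal.natCast_ne_top _)) (h i)) hle

/-- Closes the Hölder estimates below, in which a finite quantity `D` bounds itself. -/
theorem le_rpow_sub_one_mul_of_le_rpow_mul_rpow {C D X : ℝ≥0∞} {r s : ℝ}
    (hrs : r.HolderConjugate s) (hD : D ≠ ∞) (h : D ≤ X ^ (1 / r) * (C * D) ^ (1 / s)) :
    D ≤ C ^ (r - 1) * X := by
  rcases eq_or_ne D 0 with rfl | hD0
  · exact zero_le
  have hD_eq : D ^ (1 / r) * D ^ (1 / s) = D := by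
    rw [← ENNReal.rpow_add _ _ hD0 hD, one_div, one_div, hrs.inv_add_inv_eq_one,
      ENNReal.rpow_one]
  have hroot : D ^ (1 / r) ≤ C ^ (1 / s) * X ^ (1 / r) := by
    refine (ENNReal.mul_le_mul_iff_left (ENNReal.rpow_pos (pos_iff_ne_zero.2 hD0) hD).ne'
      (ENNReal.rpow_ne_top_of_nonneg hrs.symm.one_div_nonneg hD)).1 (hD_eq.trans_le ?_)
    rwa [ENNReal.mul_rpow_of_nonneg _ _ hrs.symm.one_div_nonneg, mul_left_comm,
      ← mul_assoc] at h
  rwa [one_div, ENNReal.rpow_inv_le_iff hrs.pos, ENNReal.mul_rpow_of_nonneg _ _ hrs.nonneg,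
    ENNReal.rpow_inv_rpow hrs.ne_zero, ← ENNReal.rpow_mul, one_div_mul_eq_div,
    hrs.div_conj_eq_sub_one] at hroot

end SquareSum

section SquareSumDuality

variable {ι : Type*} [Fintype ι] {p q : ℝ}

theorem sum_sq_mul_rpow_le (hpq : p.HolderConjugate q) (hp : p < 2) (a : ι → ℝ≥0∞) :
    (∑ i, (a i * (∑ j, a j ^ 2) ^ (p / 2 - 1)) ^ 2) ^ (q / 2) ≤ (∑ i, a i ^ 2) ^ (p / 2) := by
  set Q := ∑ i, a i ^ 2
  have hsum : ∑ i, (a i * Q ^ (p / 2 - 1)) ^ 2 = Q * Q ^ (p - 2) := by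
    simp only [mul_pow, ← Finset.sum_mul]
    rw [← ENNReal.rpow_natCast, ← ENNReal.rpow_mul, Nat.cast_ofNat, sub_mul, one_mul,
      div_mul_cancel₀ p two_ne_zero]
  have hle : Q * Q ^ (p - 2) ≤ Q ^ (p - 1) := by
    rcases eq_or_ne Q 0 with h0 | h0
    · rw [h0, zero_mul]
      exact zero_le
    rcases eq_or_ne Q ∞ with htop | htop
    · rw [htop, ENNReal.top_rpow_of_neg (sub_neg.2 hp), mul_zero]
      exact zero_le
    · nth_rw 1 [← ENNReal.rpow_one Q]
      rw [← ENNReal.rpow_add _ _ h0 htop]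
      ring_nf
      exact le_rfl
  calc (∑ i, (a i * Q ^ (p / 2 - 1)) ^ 2) ^ (q / 2) ≤ (Q ^ (p - 1)) ^ (q / 2) :=
        ENNReal.rpow_le_rpow (hsum.trans_le hle) (half_pos hpq.symm.pos).le
    _ = Q ^ (p / 2) := by rw [← ENNReal.rpow_mul, ← mul_div_assoc, hpq.sub_one_mul_conj]

theorem sum_sq_rpow_le_sum_mul (hp : 0 < p) {a : ι → ℝ≥0∞} (ha : ∑ i, a i ^ 2 ≠ ∞) :
    (∑ i, a i ^ 2) ^ (p / 2) ≤ ∑ i, a i * (a i * (∑ j, a j ^ 2) ^ (p / 2 - 1)) := by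
  simp only [← mul_assoc, ← sq, ← Finset.sum_mul]
  rcases eq_or_ne (∑ i, a i ^ 2) 0 with h0 | h0
  · rw [h0, ENNReal.zero_rpow_of_pos (half_pos hp)]
    exact zero_le
  · nth_rw 2 [← ENNReal.rpow_one (∑ i, a i ^ 2)]
    rw [← ENNReal.rpow_add _ _ h0 ha, add_sub_cancel]

end SquareSumDuality

section GaussSquare

open scoped NNReal

variable {E : Type*} [NormedAddCommGroup E] [InnerProductSpace ℝ E] [FiniteDimensional ℝ E]
  [MeasurableSpace E] [BorelSpace E]

variable (E) in
/-- The square function estimate on `L^p` for Gaussian averages, with constant `C ^ (1 / p)`. The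
right-hand side is assumed to be finite. -/
def IsGaussSquareBound (p : ℝ) (C : ℝ≥0) : Prop :=
  ∀ {n : ℕ} {b : Fin n → ℝ} {F : Fin n → E → ℝ≥0∞}, (∀ k, 0 < b k) → (∀ k, Measurable (F k)) →
    ∫⁻ x, (∑ k, F k x ^ 2) ^ (p / 2) ≠ ∞ →
    ∫⁻ x, (∑ k, gaussAvg (b k) (F k) x ^ 2) ^ (p / 2) ≤ C * ∫⁻ x, (∑ k, F k x ^ 2) ^ (p / 2)

variable {p : ℝ} {n : ℕ} {b : Fin n → ℝ} {F : Fin n → E → ℝ≥0∞}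

theorem lintegral_sum_sq_gaussAvg_ne_top (hp : 1 < p) (hb : ∀ k, 0 < b k)
    (hF : ∀ k, Measurable (F k)) (hfin : ∫⁻ x, (∑ k, F k x ^ 2) ^ (p / 2) ≠ ∞) :
    ∫⁻ x, (∑ k, gaussAvg (b k) (F k) x ^ 2) ^ (p / 2) ≠ ∞ := by
  have hp0 : 0 < p := by positivity
  rw [lintegral_sum_sq_rpow_ne_top_iff hp0 fun k => measurable_gaussAvg (hF k)]
  rw [lintegral_sum_sq_rpow_ne_top_iff hp0 hF] at hfin
  exact fun k => ne_top_of_le_ne_top (hfin k) (lintegral_gaussAvg_rpow_le (hb k) hp.le (hF k))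

theorem gaussAvg_sq_le {b : ℝ} (hb : 0 < b) {F : E → ℝ≥0∞} (hF : Measurable F) (x : E) :
    gaussAvg b F x ^ 2 ≤ gaussAvg b (fun y => F y ^ 2) x := by
  simpa only [ENNReal.rpow_two] using gaussAvg_rpow_le hb one_le_two hF x

theorem lintegral_sum_sq_gaussAvg_mul_le (hb : ∀ k, 0 < b k) (hF : ∀ k, Measurable (F k))
    {W : E → ℝ≥0∞} (hW : Measurable W) :
    ∫⁻ x, (∑ k, gaussAvg (b k) (F k) x ^ 2) * W x ≤
      ∫⁻ x, (∑ k, F k x ^ 2) * ⨆ k, gaussAvg (b k) W x := by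
  have hF2 (k : Fin n) : Measurable fun y => F k y ^ 2 := by fun_prop
  have hmeas (k : Fin n) : Measurable fun x => gaussAvg (b k) (fun y => F k y ^ 2) x * W x :=
    (measurable_gaussAvg (hF2 k)).mul hW
  calc ∫⁻ x, (∑ k, gaussAvg (b k) (F k) x ^ 2) * W x
      ≤ ∫⁻ x, ∑ k, gaussAvg (b k) (fun y => F k y ^ 2) x * W x := by
        simp only [Finset.sum_mul]
        gcongr with x k
        exact gaussAvg_sq_le (hb k) (hF k) x
    _ = ∫⁻ x, ∑ k, F k x ^ 2 * gaussAvg (b k) W x := by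
        rw [lintegral_finsetSum _ fun k _ => hmeas k, lintegral_finsetSum _ fun k _ => by fun_prop]
        exact Finset.sum_congr rfl fun k _ => lintegral_gaussAvg_mul (hF2 k) hW
    _ ≤ ∫⁻ x, (∑ k, F k x ^ 2) * ⨆ k, gaussAvg (b k) W x := by
        simp only [Finset.sum_mul]
        gcongr with x k
        exact le_iSup (fun k => gaussAvg (b k) W x) k

variable (E) in
/-- Test `∑ (Gₖ Fₖ)²`, where `Gₖ` are the averages, against its own power `p / 2 - 1`. The averages
are symmetric, so they can be moved to the test function, where the maximal inequality bounds
them. -/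
theorem exists_isGaussSquareBound_of_two_lt (hp : 2 < p) :
    ∃ C, IsGaussSquareBound E p C := by
  set r := p / 2 with hr
  have hr1 : 1 < r := by rw [hr]; linarith
  have hrs := Real.HolderConjugate.conjExponent hr1
  set s := Real.conjExponent r
  obtain ⟨C, hC⟩ := exists_lintegral_iSup_gaussAvg_le E hrs.symm.lt
  refine ⟨C ^ (r - 1), fun {n b F} hb hF hfin => ?_⟩
  have hG (k : Fin n) : Measurable (gaussAvg (b k) (F k)) := measurable_gaussAvg (hF k)
  set Q : E → ℝ≥0∞ := fun x => ∑ k, gaussAvg (b k) (F k) x ^ 2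
  set W : E → ℝ≥0∞ := fun x => Q x ^ (r - 1)
  have hW : Measurable W := by fun_prop
  have hW_rpow (x : E) : W x ^ s = Q x ^ r := by rw [← ENNReal.rpow_mul, hrs.sub_one_mul_conj]
  rw [ENNReal.coe_rpow_of_nonneg _ (sub_pos.2 hr1).le]
  refine le_rpow_sub_one_mul_of_le_rpow_mul_rpow hrs
    (lintegral_sum_sq_gaussAvg_ne_top (one_lt_two.trans hp) hb hF hfin) ?_
  calc ∫⁻ x, Q x ^ r = ∫⁻ x, Q x * W x := by
        refine lintegral_congr fun x => ?_
        rw [← add_sub_cancel 1 r,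
          ENNReal.rpow_add_of_nonneg _ _ zero_le_one (sub_pos.2 hr1).le, ENNReal.rpow_one]
    _ ≤ ∫⁻ x, (∑ k, F k x ^ 2) * ⨆ k, gaussAvg (b k) W x :=
        lintegral_sum_sq_gaussAvg_mul_le hb hF hW
    _ ≤ (∫⁻ x, (∑ k, F k x ^ 2) ^ r) ^ (1 / r) *
          (∫⁻ x, (⨆ k, gaussAvg (b k) W x) ^ s) ^ (1 / s) :=
        ENNReal.lintegral_mul_le_Lp_mul_Lq _ hrs (by fun_prop)
          (Measurable.iSup fun k => measurable_gaussAvg hW).aemeasurable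
    _ ≤ (∫⁻ x, (∑ k, F k x ^ 2) ^ r) ^ (1 / r) * (C * ∫⁻ x, Q x ^ r) ^ (1 / s) := by
        gcongr _ * ?_ ^ _
        · exact hrs.symm.one_div_nonneg
        · simpa only [hW_rpow] using hC hb hW

theorem lintegral_sum_gaussAvg_mul_le {q : ℝ} (hpq : p.HolderConjugate q)
    (hF : ∀ k, Measurable (F k)) {H : Fin n → E → ℝ≥0∞} (hH : ∀ k, Measurable (H k)) :
    ∫⁻ x, ∑ k, gaussAvg (b k) (F k) x * H k x ≤
      (∫⁻ x, (∑ k, F k x ^ 2) ^ (p / 2)) ^ (1 / p) *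
        (∫⁻ x, (∑ k, gaussAvg (b k) (H k) x ^ 2) ^ (q / 2)) ^ (1 / q) := by
  have hG (k : Fin n) : Measurable (gaussAvg (b k) (F k)) := measurable_gaussAvg (hF k)
  have hGH (k : Fin n) : Measurable (gaussAvg (b k) (H k)) := measurable_gaussAvg (hH k)
  have hsqrt (a : ℝ≥0∞) (u : ℝ) : (a ^ (1 / 2 : ℝ)) ^ u = a ^ (u / 2) := by
    rw [← ENNReal.rpow_mul, one_div_mul_eq_div]
  calc ∫⁻ x, ∑ k, gaussAvg (b k) (F k) x * H k x
      = ∫⁻ x, ∑ k, F k x * gaussAvg (b k) (H k) x := by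
        rw [lintegral_finsetSum _ fun k _ => by fun_prop,
          lintegral_finsetSum _ fun k _ => by fun_prop]
        exact Finset.sum_congr rfl fun k _ => lintegral_gaussAvg_mul (hF k) (hH k)
    _ ≤ ∫⁻ x, (∑ k, F k x ^ 2) ^ (1 / 2 : ℝ) *
          (∑ k, gaussAvg (b k) (H k) x ^ 2) ^ (1 / 2 : ℝ) := by
        refine lintegral_mono fun x => ?_
        simpa only [ENNReal.rpow_two] using ENNReal.inner_le_Lp_mul_Lq Finset.univ
          (fun k => F k x) (fun k => gaussAvg (b k) (H k) x) Real.HolderConjugate.two_two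
    _ ≤ (∫⁻ x, ((∑ k, F k x ^ 2) ^ (1 / 2 : ℝ)) ^ p) ^ (1 / p) *
          (∫⁻ x, ((∑ k, gaussAvg (b k) (H k) x ^ 2) ^ (1 / 2 : ℝ)) ^ q) ^ (1 / q) :=
        ENNReal.lintegral_mul_le_Lp_mul_Lq _ hpq (by fun_prop) (by fun_prop)
    _ = (∫⁻ x, (∑ k, F k x ^ 2) ^ (p / 2)) ^ (1 / p) *
          (∫⁻ x, (∑ k, gaussAvg (b k) (H k) x ^ 2) ^ (q / 2)) ^ (1 / q) := by
        simp only [hsqrt]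

/-- Duality: the averages are symmetric, and the functions `(Gₖ Fₖ) Q ^ (p / 2 - 1)`, where
`Q = ∑ (Gₖ Fₖ)²`, norm the vector `(Gₖ Fₖ)`. -/
theorem IsGaussSquareBound.of_holderConjugate {q : ℝ} {C : ℝ≥0} (hpq : p.HolderConjugate q)
    (hp : p < 2) (hC : IsGaussSquareBound E q C) : IsGaussSquareBound E p (C ^ (p - 1)) := by
  intro n b F hb hF hfin
  have hG (k : Fin n) : Measurable (gaussAvg (b k) (F k)) := measurable_gaussAvg (hF k)
  set Q : E → ℝ≥0∞ := fun x => ∑ k, gaussAvg (b k) (F k) x ^ 2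
  have hQ_fin : ∫⁻ x, Q x ^ (p / 2) ≠ ∞ := lintegral_sum_sq_gaussAvg_ne_top hpq.lt hb hF hfin
  have hQ_ne_top : ∀ᵐ x, Q x ≠ ∞ := by
    filter_upwards [ae_lt_top (by fun_prop) hQ_fin] with x hx htop
    rw [htop, ENNReal.top_rpow_of_pos (half_pos hpq.pos)] at hx
    exact hx.ne rfl
  set H : Fin n → E → ℝ≥0∞ := fun k x => gaussAvg (b k) (F k) x * Q x ^ (p / 2 - 1)
  have hH (k : Fin n) : Measurable (H k) := by fun_prop
  have hH_le : ∫⁻ x, (∑ k, H k x ^ 2) ^ (q / 2) ≤ ∫⁻ x, Q x ^ (p / 2) :=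
    lintegral_mono fun x => sum_sq_mul_rpow_le hpq hp _
  rw [ENNReal.coe_rpow_of_nonneg _ (sub_pos.2 hpq.lt).le]
  refine le_rpow_sub_one_mul_of_le_rpow_mul_rpow hpq hQ_fin ?_
  calc ∫⁻ x, Q x ^ (p / 2) ≤ ∫⁻ x, ∑ k, gaussAvg (b k) (F k) x * H k x := by
        refine lintegral_mono_ae ?_
        filter_upwards [hQ_ne_top] with x hx
        exact sum_sq_rpow_le_sum_mul hpq.pos hx
    _ ≤ (∫⁻ x, (∑ k, F k x ^ 2) ^ (p / 2)) ^ (1 / p) *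
          (∫⁻ x, (∑ k, gaussAvg (b k) (H k) x ^ 2) ^ (q / 2)) ^ (1 / q) :=
        lintegral_sum_gaussAvg_mul_le hpq hF hH
    _ ≤ (∫⁻ x, (∑ k, F k x ^ 2) ^ (p / 2)) ^ (1 / p) *
          (C * ∫⁻ x, Q x ^ (p / 2)) ^ (1 / q) := by
        gcongr _ * ?_ ^ _
        · exact hpq.symm.one_div_nonneg
        · exact (hC hb hH (ne_top_of_le_ne_top hQ_fin hH_le)).trans (by gcongr)

theorem isGaussSquareBound_two : IsGaussSquareBound E 2 1 := by
  intro n b F hb hF _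
  have hG (k : Fin n) : Measurable (gaussAvg (b k) (F k)) := measurable_gaussAvg (hF k)
  simp only [div_self (two_ne_zero' ℝ), ENNReal.rpow_one, ENNReal.coe_one, one_mul]
  rw [lintegral_finsetSum _ fun k _ => by fun_prop, lintegral_finsetSum _ fun k _ => by fun_prop]
  refine Finset.sum_le_sum fun k _ => ?_
  simpa only [ENNReal.rpow_two] using lintegral_gaussAvg_rpow_le (hb k) one_le_two (hF k)

variable (E) in
theorem exists_isGaussSquareBound (hp : 1 < p) : ∃ C, IsGaussSquareBound E p C := by
  rcases lt_trichotomy p 2 with hp2 | rfl | hp2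
  · have hpq := Real.HolderConjugate.conjExponent hp
    have hq : 2 < Real.conjExponent p := by
      rw [Real.conjExponent, lt_div_iff₀ (sub_pos.2 hp)]
      linarith
    obtain ⟨C, hC⟩ := exists_isGaussSquareBound_of_two_lt E hq
    exact ⟨C ^ (p - 1), hC.of_holderConjugate hpq hp2⟩
  · exact ⟨1, isGaussSquareBound_two⟩
  · exact exists_isGaussSquareBound_of_two_lt E hp2

end GaussSquare

section GaussDomination

open scoped NNReal

variable {E : Type*} [NormedAddCommGroup E] [InnerProductSpace ℝ E] [FiniteDimensional ℝ E]
  [MeasurableSpace E] [BorelSpace E] {Ω : Set E} {p : ℝ≥0∞}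

/-- The modulus of `f ∈ L^p(Ω)`, extended by zero to the whole space. -/
def absExt (f : Lp ℂ p (volume.restrict Ω)) : E → ℝ≥0∞ := Ω.indicator fun y => ‖f y‖ₑ

theorem measurable_absExt (hΩ : MeasurableSet Ω) (f : Lp ℂ p (volume.restrict Ω)) :
    Measurable (absExt f) :=
  (Lp.stronglyMeasurable f).enorm.indicator hΩ

theorem lintegral_absExt (hΩ : MeasurableSet Ω) (f : Lp ℂ p (volume.restrict Ω)) :
    ∫⁻ y, absExt f y = ∫⁻ y in Ω, ‖f y‖ₑ := lintegral_indicator hΩ _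

theorem lintegral_gauss_mul_absExt (hΩ : MeasurableSet Ω) (b : ℝ) (x : E)
    (f : Lp ℂ p (volume.restrict Ω)) :
    ∫⁻ y, gauss b (x - y) * absExt f y = ∫⁻ y in Ω, gauss b (x - y) * ‖f y‖ₑ := by
  rw [← lintegral_indicator hΩ]
  refine lintegral_congr fun y => ?_
  by_cases hy : y ∈ Ω <;> simp [absExt, hy]

theorem lintegral_absExt_rpow (hΩ : MeasurableSet Ω) (hp0 : p ≠ 0) (hp : p ≠ ∞)
    (f : Lp ℂ p (volume.restrict Ω)) :
    ∫⁻ y, absExt f y ^ p.toReal = ∫⁻ y in Ω, ‖f y‖ₑ ^ p.toReal := by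
  rw [← lintegral_indicator hΩ]
  refine lintegral_congr fun y => ?_
  by_cases hy : y ∈ Ω <;> simp [absExt, hy, ENNReal.toReal_pos hp0 hp]

theorem sqNorm_absExt (hΩ : MeasurableSet Ω) (hp0 : p ≠ 0) (hp : p ≠ ∞) {n : ℕ}
    (f : Fin n → Lp ℂ p (volume.restrict Ω)) :
    sqNorm p volume (fun k => absExt (f k)) =
      sqNorm p (volume.restrict Ω) fun k y => ‖f k y‖ₑ := by
  rw [sqNorm, sqNorm, ← lintegral_indicator hΩ]
  congr 1
  refine lintegral_congr fun y => ?_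
  by_cases hy : y ∈ Ω <;> simp [absExt, hy, ENNReal.toReal_pos hp0 hp]

variable [Fact (1 ≤ p)]

/-- `B` is dominated by `K` times the Gaussian average of parameter `b`. -/
def GaussDom (K : ℝ≥0) (b : ℝ)
    (B : Lp ℂ p (volume.restrict Ω) →L[ℂ] Lp ℂ p (volume.restrict Ω)) : Prop :=
  ∀ f, ∀ᵐ x ∂volume.restrict Ω, ‖B f x‖ₑ ≤ K * gaussAvg b (absExt f) x

namespace GaussDom

variable {K : ℝ≥0} {b : ℝ} {B B' : Lp ℂ p (volume.restrict Ω) →L[ℂ] Lp ℂ p (volume.restrict Ω)}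

theorem smul (h : GaussDom K b B) {c : ℂ} {M : ℝ≥0} (hc : ‖c‖ ≤ M) :
    GaussDom (M * K) b (c • B) := by
  intro f
  filter_upwards [h f, Lp.coeFn_smul c (B f)] with x hx hsmul
  rw [smul_apply, hsmul, Pi.smul_apply, enorm_smul, ENNReal.coe_mul, mul_assoc]
  gcongr
  exact ENNReal.coe_le_coe.2 hc

theorem enorm_rpow_le (h : GaussDom K b B) (hΩ : MeasurableSet Ω) (hp : p ≠ ∞)
    (f : Lp ℂ p (volume.restrict Ω)) :
    ‖B f‖ₑ ^ p.toReal ≤ (K : ℝ≥0∞) ^ p.toReal * ∫⁻ x, gaussAvg b (absExt f) x ^ p.toReal := by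
  rw [enorm_rpow_toReal hp,
    ← lintegral_const_mul _ ((measurable_gaussAvg (measurable_absExt hΩ f)).pow_const _)]
  refine le_trans (lintegral_mono_ae ((h f).mono fun x hx => ?_)) (setLIntegral_le_lintegral Ω _)
  rw [← ENNReal.mul_rpow_of_nonneg _ _ ENNReal.toReal_nonneg]
  gcongr

theorem enorm_le (h : GaussDom K b B) (hΩ : MeasurableSet Ω) (hp : p ≠ ∞) (hb : 0 < b)
    (f : Lp ℂ p (volume.restrict Ω)) : ‖B f‖ₑ ≤ K * ‖f‖ₑ := by
  have hp1 : 1 ≤ p.toReal := one_le_toReal hp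
  have hp0 : p ≠ 0 := (zero_lt_one.trans_le Fact.out).ne'
  rw [← ENNReal.rpow_le_rpow_iff (ENNReal.toReal_pos hp0 hp),
    ENNReal.mul_rpow_of_nonneg _ _ ENNReal.toReal_nonneg, enorm_rpow_toReal hp f,
    ← lintegral_absExt_rpow hΩ hp0 hp]
  refine (h.enorm_rpow_le hΩ hp f).trans ?_
  refine mul_le_mul_right ?_ _
  exact lintegral_gaussAvg_rpow_le hb hp1 (measurable_absExt hΩ f)

theorem norm_le (h : GaussDom K b B) (hΩ : MeasurableSet Ω) (hp : p ≠ ∞) (hb : 0 < b) :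
    ‖B‖ ≤ K := by
  refine B.opNorm_le_bound K.2 fun f => ?_
  have hle := h.enorm_le hΩ hp hb f
  rw [enorm_eq_nnnorm, enorm_eq_nnnorm] at hle
  exact_mod_cast hle

theorem enorm_apply_le (h : GaussDom K b B) (hΩ : MeasurableSet Ω) (hp : p ≠ ∞) (hb : 0 < b)
    (f : Lp ℂ p (volume.restrict Ω)) :
    ∀ᵐ x ∂volume.restrict Ω, ‖B f x‖ₑ ≤ K * gaussMass E b ^ (-(1 / p.toReal)) * ‖f‖ₑ := by
  have hp1 : 1 ≤ p.toReal := one_le_toReal hp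
  have hp0 : p ≠ 0 := (zero_lt_one.trans_le Fact.out).ne'
  have hr : 0 < p.toReal := ENNReal.toReal_pos hp0 hp
  filter_upwards [h f] with x hx
  refine hx.trans ?_
  rw [mul_assoc]
  gcongr
  rw [← ENNReal.rpow_le_rpow_iff hr]
  refine (gaussAvg_rpow_le hb hp1 (measurable_absExt hΩ f) x).trans ?_
  rw [ENNReal.mul_rpow_of_nonneg _ _ hr.le, ← ENNReal.rpow_mul, neg_mul,
    one_div_mul_cancel hr.ne', ENNReal.rpow_neg_one, enorm_rpow_toReal hp,
    ← lintegral_absExt_rpow hΩ hp0 hp]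
  exact gaussAvg_le_inv_gaussMass_mul hb.le _ x

theorem enorm_le_lintegral (h : GaussDom K b B) (hΩ : MeasurableSet Ω) (hp : p ≠ ∞) (hb : 0 < b)
    (f : Lp ℂ p (volume.restrict Ω)) :
    ‖B f‖ₑ ≤ K * gaussMass E b ^ (1 / p.toReal - 1) * ∫⁻ y in Ω, ‖f y‖ₑ := by
  have hp1 : 1 ≤ p.toReal := one_le_toReal hp
  have hr : 0 < p.toReal := by positivity
  have hr' : 0 ≤ p.toReal - 1 := sub_nonneg.2 hp1
  have hmeas := measurable_gaussAvg (b := b) (measurable_absExt hΩ f)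
  have rpow_eq_mul (a : ℝ≥0∞) : a ^ p.toReal = a * a ^ (p.toReal - 1) := by
    conv_lhs => rw [← add_sub_cancel 1 p.toReal,
      ENNReal.rpow_add_of_nonneg _ _ zero_le_one hr', ENNReal.rpow_one]
  rw [← ENNReal.rpow_le_rpow_iff hr, ENNReal.mul_rpow_of_nonneg _ _ hr.le,
    ENNReal.mul_rpow_of_nonneg _ _ hr.le, ← lintegral_absExt hΩ]
  refine (h.enorm_rpow_le hΩ hp f).trans ?_
  rw [mul_assoc]
  gcongr
  calc ∫⁻ x, gaussAvg b (absExt f) x ^ p.toReal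
      ≤ ∫⁻ x, gaussAvg b (absExt f) x *
          ((gaussMass E b)⁻¹ * ∫⁻ y, absExt f y) ^ (p.toReal - 1) := by
        refine lintegral_mono fun x => ?_
        rw [rpow_eq_mul]
        gcongr
        exact gaussAvg_le_inv_gaussMass_mul hb.le _ x
    _ = (gaussMass E b ^ (1 / p.toReal - 1)) ^ p.toReal * (∫⁻ y, absExt f y) ^ p.toReal := by
        have hexp : (1 / p.toReal - 1) * p.toReal = -(p.toReal - 1) := by field_simp; ring
        rw [lintegral_mul_const _ hmeas, lintegral_gaussAvg hb (measurable_absExt hΩ f),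
          rpow_eq_mul (∫⁻ y, absExt f y), ENNReal.mul_rpow_of_nonneg _ _ hr', ENNReal.inv_rpow,
          ← ENNReal.rpow_neg, ← ENNReal.rpow_mul, hexp]
        ring

theorem enorm_comp_comp_le (h : GaussDom K b B) (h' : GaussDom K b B') (hΩ : MeasurableSet Ω)
    (hp : p ≠ ∞) (hb : 0 < b) (D : Lp ℂ p (volume.restrict Ω) →L[ℂ] Lp ℂ p (volume.restrict Ω))
    {δ : ℝ≥0} (hD : ‖D‖ ≤ δ) (f : Lp ℂ p (volume.restrict Ω)) :
    ∀ᵐ x ∂volume.restrict Ω, ‖B (D (B' f)) x‖ₑ ≤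
      K ^ 2 * δ * ((gaussMass E b)⁻¹ * ∫⁻ y in Ω, ‖f y‖ₑ) := by
  have hDf : ‖D (B' f)‖ₑ ≤ δ * ‖B' f‖ₑ := by
    simp only [enorm_eq_nnnorm]
    exact_mod_cast (D.le_of_opNorm_le hD (B' f))
  have hexp : -(1 / p.toReal) + (1 / p.toReal - 1) = -1 := by ring
  filter_upwards [h.enorm_apply_le hΩ hp hb (D (B' f))] with x hx
  calc ‖B (D (B' f)) x‖ₑ
      ≤ K * gaussMass E b ^ (-(1 / p.toReal)) * (δ * (K * gaussMass E b ^ (1 / p.toReal - 1) *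
          ∫⁻ y in Ω, ‖f y‖ₑ)) := by
        refine hx.trans ?_
        gcongr
        exact hDf.trans (by gcongr; exact h'.enorm_le_lintegral hΩ hp hb f)
    _ = K ^ 2 * δ * ((gaussMass E b ^ (-(1 / p.toReal)) * gaussMass E b ^ (1 / p.toReal - 1)) *
          ∫⁻ y in Ω, ‖f y‖ₑ) := by ring
    _ = K ^ 2 * δ * ((gaussMass E b)⁻¹ * ∫⁻ y in Ω, ‖f y‖ₑ) := by
        rw [← ENNReal.rpow_add _ _ (gaussMass_ne_zero E hb) (gaussMass_ne_top E hb), hexp,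
          ENNReal.rpow_neg_one]

end GaussDom

theorem sqNorm_le_of_gaussDom (hΩ : MeasurableSet Ω) (hp : p ≠ ∞) {C K : ℝ≥0}
    (hC : IsGaussSquareBound E p.toReal C) {n : ℕ} {b : Fin n → ℝ}
    {T : Fin n → Lp ℂ p (volume.restrict Ω) →L[ℂ] Lp ℂ p (volume.restrict Ω)}
    (hb : ∀ k, 0 < b k) (hT : ∀ k, GaussDom K (b k) (T k))
    {f : Fin n → Lp ℂ p (volume.restrict Ω)}
    (hfin : sqNorm p (volume.restrict Ω) (fun k y => ‖f k y‖ₑ) ≠ ∞) :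
    sqNorm p (volume.restrict Ω) (fun k y => ‖T k (f k) y‖ₑ) ≤
      K * C ^ (1 / p.toReal) * sqNorm p (volume.restrict Ω) (fun k y => ‖f k y‖ₑ) := by
  have hp0 : p ≠ 0 := (zero_lt_one.trans_le Fact.out).ne'
  have hr : 0 < p.toReal := ENNReal.toReal_pos hp0 hp
  have hmeas (k : Fin n) : Measurable (gaussAvg (b k) (absExt (f k))) :=
    measurable_gaussAvg (measurable_absExt hΩ (f k))
  rw [← sqNorm_absExt hΩ hp0 hp f] at hfin ⊢
  have hfin' : ∫⁻ y, (∑ k, absExt (f k) y ^ 2) ^ (p.toReal / 2) ≠ ∞ := fun htop =>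
    hfin (by rw [sqNorm, htop, ENNReal.top_rpow_of_pos (one_div_pos.2 hr)])
  have hdom : ∀ᵐ y ∂volume.restrict Ω, (∑ k, ‖T k (f k) y‖ₑ ^ 2) ^ (p.toReal / 2) ≤
      (K : ℝ≥0∞) ^ p.toReal * (∑ k, gaussAvg (b k) (absExt (f k)) y ^ 2) ^ (p.toReal / 2) := by
    filter_upwards [eventually_all.2 fun k => hT k (f k)] with y hy
    rw [← sq_rpow_half (K : ℝ≥0∞), ← ENNReal.mul_rpow_of_nonneg _ _ (half_pos hr).le,
      Finset.mul_sum]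
    simp only [← mul_pow]
    gcongr with k
    exact hy k
  rw [← ENNReal.rpow_le_rpow_iff hr, ENNReal.mul_rpow_of_nonneg _ _ hr.le,
    ENNReal.mul_rpow_of_nonneg _ _ hr.le]
  simp only [sqNorm, ← ENNReal.rpow_mul, one_div_mul_cancel hr.ne', ENNReal.rpow_one]
  refine (lintegral_mono_ae hdom).trans ((setLIntegral_le_lintegral _ _).trans ?_)
  rw [lintegral_const_mul _ (by fun_prop), mul_assoc]
  gcongr
  exact hC hb (fun k => measurable_absExt hΩ (f k)) hfin'

variable (Ω p) in
/-- The operators on `L^p(Ω)` dominated by `K` times some Gaussian average. -/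
def gaussClass (K : ℝ≥0) : Set (Lp ℂ p (volume.restrict Ω) →L[ℂ] Lp ℂ p (volume.restrict Ω)) :=
  {B | ∃ b > 0, GaussDom K b B}

theorem isRBounded_gaussClass (hΩ : MeasurableSet Ω) (hp1 : 1 < p) (hp : p ≠ ∞) (K : ℝ≥0) :
    IsRBounded (gaussClass Ω p K) := by
  have hr1 : 1 < p.toReal := by
    rw [← ENNReal.toReal_one]
    exact (ENNReal.toReal_lt_toReal ENNReal.one_ne_top hp).2 hp1
  obtain ⟨C₁, hC₁⟩ := exists_rademacherMean_le_sqNorm hp (volume.restrict Ω)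
  obtain ⟨C₂, hC₂⟩ := exists_sqNorm_le_rademacherMean hp (volume.restrict Ω)
  obtain ⟨C₃, hC₃⟩ := exists_isGaussSquareBound E hr1
  refine ⟨C₁ * (K * C₃ ^ (1 / p.toReal) * C₂), by positivity, fun n T f hT => ?_⟩
  choose b hb hdom using hT
  have hfin : sqNorm p (volume.restrict Ω) (fun k y => ‖f k y‖ₑ) ≠ ∞ :=
    ne_top_of_le_ne_top (by finiteness) (hC₂ n f)
  have hle : ENNReal.ofReal (rademacherMean fun ε => ‖rademacherSum (fun k => T k (f k)) ε‖) ≤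
      C₁ * (K * C₃ ^ (1 / p.toReal) *
        (C₂ * ENNReal.ofReal (rademacherMean fun ε => ‖rademacherSum f ε‖))) := by
    refine (hC₁ n _).trans ?_
    gcongr
    exact (sqNorm_le_of_gaussDom hΩ hp hC₃ hb hdom hfin).trans (by gcongr; exact hC₂ n f)
  have hmean : 0 ≤ rademacherMean fun ε => ‖∑ k, (ε k : ℤ) • f k‖ :=
    rademacherMean_nonneg fun _ => norm_nonneg _
  rw [← ENNReal.ofReal_le_ofReal_iff (by positivity), ENNReal.ofReal_mul (by positivity)]
  refine hle.trans_eq ?_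
  rw [← NNReal.coe_rpow, ← NNReal.coe_mul, ← NNReal.coe_mul, ← NNReal.coe_mul,
    ENNReal.ofReal_coe_nnreal, ENNReal.coe_mul, ENNReal.coe_mul, ENNReal.coe_mul,
    ENNReal.coe_rpow_of_nonneg _ (by positivity)]
  simp only [rademacherSum, mul_assoc]

end GaussDomination

section Local

open scoped NNReal
open Metric

theorem ae_enorm_le_of_tendsto {α : Type*} [MeasurableSpace α] {ν : Measure α} {p : ℝ≥0∞}
    [Fact (1 ≤ p)] {u : ℕ → Lp ℂ p ν} {v : Lp ℂ p ν} {G : α → ℝ≥0∞} (h : Tendsto u atTop (𝓝 v))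
    (hle : ∀ n, ∀ᵐ x ∂ν, ‖u n x‖ₑ ≤ G x) : ∀ᵐ x ∂ν, ‖v x‖ₑ ≤ G x := by
  obtain ⟨φ, -, hφ⟩ := (tendstoInMeasure_of_tendsto_Lp h).exists_seq_tendsto_ae
  filter_upwards [hφ, ae_all_iff.2 hle] with x hlim hx
  exact le_of_tendsto' hlim.enorm fun n => hx (φ n)

variable {E : Type*} [NormedAddCommGroup E] [InnerProductSpace ℝ E] [FiniteDimensional ℝ E]
  [MeasurableSpace E] [BorelSpace E] {Ω s : Set E} {p : ℝ≥0∞}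

theorem gaussAvg_congr_ae {b : ℝ} {F G : E → ℝ≥0∞} (h : F =ᵐ[volume] G) (x : E) :
    gaussAvg b F x = gaussAvg b G x := by
  unfold gaussAvg
  congr 1
  exact lintegral_congr_ae (h.mono fun y hy => by simp only [hy])

theorem sum_gaussAvg_indicator_le {b : ℝ} {F : E → ℝ≥0∞} (hF : Measurable F) {ι : Type*}
    (I : Finset ι) {s : ι → Set E} (hs : ∀ i, MeasurableSet (s i))
    (hdisj : Pairwise (Function.onFun Disjoint s)) (x : E) :
    ∑ i ∈ I, gaussAvg b ((s i).indicator F) x ≤ gaussAvg b F x := by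
  have hsum : ∑ i ∈ I, gaussAvg b ((s i).indicator F) x =
      gaussAvg b (fun y => ∑ i ∈ I, (s i).indicator F y) x := by
    simp only [gaussAvg, Finset.mul_sum]
    rw [← Finset.mul_sum, lintegral_finsetSum]
    exact fun i _ => (by fun_prop : Measurable fun y => gauss b (x - y)).mul (hF.indicator (hs i))
  rw [hsum]
  refine gaussAvg_mono (fun y => ?_) x
  rw [← Finset.indicator_biUnion_apply _ _ fun i _ j _ hij => hdisj hij]
  exact indicator_le_self _ _ _

/-- The restriction of `f ∈ L^p(Ω)` to a measurable set, as an element of `L^p(Ω)`. -/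
def cutOff (hs : MeasurableSet s) (f : Lp ℂ p (volume.restrict Ω)) :
    Lp ℂ p (volume.restrict Ω) :=
  ((Lp.memLp f).indicator hs).toLp

theorem coeFn_cutOff (hs : MeasurableSet s) (f : Lp ℂ p (volume.restrict Ω)) :
    cutOff hs f =ᵐ[volume.restrict Ω] s.indicator f := MemLp.coeFn_toLp _

theorem absExt_cutOff (hΩ : MeasurableSet Ω) (hs : MeasurableSet s)
    (f : Lp ℂ p (volume.restrict Ω)) :
    absExt (cutOff hs f) =ᵐ[volume] s.indicator (absExt f) := by
  filter_upwards [(ae_restrict_iff' hΩ).1 (coeFn_cutOff hs f)] with y hy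
  by_cases hyΩ : y ∈ Ω
  · by_cases hys : y ∈ s <;> simp [absExt, hyΩ, hy, hys]
  · by_cases hys : y ∈ s <;> simp [absExt, hyΩ, hys]

theorem cutOff_partialSups {t : ℕ → Set E} (ht : ∀ n, MeasurableSet (partialSups t n))
    (ht' : ∀ n, MeasurableSet (disjointed t n)) (n : ℕ) (f : Lp ℂ p (volume.restrict Ω)) :
    cutOff (ht n) f = ∑ k ∈ Finset.range (n + 1), cutOff (ht' k) f := by
  refine Lp.ext ?_
  filter_upwards [coeFn_cutOff (ht n) f, ae_all_iff.2 fun k => coeFn_cutOff (ht' k) f,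
    Lp.coeFn_finsetSum (Finset.range (n + 1)) fun k => cutOff (ht' k) f] with y hn hk hsum
  rw [hn, hsum, Finset.sum_apply]
  simp only [hk]
  rw [← partialSups_disjointed, partialSups_eq_biUnion_range,
    Finset.indicator_biUnion_apply _ _ fun i _ j _ hij => disjoint_disjointed t hij]

variable [Fact (1 ≤ p)]

theorem enorm_cutOff_sub_rpow (hp : p ≠ ∞) (hs : MeasurableSet s)
    (f : Lp ℂ p (volume.restrict Ω)) :
    ‖cutOff hs f - f‖ₑ ^ p.toReal =
      ∫⁻ y in Ω, sᶜ.indicator (fun y => ‖f y‖ₑ ^ p.toReal) y := by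
  have hr : 0 < p.toReal := zero_lt_one.trans_le (one_le_toReal hp)
  rw [enorm_rpow_toReal hp]
  refine lintegral_congr_ae ?_
  filter_upwards [Lp.coeFn_sub (cutOff hs f) f, coeFn_cutOff hs f] with y hsub hcut
  rw [hsub, Pi.sub_apply, hcut]
  by_cases hy : y ∈ s <;> simp [hy, hr]

theorem tendsto_cutOff (hp : p ≠ ∞) {s : ℕ → Set E} (hs : ∀ n, MeasurableSet (s n))
    (hmono : Monotone s) (huniv : ⋃ n, s n = univ) (f : Lp ℂ p (volume.restrict Ω)) :
    Tendsto (fun n => cutOff (hs n) f) atTop (𝓝 f) := by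
  have hr : 0 < p.toReal := zero_lt_one.trans_le (one_le_toReal hp)
  have hint : Tendsto (fun n => ∫⁻ y in Ω, (s n)ᶜ.indicator (fun y => ‖f y‖ₑ ^ p.toReal) y)
      atTop (𝓝 (∫⁻ _ in Ω, 0)) := by
    refine tendsto_lintegral_of_dominated_convergence' (fun y => ‖f y‖ₑ ^ p.toReal)
      (fun n => ((Lp.aestronglyMeasurable f).enorm.pow_const _).indicator (hs n).compl)
      (fun n => ae_of_all _ fun y => indicator_le_self _ _ _) ?_ (ae_of_all _ fun y => ?_)
    · rw [← enorm_rpow_toReal hp]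
      finiteness
    · obtain ⟨n, hn⟩ := mem_iUnion.1 (huniv ▸ mem_univ y : y ∈ ⋃ n, s n)
      refine tendsto_const_nhds.congr' ?_
      filter_upwards [eventually_ge_atTop n] with m hm
      exact (indicator_of_notMem (notMem_compl_iff.2 (hmono hm hn)) _).symm
  have hroot := hint.ennrpow_const (1 / p.toReal)
  rw [lintegral_zero, ENNReal.zero_rpow_of_pos (one_div_pos.2 hr)] at hroot
  rw [tendsto_iff_edist_tendsto_0]
  refine hroot.congr fun n => ?_
  rw [edist_eq_enorm_sub, ← enorm_cutOff_sub_rpow hp, ← ENNReal.rpow_mul,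
    mul_one_div_cancel hr.ne', ENNReal.rpow_one]

theorem iUnion_partialSups_ball_denseSeq (E : Type*) [PseudoMetricSpace E]
    [TopologicalSpace.SeparableSpace E] [Nonempty E] {ρ : ℝ} (hρ : 0 < ρ) :
    ⋃ n, partialSups (fun k => ball (TopologicalSpace.denseSeq E k) ρ) n = univ := by
  rw [← iSup_eq_iUnion, iSup_partialSups_eq, iSup_eq_iUnion]
  refine eq_univ_of_forall fun x => ?_
  obtain ⟨n, hn⟩ := (TopologicalSpace.denseRange_denseSeq E).exists_mem_open isOpen_ball
    ⟨x, mem_ball_self hρ⟩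
  exact mem_iUnion.2 ⟨n, mem_ball_comm.1 hn⟩

/-- Decompose `f` along a partition into sets of radius `ρ`: the Gaussian averages of the pieces
add up, so no constant is lost. -/
theorem gaussDom_of_local (hΩ : MeasurableSet Ω) (hp : p ≠ ∞)
    {B : Lp ℂ p (volume.restrict Ω) →L[ℂ] Lp ℂ p (volume.restrict Ω)} {K : ℝ≥0} {b ρ : ℝ}
    (hρ : 0 < ρ)
    (h : ∀ (z : E) (f : Lp ℂ p (volume.restrict Ω)), (∀ᵐ y, y ∉ ball z ρ → absExt f y = 0) →
      ∀ᵐ x ∂volume.restrict Ω, ‖B f x‖ₑ ≤ K * gaussAvg b (absExt f) x) : GaussDom K b B := by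
  intro f
  set t : ℕ → Set E := fun n => ball (TopologicalSpace.denseSeq E n) ρ
  have hpart (n : ℕ) : MeasurableSet (disjointed t n) :=
    MeasurableSet.disjointed (fun _ => measurableSet_ball) n
  have hunion (n : ℕ) : MeasurableSet (partialSups t n) := by
    rw [partialSups_eq_biUnion_range]
    exact Finset.measurableSet_biUnion _ fun _ _ => measurableSet_ball
  have hlim : Tendsto (fun n => B (cutOff (hunion n) f)) atTop (𝓝 (B f)) :=
    (B.continuous.tendsto f).comp (tendsto_cutOff hp hunion (partialSups t).monotone
      (iUnion_partialSups_ball_denseSeq E hρ) f)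
  have hpiece (k : ℕ) : ∀ᵐ x ∂volume.restrict Ω, ‖B (cutOff (hpart k) f) x‖ₑ ≤
      K * gaussAvg b ((disjointed t k).indicator (absExt f)) x := by
    simp only [← gaussAvg_congr_ae (absExt_cutOff hΩ (hpart k) f)]
    refine h (TopologicalSpace.denseSeq E k) _ ?_
    filter_upwards [absExt_cutOff hΩ (hpart k) f] with y hy hyt
    rw [hy, indicator_of_notMem fun hmem => hyt (disjointed_subset t k hmem)]
  refine ae_enorm_le_of_tendsto hlim fun n => ?_
  rw [cutOff_partialSups hunion hpart, map_sum]
  filter_upwards [Lp.coeFn_finsetSum (Finset.range (n + 1)) fun k => B (cutOff (hpart k) f),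
    ae_all_iff.2 hpiece] with x hsum hx
  rw [hsum, Finset.sum_apply]
  calc ‖∑ k ∈ Finset.range (n + 1), B (cutOff (hpart k) f) x‖ₑ
      ≤ ∑ k ∈ Finset.range (n + 1), K * gaussAvg b ((disjointed t k).indicator (absExt f)) x :=
        (enorm_sum_le _ _).trans (Finset.sum_le_sum fun k _ => hx k)
    _ ≤ K * gaussAvg b (absExt f) x := by
        rw [← Finset.mul_sum]
        gcongr
        exact sum_gaussAvg_indicator_le (measurable_absExt hΩ f) _ hpart (disjoint_disjointed t) x

end Local

section Landau

open scoped NNReal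
open Metric

theorem le_mul_ofReal_of_forall_half_pow_mul_le {a A M : ℝ≥0∞} {g : ℝ} (hg : 0 < g) (hg1 : g ≤ 1)
    (h : ∀ j : ℕ, ENNReal.ofReal ((1 / 2) ^ j) * a ≤
      A * ENNReal.ofReal g ^ 2 + M * ENNReal.ofReal ((1 / 2) ^ j) ^ 2) :
    a ≤ (2 * A + M) * ENNReal.ofReal g := by
  obtain ⟨j, hj_lt, hj_le⟩ := exists_nat_pow_near_of_lt_one hg hg1
    (by norm_num : (0 : ℝ) < 1 / 2) (by norm_num)
  set η := ENNReal.ofReal ((1 / 2 : ℝ) ^ (j + 1)) with hη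
  have hη0 : η ≠ 0 := (ENNReal.ofReal_pos.2 (by positivity)).ne'
  have hη_le : η ≤ ENNReal.ofReal g := ENNReal.ofReal_le_ofReal hj_lt.le
  have hle_η : ENNReal.ofReal g ≤ 2 * η := by
    rw [hη, ← ENNReal.ofReal_ofNat 2, ← ENNReal.ofReal_mul zero_le_two]
    exact ENNReal.ofReal_le_ofReal (hj_le.trans_eq (by ring))
  refine (ENNReal.mul_le_mul_iff_right hη0 ENNReal.ofReal_ne_top).1 ((h (j + 1)).trans ?_)
  calc A * ENNReal.ofReal g ^ 2 + M * η ^ 2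
      ≤ A * (ENNReal.ofReal g * (2 * η)) + M * (η * ENNReal.ofReal g) := by
        rw [sq, sq]
        gcongr
    _ = η * ((2 * A + M) * ENNReal.ofReal g) := by ring

section GaussOnBall

variable {E : Type*} [NormedAddCommGroup E] {b : ℝ} {x y z : E}

theorem sq_norm_sub_le_of_mem_ball (hy : y ∈ ball z √b) :
    ‖x - z‖ ^ 2 ≤ 2 * ‖x - y‖ ^ 2 + 2 * b := by
  rw [mem_ball, dist_eq_norm, Real.lt_sqrt (norm_nonneg _)] at hy
  have htri : ‖x - z‖ ≤ ‖x - y‖ + ‖y - z‖ := norm_sub_le_norm_sub_add_norm_sub _ _ _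
  nlinarith [norm_nonneg (x - z), norm_nonneg (x - y), norm_nonneg (y - z),
    sq_nonneg (‖x - y‖ - ‖y - z‖)]

theorem gauss_le_of_mem_ball (hb : 0 < b) (hy : y ∈ ball z √b) :
    gauss (2 * b) (x - y) ≤ ENNReal.ofReal (Real.exp (1 / 2)) * gauss (8 * b) (x - z) ^ 2 := by
  rw [gauss, gauss, ← ENNReal.ofReal_pow (Real.exp_pos _).le,
    ← ENNReal.ofReal_mul (Real.exp_pos _).le, ← Real.exp_nat_mul, ← Real.exp_add]
  refine ENNReal.ofReal_le_ofReal (Real.exp_le_exp.2 ?_)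
  have hsq : ‖x - z‖ ^ 2 / (4 * b) ≤ (2 * ‖x - y‖ ^ 2 + 2 * b) / (4 * b) := by
    gcongr
    exact sq_norm_sub_le_of_mem_ball hy
  have hleft : (2 * ‖x - y‖ ^ 2 + 2 * b) / (4 * b) = ‖x - y‖ ^ 2 / (2 * b) + 1 / 2 := by
    field_simp
    ring
  have hright : ‖x - z‖ ^ 2 / (4 * b) = 2 * (‖x - z‖ ^ 2 / (8 * b)) := by
    field_simp
    ring
  push_cast
  linarith

theorem gauss_le_mul_gauss_of_mem_ball (hb : 0 < b) (hy : y ∈ ball z √b) :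
    gauss (8 * b) (x - z) ≤ ENNReal.ofReal (Real.exp (1 / 8)) * gauss (16 * b) (x - y) := by
  rw [gauss, gauss, ← ENNReal.ofReal_mul (Real.exp_pos _).le, ← Real.exp_add]
  refine ENNReal.ofReal_le_ofReal (Real.exp_le_exp.2 ?_)
  have hsq : ‖x - y‖ ^ 2 / (16 * b) ≤ (2 * ‖x - z‖ ^ 2 + 2 * b) / (16 * b) := by
    gcongr
    exact sq_norm_sub_le_of_mem_ball (mem_ball_comm.1 hy)
  have hright : (2 * ‖x - z‖ ^ 2 + 2 * b) / (16 * b) = ‖x - z‖ ^ 2 / (8 * b) + 1 / 8 := by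
    field_simp
    ring
  linarith

variable [MeasurableSpace E] {μ : Measure E} {F : E → ℝ≥0∞}

theorem lintegral_gauss_mul_le_of_support (hb : 0 < b) (hF : Measurable F)
    (hsupp : ∀ᵐ y ∂μ, y ∉ ball z √b → F y = 0) :
    ∫⁻ y, gauss (2 * b) (x - y) * F y ∂μ ≤
      ENNReal.ofReal (Real.exp (1 / 2)) * gauss (8 * b) (x - z) ^ 2 * ∫⁻ y, F y ∂μ := by
  rw [← lintegral_const_mul _ hF]
  refine lintegral_mono_ae ?_
  filter_upwards [hsupp] with y hy
  by_cases hyz : y ∈ ball z √b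
  · gcongr
    exact gauss_le_of_mem_ball hb hyz
  · simp only [hy hyz, mul_zero, le_refl]

theorem gauss_mul_lintegral_le_of_support (hb : 0 < b) (hF : Measurable F)
    (hsupp : ∀ᵐ y ∂μ, y ∉ ball z √b → F y = 0) :
    gauss (8 * b) (x - z) * ∫⁻ y, F y ∂μ ≤
      ENNReal.ofReal (Real.exp (1 / 8)) * ∫⁻ y, gauss (16 * b) (x - y) * F y ∂μ := by
  rw [← lintegral_const_mul _ hF, ← lintegral_const_mul' _ _ ENNReal.ofReal_ne_top]
  refine lintegral_mono_ae ?_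
  filter_upwards [hsupp] with y hy
  by_cases hyz : y ∈ ball z √b
  · rw [← mul_assoc]
    gcongr
    exact gauss_le_mul_gauss_of_mem_ball hb hyz
  · simp only [hy hyz, mul_zero, le_refl]

end GaussOnBall

variable {E : Type*} [NormedAddCommGroup E] [InnerProductSpace ℝ E] [FiniteDimensional ℝ E]
  [MeasurableSpace E] [BorelSpace E] {Ω : Set E} {p : ℝ≥0∞} [Fact (1 ≤ p)]

variable (E) in
theorem gaussMass_mul {a b : ℝ} (ha : 0 < a) (hb : 0 < b) :
    gaussMass E (a * b) =
      ENNReal.ofReal (a ^ (Module.finrank ℝ E / 2 : ℝ)) * gaussMass E b := by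
  rw [gaussMass_eq E (by positivity), gaussMass_eq E hb, ← ENNReal.ofReal_mul (by positivity),
    ← Real.mul_rpow ha.le (by positivity), mul_left_comm]

variable (E) in
theorem inv_gaussMass_le {a b c : ℝ} (ha : 0 < a) (hb : 0 < b) (hc : 0 < c) (hbc : c ≤ a * b) :
    (gaussMass E b)⁻¹ ≤
      ENNReal.ofReal (a ^ (Module.finrank ℝ E / 2 : ℝ)) * (gaussMass E c)⁻¹ := by
  have ha0 : ENNReal.ofReal (a ^ (Module.finrank ℝ E / 2 : ℝ)) ≠ 0 :=
    (ENNReal.ofReal_pos.2 (by positivity)).ne'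
  calc (gaussMass E b)⁻¹
      = ENNReal.ofReal (a ^ (Module.finrank ℝ E / 2 : ℝ)) * (gaussMass E (a * b))⁻¹ := by
        rw [gaussMass_mul E ha hb, ENNReal.mul_inv (Or.inl ha0) (Or.inl ENNReal.ofReal_ne_top),
          ← mul_assoc, ENNReal.mul_inv_cancel ha0 ENNReal.ofReal_ne_top, one_mul]
    _ ≤ ENNReal.ofReal (a ^ (Module.finrank ℝ E / 2 : ℝ)) * (gaussMass E c)⁻¹ := by
        gcongr
        exact lintegral_mono fun x => gauss_mono hc hbc x

theorem enorm_sub_sub_apply_le {K δ : ℝ≥0} {b b' : ℝ} (hΩ : MeasurableSet Ω) (hp : p ≠ ∞)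
    (hb : 0 < b) (hbb' : b ≤ b') (hb'b : b' ≤ 2 * b)
    {T₁ T₂ T₃ D : Lp ℂ p (volume.restrict Ω) →L[ℂ] Lp ℂ p (volume.restrict Ω)}
    (hT₁ : GaussDom K b T₁) (hT₂ : GaussDom K b' T₂) (hT₃ : GaussDom K (b / 3) T₃) (hD : ‖D‖ ≤ δ)
    (f : Lp ℂ p (volume.restrict Ω)) :
    ∀ᵐ x ∂volume.restrict Ω, ‖(T₁ f - T₂ f - T₃ (D (T₃ f))) x‖ₑ ≤
      ENNReal.ofReal (48 ^ (Module.finrank ℝ E / 2 : ℝ)) * (gaussMass E (16 * b))⁻¹ *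
        (2 * K * (∫⁻ y, gauss (2 * b) (x - y) * absExt f y) + K ^ 2 * δ * ∫⁻ y, absExt f y) := by
  set Λ := ENNReal.ofReal (48 ^ (Module.finrank ℝ E / 2 : ℝ)) * (gaussMass E (16 * b))⁻¹
  have hmass {c : ℝ} (hc : b / 3 ≤ c) : (gaussMass E c)⁻¹ ≤ Λ :=
    inv_gaussMass_le E (by norm_num) (by linarith) (by positivity) (by linarith)
  have havg {c : ℝ} (hbc : b ≤ c) (hcb : c ≤ 2 * b) (x : E) :
      (K : ℝ≥0∞) * gaussAvg c (absExt f) x ≤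
        K * (Λ * ∫⁻ y, gauss (2 * b) (x - y) * absExt f y) := by
    unfold gaussAvg
    gcongr with y
    · exact hmass (by linarith)
    · exact gauss_mono (by linarith) hcb _
  filter_upwards [hT₁ f, hT₂ f, hT₃.enorm_comp_comp_le hT₃ hΩ hp (by positivity) D hD f,
    Lp.coeFn_sub (T₁ f - T₂ f) (T₃ (D (T₃ f))), Lp.coeFn_sub (T₁ f) (T₂ f)]
    with x hx₁ hx₂ hx₃ hsub hsub'
  rw [hsub, Pi.sub_apply, hsub', Pi.sub_apply]
  rw [← lintegral_absExt hΩ] at hx₃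
  calc ‖T₁ f x - T₂ f x - T₃ (D (T₃ f)) x‖ₑ
      ≤ ‖T₁ f x‖ₑ + ‖T₂ f x‖ₑ + ‖T₃ (D (T₃ f)) x‖ₑ :=
        enorm_sub_le.trans (add_le_add_left enorm_sub_le _)
    _ ≤ K * (Λ * ∫⁻ y, gauss (2 * b) (x - y) * absExt f y) +
          K * (Λ * ∫⁻ y, gauss (2 * b) (x - y) * absExt f y) +
          K ^ 2 * δ * (Λ * ∫⁻ y, absExt f y) := by
        refine add_le_add (add_le_add ?_ ?_) (hx₃.trans ?_)
        · exact hx₁.trans (havg le_rfl (by linarith) x)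
        · exact hx₂.trans (havg hbb' hb'b x)
        · gcongr
          exact hmass le_rfl
    _ = Λ * (2 * K * (∫⁻ y, gauss (2 * b) (x - y) * absExt f y) +
          K ^ 2 * δ * ∫⁻ y, absExt f y) := by ring

theorem mul_enorm_apply_le_of_second_order (hΩ : MeasurableSet Ω) (hp : p ≠ ∞) {K δ : ℝ≥0}
    {c s h : ℝ} (hc : 0 < c) (hs : 0 < s) (hh : h ∈ Ioc (0 : ℝ) 1)
    {B D : Lp ℂ p (volume.restrict Ω) →L[ℂ] Lp ℂ p (volume.restrict Ω)}
    {T : ℝ → Lp ℂ p (volume.restrict Ω) →L[ℂ] Lp ℂ p (volume.restrict Ω)}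
    (hT : ∀ τ > 0, GaussDom K (c * τ) (T τ)) (hD : ‖D‖ ≤ δ * h ^ 2)
    {f : Lp ℂ p (volume.restrict Ω)}
    (hB : (h : ℂ) • B f = T s f - T (s + h * s) f - T (s / 3) (D (T (s / 3) f))) :
    ∀ᵐ x ∂volume.restrict Ω, ENNReal.ofReal h * ‖B f x‖ₑ ≤
      ENNReal.ofReal (48 ^ (Module.finrank ℝ E / 2 : ℝ)) * (gaussMass E (16 * (c * s)))⁻¹ *
        (2 * K * (∫⁻ y, gauss (2 * (c * s)) (x - y) * absExt f y) +
          K ^ 2 * (δ * ENNReal.ofReal h ^ 2) * ∫⁻ y, absExt f y) := by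
  have hcs : 0 < c * s := mul_pos hc hs
  have hDh : ‖D‖ ≤ ((δ * h.toNNReal ^ 2 : ℝ≥0) : ℝ) := by
    simpa only [NNReal.coe_mul, NNReal.coe_pow, Real.coe_toNNReal _ hh.1.le] using hD
  have hT₃ : GaussDom K (c * s / 3) (T (s / 3)) := by
    simpa only [mul_div_assoc] using hT (s / 3) (by positivity)
  filter_upwards [enorm_sub_sub_apply_le hΩ hp hcs (by nlinarith [hh.1]) (by nlinarith [hh.2])
    (hT s hs) (hT (s + h * s) (by nlinarith [hh.1])) hT₃ hDh f,
    Lp.coeFn_smul (h : ℂ) (B f)] with x hx hsmul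
  rw [← hB, hsmul, Pi.smul_apply, enorm_smul, ← ofReal_norm (h : ℂ), Complex.norm_real,
    Real.norm_of_nonneg hh.1.le, ENNReal.coe_mul, ENNReal.coe_pow] at hx
  exact hx

variable (E) in
/-- The domination constant which `gaussDom_of_second_order` produces from the constant `K` of the
differences and the bound `δ` for the second order remainder. -/
def landauConst (K δ : ℝ≥0) : ℝ≥0 :=
  ((48 : ℝ) ^ (Module.finrank ℝ E / 2 : ℝ)).toNNReal *
    (4 * K * (Real.exp (1 / 2)).toNNReal + K ^ 2 * δ) * (Real.exp (1 / 8)).toNNReal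

/-- A kernel version of the Landau inequality `‖u'‖² ≲ ‖u‖ ‖u''‖`. For `f` supported in a ball
around `z` the optimal step is the Gaussian weight `h = exp (-|x - z|² / (8cs))`: the differences
are of order `h²`, hence so is `h B f`, up to the remainder of order `h²`. -/
theorem gaussDom_of_second_order (hΩ : MeasurableSet Ω) (hp : p ≠ ∞) {K δ : ℝ≥0} {c s : ℝ}
    (hc : 0 < c) (hs : 0 < s)
    {B : Lp ℂ p (volume.restrict Ω) →L[ℂ] Lp ℂ p (volume.restrict Ω)}
    (T D : ℝ → Lp ℂ p (volume.restrict Ω) →L[ℂ] Lp ℂ p (volume.restrict Ω))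
    (hT : ∀ τ > 0, GaussDom K (c * τ) (T τ)) (hD : ∀ h ∈ Ioc (0 : ℝ) 1, ‖D h‖ ≤ δ * h ^ 2)
    (hB : ∀ h ∈ Ioc (0 : ℝ) 1, ∀ f,
      (h : ℂ) • B f = T s f - T (s + h * s) f - T (s / 3) (D h (T (s / 3) f))) :
    GaussDom (landauConst E K δ) (16 * (c * s)) B := by
  set b := c * s
  have hb : 0 < b := by positivity
  refine gaussDom_of_local hΩ hp (Real.sqrt_pos.2 hb) fun z f hf => ?_
  set Λ := ENNReal.ofReal (48 ^ (Module.finrank ℝ E / 2 : ℝ)) * (gaussMass E (16 * b))⁻¹ with hΛ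
  set J := ∫⁻ y, absExt f y
  have hstep (j : ℕ) := by
    have hj : (1 / 2 : ℝ) ^ j ∈ Ioc (0 : ℝ) 1 :=
      ⟨by positivity, pow_le_one₀ (by norm_num) (by norm_num)⟩
    exact mul_enorm_apply_le_of_second_order hΩ hp hc hs hj hT (hD _ hj) (hB _ hj f)
  filter_upwards [ae_all_iff.2 hstep] with x hx
  have hopt := le_mul_ofReal_of_forall_half_pow_mul_le (a := ‖B f x‖ₑ)
    (A := Λ * (2 * K * ENNReal.ofReal (Real.exp (1 / 2)) * J)) (M := Λ * (K ^ 2 * δ * J))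
    (Real.exp_pos (-(‖x - z‖ ^ 2 / (8 * b)))) (Real.exp_le_one_iff.2 (neg_nonpos.2 (by positivity)))
    fun j => (hx j).trans ?_
  · calc ‖B f x‖ₑ
        ≤ Λ * (4 * K * ENNReal.ofReal (Real.exp (1 / 2)) + K ^ 2 * δ) *
            (gauss (8 * b) (x - z) * J) := hopt.trans_eq (by rw [gauss]; ring)
      _ ≤ Λ * (4 * K * ENNReal.ofReal (Real.exp (1 / 2)) + K ^ 2 * δ) *
            (ENNReal.ofReal (Real.exp (1 / 8)) * ∫⁻ y, gauss (16 * b) (x - y) * absExt f y) := by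
          gcongr Λ * _ * ?_
          exact gauss_mul_lintegral_le_of_support hb (measurable_absExt hΩ f) hf
      _ = landauConst E K δ * gaussAvg (16 * b) (absExt f) x := by
          simp only [landauConst, gaussAvg, hΛ, ENNReal.ofReal, ENNReal.coe_mul, ENNReal.coe_add,
            ENNReal.coe_pow, ENNReal.coe_ofNat]
          ring
  · calc
      _ ≤ Λ * (2 * K * (ENNReal.ofReal (Real.exp (1 / 2)) * gauss (8 * b) (x - z) ^ 2 * J) +
          K ^ 2 * (δ * ENNReal.ofReal ((1 / 2) ^ j) ^ 2) * J) := by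
            gcongr
            exact lintegral_gauss_mul_le_of_support hb (measurable_absExt hΩ f) hf
      _ = _ := by
            rw [gauss]
            ring

end Landau

section Semigroup

variable {X : Type*} [NormedAddCommGroup X] [NormedSpace ℂ X]

/-- `Q` is the inverse of `z + A`. In terms of the resolvent, `Q = -R(-z, A)`; this sign convention
makes `Q` the Laplace transform of the semigroup generated by `-A`. -/
structure IsShiftInv (A : X →ₗ.[ℂ] X) (z : ℂ) (Q : X →L[ℂ] X) : Prop where
  mem_graph : ∀ x, (Q x, x - z • Q x) ∈ A.graph
  apply_eq : ∀ {y w : X}, (y, w) ∈ A.graph → Q (z • y + w) = y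

theorem IsResolventAt.isShiftInv {A : X →ₗ.[ℂ] X} {z : ℂ} {R : X →L[ℂ] X}
    (h : IsResolventAt A z R) : IsShiftInv A (-z) (-R) where
  mem_graph x := by
    obtain ⟨hx, hAx⟩ := h.1 x
    have hR : (R x, z • R x - x) ∈ A.graph :=
      A.mem_graph_iff.2 ⟨⟨R x, hx⟩, rfl, by rw [eq_sub_iff_add_eq, ← eq_sub_iff_add_eq', hAx]⟩
    simpa [neg_sub, sub_eq_add_neg, add_comm] using A.graph.neg_mem hR
  apply_eq {y w} hyw := by
    obtain ⟨y, rfl, rfl⟩ := A.mem_graph_iff.1 hyw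
    rw [neg_apply, ← map_neg]
    convert h.2 y using 2
    simp [sub_eq_add_neg, add_comm]

theorem IsShiftInv.integral_mem_graph [CompleteSpace X] {A : X →ₗ.[ℂ] X} {z : ℂ}
    {Q : X →L[ℂ] X} (hQ : IsShiftInv A z Q) {α : Type*} [MeasurableSpace α] {μ : Measure α}
    {f g : α → X} (hf : Integrable f μ) (hg : Integrable g μ)
    (hfg : ∀ᵐ a ∂μ, (f a, g a) ∈ A.graph) : (∫ a, f a ∂μ, ∫ a, g a ∂μ) ∈ A.graph := by
  have hfz : Integrable (fun a => z • f a) μ := hf.smul z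
  have hQ_integral : Q (z • ∫ a, f a ∂μ + ∫ a, g a ∂μ) = ∫ a, f a ∂μ := by
    rw [← integral_smul, ← integral_add hfz hg]
    refine (Q.integral_comp_comm (hfz.add hg)).symm.trans ?_
    exact integral_congr_ae (hfg.mono fun a ha => hQ.apply_eq ha)
  have hgraph := hQ.mem_graph (z • ∫ a, f a ∂μ + ∫ a, g a ∂μ)
  rwa [hQ_integral, add_sub_cancel_left] at hgraph

/-- `(U s)_{s ≥ 0}` is a `C₀`-semigroup with generator `-A` and `‖U s‖ ≤ K`. Continuity and the
bound are asked for on all of `ℝ`, so that the values at negative times have to be chosen suitably,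
e.g. by `U s = U (max s 0)`. -/
structure IsBddSemigroup (A : X →ₗ.[ℂ] X) (U : ℝ → X →L[ℂ] X) (K : ℝ) : Prop where
  zero : ∀ x, U 0 x = x
  add : ∀ s r : ℝ, 0 ≤ s → 0 ≤ r → ∀ x, U (s + r) x = U s (U r x)
  cont : ∀ x, Continuous fun s => U s x
  bound : ∀ s x, ‖U s x‖ ≤ K * ‖x‖
  gen : ∀ x y, (x, y) ∈ A.graph ↔
    Tendsto (fun s : ℝ => (s : ℂ)⁻¹ • (U s x - x)) (𝓝[>] 0) (𝓝 (-y))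

namespace IsBddSemigroup

variable {A : X →ₗ.[ℂ] X} {U : ℝ → X →L[ℂ] X} {K : ℝ}

theorem map_graph (h : IsBddSemigroup A U K) {s : ℝ} (hs : 0 ≤ s) {x y : X}
    (hxy : (x, y) ∈ A.graph) : (U s x, U s y) ∈ A.graph := by
  rw [h.gen] at hxy ⊢
  have hlim := ((U s).continuous.tendsto _).comp hxy
  rw [map_neg] at hlim
  refine hlim.congr' ?_
  filter_upwards [self_mem_nhdsWithin] with k (hk : 0 < k)
  simp only [Function.comp_apply, map_smul, map_sub]
  rw [← h.add s k hs hk.le, ← h.add k s hk.le hs, add_comm]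

theorem continuous_exp_smul (h : IsBddSemigroup A U K) (z : ℂ) (x : X) :
    Continuous fun s : ℝ => Complex.exp (-z * s) • U s x :=
  (by fun_prop : Continuous fun s : ℝ => Complex.exp (-z * s)).smul (h.cont x)

theorem norm_exp_smul_le (h : IsBddSemigroup A U K) (z : ℂ) (x : X) (s : ℝ) :
    ‖Complex.exp (-z * s) • U s x‖ ≤ K * ‖x‖ * Real.exp (-z.re * s) := by
  rw [norm_smul, Complex.norm_exp, mul_comm, Complex.re_mul_ofReal, Complex.neg_re]
  gcongr
  exact h.bound s x

theorem integrableOn_exp_smul (h : IsBddSemigroup A U K) {z : ℂ} (hz : 0 < z.re) (x : X) :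
    IntegrableOn (fun s : ℝ => Complex.exp (-z * s) • U s x) (Ioi 0) :=
  ((exp_neg_integrableOn_Ioi 0 hz).const_mul (K * ‖x‖)).mono'
    (h.continuous_exp_smul z x).aestronglyMeasurable (ae_of_all _ (h.norm_exp_smul_le z x))

theorem tendsto_exp_smul (h : IsBddSemigroup A U K) {z : ℂ} (hz : 0 < z.re) (x : X) :
    Tendsto (fun s : ℝ => Complex.exp (-z * s) • U s x) atTop (𝓝 0) := by
  have hexp : Tendsto (fun s : ℝ => Real.exp (-z.re * s)) atTop (𝓝 0) :=
    Real.tendsto_exp_atBot.comp (tendsto_id.const_mul_atTop_of_neg (neg_neg_of_pos hz))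
  refine squeeze_zero_norm (h.norm_exp_smul_le z x) ?_
  simpa only [mul_zero] using hexp.const_mul (K * ‖x‖)

end IsBddSemigroup

variable [CompleteSpace X]

theorem hasDerivAt_exp_smul_integral_add {g : ℝ → X} (hg : Continuous g) (z : ℂ) (t : ℝ) :
    HasDerivAt (fun k : ℝ => Complex.exp (z * k) • ∫ s in k..t + k, g s)
      (z • (∫ s in 0..t, g s) + (g t - g 0)) 0 := by
  have hG (r : ℝ) : HasDerivAt (fun r => ∫ s in 0..r, g s) (g r) r :=
    (hg.integral_hasStrictDerivAt 0 r).hasDerivAt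
  have hexp : HasDerivAt (fun k : ℝ => Complex.exp (z * k)) z 0 := by
    simpa using ((hasDerivAt_id (0 : ℝ)).ofReal_comp.const_mul z).cexp
  have hint : HasDerivAt (fun k => ∫ s in k..t + k, g s) (g t - g 0) 0 := by
    have hsub := ((hG (t + 0)).comp_const_add t 0).sub (hG 0)
    rw [add_zero] at hsub
    refine hsub.congr_of_eventuallyEq (.of_forall fun k => ?_)
    exact (intervalIntegral.integral_interval_sub_left (hg.intervalIntegrable _ _)
      (hg.intervalIntegrable _ _)).symm
  convert! hexp.smul hint using 1
  simp [add_comm]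

namespace IsBddSemigroup

variable {A : X →ₗ.[ℂ] X} {U : ℝ → X →L[ℂ] X} {K : ℝ}

theorem apply_integral_exp_smul (h : IsBddSemigroup A U K) (z : ℂ) {k t : ℝ} (hk : 0 ≤ k)
    (ht : 0 ≤ t) (x : X) :
    U k (∫ s in 0..t, Complex.exp (-z * s) • U s x) =
      Complex.exp (z * k) • ∫ s in k..t + k, Complex.exp (-z * s) • U s x := by
  have hshift : ∫ s in k..t + k, Complex.exp (-z * s) • U s x =
      ∫ s in 0..t, Complex.exp (-z * (s + k : ℝ)) • U (s + k) x := by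
    simpa using (intervalIntegral.integral_comp_add_right (a := 0) (b := t)
      (fun s : ℝ => Complex.exp (-z * s) • U s x) k).symm
  rw [hshift, ← (U k).intervalIntegral_comp_comm
    ((h.continuous_exp_smul z x).intervalIntegrable _ _), ← intervalIntegral.integral_smul]
  refine intervalIntegral.integral_congr fun s hs => ?_
  rw [uIcc_of_le ht] at hs
  simp only [map_smul]
  rw [← h.add k s hk hs.1, smul_smul, ← Complex.exp_add, add_comm k s]
  congr 2
  push_cast
  ring

theorem integral_mem_graph (h : IsBddSemigroup A U K) (z : ℂ) {t : ℝ} (ht : 0 ≤ t) (x : X) :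
    (∫ s in 0..t, Complex.exp (-z * s) • U s x,
      x - Complex.exp (-z * t) • U t x -
        z • ∫ s in 0..t, Complex.exp (-z * s) • U s x) ∈ A.graph := by
  have hslope := (hasDerivAt_exp_smul_integral_add (h.continuous_exp_smul z x) z
    t).tendsto_slope_zero_right
  rw [h.gen]
  convert hslope.congr' ?_ using 2
  · simp only [Complex.ofReal_zero, mul_zero, Complex.exp_zero, one_smul, h.zero]
    abel
  · filter_upwards [self_mem_nhdsWithin] with k (hk : 0 < k)
    rw [h.apply_integral_exp_smul z hk.le ht, ← Complex.ofReal_inv, Complex.coe_smul]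
    simp

theorem integral_exp_smul_eq (h : IsBddSemigroup A U K) {z : ℂ} (hz : 0 < z.re)
    {Q : X →L[ℂ] X} (hQ : IsShiftInv A z Q) (x : X) :
    ∫ s in Ioi (0 : ℝ), Complex.exp (-z * s) • U s x = Q x := by
  refine tendsto_nhds_unique
    (intervalIntegral_tendsto_integral_Ioi 0 (h.integrableOn_exp_smul hz x) tendsto_id) ?_
  have hlim : Tendsto (fun t : ℝ => Q x - Q (Complex.exp (-z * t) • U t x)) atTop (𝓝 (Q x)) := by
    simpa using ((Q.continuous.tendsto _).comp (h.tendsto_exp_smul hz x)).const_sub (Q x)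
  refine hlim.congr' ?_
  filter_upwards [eventually_ge_atTop 0] with t ht
  simpa only [add_sub_cancel, map_sub, id_eq] using hQ.apply_eq (h.integral_mem_graph z ht x)

end IsBddSemigroup

end Semigroup

section Inversion

open scoped FourierTransform

variable {X : Type*} [NormedAddCommGroup X] [NormedSpace ℂ X]
  {A : X →ₗ.[ℂ] X} {U : ℝ → X →L[ℂ] X} {Q : ℂ → X →L[ℂ] X} {K M : ℝ}

theorem IsShiftInv.sub_eq {z w : ℂ} {Q R : X →L[ℂ] X} (hQ : IsShiftInv A z Q)
    (hR : IsShiftInv A w R) : R - Q = (z - w) • Q.comp R := by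
  ext x
  have hQR := hQ.apply_eq (hR.mem_graph x)
  rw [show z • R x + (x - w • R x) = (z - w) • R x + x by module, map_add, map_smul] at hQR
  rw [sub_apply, smul_apply, ContinuousLinearMap.comp_apply, sub_eq_iff_eq_add, hQR]

/-- The point `a + 2πiξ` of the vertical line through `a`, so normalised that `ξ` is the variable of
Mathlib's Fourier transform. -/
def linePt (a ξ : ℝ) : ℂ := a + 2 * π * Complex.I * ξ

theorem linePt_re (a ξ : ℝ) : (linePt a ξ).re = a := by simp [linePt]

theorem norm_linePt_sq (a ξ : ℝ) : ‖linePt a ξ‖ ^ 2 = a ^ 2 + (2 * π * ξ) ^ 2 := by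
  rw [Complex.sq_norm, Complex.normSq_apply]
  simp [linePt]
  ring

theorem le_norm_linePt (a ξ : ℝ) : a ≤ ‖linePt a ξ‖ := by
  simpa only [linePt_re] using Complex.re_le_norm (linePt a ξ)

theorem linePt_sub (a ξ η : ℝ) :
    linePt a ξ - linePt a η = (2 * π * Complex.I) * ((ξ - η : ℝ) : ℂ) := by
  simp only [linePt]
  push_cast
  ring

theorem continuous_linePt (a : ℝ) : Continuous (linePt a) := by
  unfold linePt
  fun_prop

theorem continuous_shiftInv_linePt (hQ : ∀ z : ℂ, 0 < z.re → IsShiftInv A z (Q z))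
    (hM : ∀ z : ℂ, 0 < z.re → ‖z • Q z‖ ≤ M) {a : ℝ} (ha : 0 < a) :
    Continuous fun ξ => Q (linePt a ξ) := by
  have hM0 : 0 ≤ M := (norm_nonneg _).trans (hM 1 (by simp))
  have hbound (ξ : ℝ) : ‖Q (linePt a ξ)‖ ≤ M / a := by
    have hQξ := hM (linePt a ξ) (by rwa [linePt_re])
    rw [norm_smul] at hQξ
    rw [le_div_iff₀' ha]
    exact (mul_le_mul_of_nonneg_right (le_norm_linePt a ξ) (norm_nonneg _)).trans hQξ
  have hlip : LipschitzWith (2 * π * (M / a) ^ 2).toNNReal fun ξ => Q (linePt a ξ) := by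
    refine LipschitzWith.of_dist_le_mul fun ξ η => ?_
    have hpt : ‖2 * ↑π * Complex.I * ((η - ξ : ℝ) : ℂ)‖ = 2 * π * ‖ξ - η‖ := by
      rw [norm_mul, Complex.norm_real, norm_sub_rev]
      simp [abs_of_pos Real.pi_pos]
    rw [dist_eq_norm, (hQ (linePt a η) (by rwa [linePt_re])).sub_eq
      (hQ (linePt a ξ) (by rwa [linePt_re])), linePt_sub, norm_smul, dist_eq_norm,
      Real.coe_toNNReal _ (by positivity), hpt]
    calc 2 * π * ‖ξ - η‖ * ‖(Q (linePt a η)).comp (Q (linePt a ξ))‖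
        ≤ 2 * π * ‖ξ - η‖ * ((M / a) * (M / a)) := by
          gcongr
          exact (ContinuousLinearMap.opNorm_comp_le _ _).trans
            (mul_le_mul (hbound _) (hbound _) (norm_nonneg _) (by positivity))
      _ = 2 * π * (M / a) ^ 2 * ‖ξ - η‖ := by ring
  exact hlip.continuous

theorem hasDerivAt_shiftInv_linePt (hQ : ∀ z : ℂ, 0 < z.re → IsShiftInv A z (Q z))
    (hM : ∀ z : ℂ, 0 < z.re → ‖z • Q z‖ ≤ M) {a : ℝ} (ha : 0 < a) (ξ : ℝ) :
    HasDerivAt (fun ξ => Q (linePt a ξ))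
      ((-2 * π * Complex.I : ℂ) • (Q (linePt a ξ)).comp (Q (linePt a ξ))) ξ := by
  rw [hasDerivAt_iff_tendsto_slope]
  have hcont : Continuous fun η =>
      (-2 * π * Complex.I : ℂ) • (Q (linePt a ξ)).comp (Q (linePt a η)) :=
    (continuous_const.clm_comp (continuous_shiftInv_linePt hQ hM ha)).const_smul
      (-2 * π * Complex.I : ℂ)
  refine ((hcont.tendsto ξ).mono_left nhdsWithin_le_nhds).congr' ?_
  filter_upwards [self_mem_nhdsWithin] with η (hη : η ≠ ξ)
  have hne : ((η - ξ : ℝ) : ℂ) ≠ 0 := by exact_mod_cast sub_ne_zero.2 hη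
  rw [slope_def_module, (hQ (linePt a ξ) (by rwa [linePt_re])).sub_eq
    (hQ (linePt a η) (by rwa [linePt_re])), linePt_sub, ← Complex.coe_smul, smul_smul,
    ← neg_sub η ξ, Complex.ofReal_inv, Complex.ofReal_neg]
  congr 1
  field_simp

theorem hasDerivAt_apply {q : ℝ → X →L[ℂ] X} {q' : X →L[ℂ] X} {v : ℝ → X} {v' : X} {ξ : ℝ}
    (hq : HasDerivAt q q' ξ) (hv : HasDerivAt v v' ξ) :
    HasDerivAt (fun η => q η (v η)) (q' (v ξ) + q ξ v') ξ :=
  ((ContinuousLinearMap.restrictScalarsL ℂ X X ℝ ℝ).hasFDerivAt.comp_hasDerivAt ξ hq).clm_apply hv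

/-- The weighted orbit `s ↦ sⁿ e^{-as} U(s) x`, `s > 0`, extended by `0`. Its Fourier transform at
`ξ` is `n! Q(a + 2πiξ)ⁿ⁺¹ x`. -/
def orbit (U : ℝ → X →L[ℂ] X) (a : ℝ) (n : ℕ) (x : X) : ℝ → X :=
  (Ioi 0).indicator fun s => (s ^ n * Real.exp (-a * s)) • U s x

theorem smul_orbit (U : ℝ → X →L[ℂ] X) (a : ℝ) (n : ℕ) (x : X) (s : ℝ) :
    s • orbit U a n x s = orbit U a (n + 1) x s := by
  by_cases hs : s ∈ Ioi (0 : ℝ)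
  · simp only [orbit, indicator_of_mem hs, smul_smul, pow_succ', mul_assoc]
  · simp only [orbit, indicator_of_notMem hs, smul_zero]

theorem IsBddSemigroup.integrable_orbit (h : IsBddSemigroup A U K) {a : ℝ} (ha : 0 < a) (n : ℕ)
    (x : X) : Integrable (orbit U a n x) := by
  have hweight : IntegrableOn (fun s : ℝ => s ^ n * Real.exp (-a * s)) (Ioi 0) := by
    simpa using integrableOn_rpow_mul_exp_neg_mul_rpow (p := 1) (s := n) (b := a)
      (neg_one_lt_zero.trans_le n.cast_nonneg) one_pos ha
  rw [orbit, integrable_indicator_iff measurableSet_Ioi]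
  refine (hweight.mul_const (K * ‖x‖)).mono'
    ((by fun_prop : Continuous fun s : ℝ => s ^ n * Real.exp (-a * s)).smul
      (h.cont x)).aestronglyMeasurable ?_
  refine ae_restrict_of_forall_mem measurableSet_Ioi fun s (hs : 0 < s) => ?_
  rw [norm_smul, Real.norm_of_nonneg (by positivity)]
  gcongr
  exact h.bound s x

theorem fourier_orbit_succ (h : IsBddSemigroup A U K) {a : ℝ} (ha : 0 < a) (n : ℕ) (x : X)
    {g : ℝ → X} (hg : 𝓕 (orbit U a n x) = g) {g' : X} {ξ : ℝ}
    (hgd : HasDerivAt g ((-2 * π * Complex.I : ℂ) • g') ξ) :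
    𝓕 (orbit U a (n + 1) x) ξ = g' := by
  have hderiv := Real.hasDerivAt_fourier (h.integrable_orbit ha n x)
    (by simpa only [smul_orbit] using h.integrable_orbit ha (n + 1) x) ξ
  have hpull : 𝓕 (fun s : ℝ => (-2 * π * Complex.I * s : ℂ) • orbit U a n x s) ξ =
      (-2 * π * Complex.I : ℂ) • 𝓕 (orbit U a (n + 1) x) ξ := by
    rw [Real.fourier_real_eq, Real.fourier_real_eq, ← integral_smul]
    refine integral_congr_ae (ae_of_all _ fun s => ?_)
    simp only [mul_smul (-2 * π * Complex.I : ℂ), Complex.coe_smul, smul_orbit]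
    exact smul_comm (𝐞 (-(s * ξ))) (-2 * π * Complex.I : ℂ) (orbit U a (n + 1) x s)
  rw [hg, hpull] at hderiv
  exact smul_right_injective X (by simp [Real.pi_ne_zero]) (hderiv.unique hgd)

variable [CompleteSpace X]

theorem fourier_orbit_zero (h : IsBddSemigroup A U K)
    (hQ : ∀ z : ℂ, 0 < z.re → IsShiftInv A z (Q z)) {a : ℝ} (ha : 0 < a) (x : X) :
    𝓕 (orbit U a 0 x) = fun ξ => Q (linePt a ξ) x := by
  ext ξ
  rw [← h.integral_exp_smul_eq (by rwa [linePt_re]) (hQ _ (by rwa [linePt_re])) x,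
    Real.fourier_real_eq_integral_exp_smul, ← integral_indicator measurableSet_Ioi]
  refine integral_congr_ae (ae_of_all _ fun s => ?_)
  by_cases hs : s ∈ Ioi (0 : ℝ)
  · simp only [orbit, indicator_of_mem hs]
    rw [← Complex.coe_smul, smul_smul, pow_zero, one_mul, Complex.ofReal_exp, ← Complex.exp_add]
    congr 2
    simp only [linePt]
    push_cast
    ring
  · simp only [orbit, indicator_of_notMem hs, smul_zero]

theorem fourier_orbit_two (h : IsBddSemigroup A U K)
    (hQ : ∀ z : ℂ, 0 < z.re → IsShiftInv A z (Q z))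
    (hM : ∀ z : ℂ, 0 < z.re → ‖z • Q z‖ ≤ M) {a : ℝ} (ha : 0 < a) (x : X) :
    𝓕 (orbit U a 2 x) = fun ξ =>
      (2 : ℂ) • Q (linePt a ξ) (Q (linePt a ξ) (Q (linePt a ξ) x)) := by
  have hderiv := hasDerivAt_shiftInv_linePt hQ hM ha
  have hderiv_apply (ξ : ℝ) := hasDerivAt_apply (hderiv ξ) (hasDerivAt_const ξ x)
  have hone : 𝓕 (orbit U a 1 x) = fun ξ => Q (linePt a ξ) (Q (linePt a ξ) x) := by
    ext ξ
    refine fourier_orbit_succ h ha 0 x (fourier_orbit_zero h hQ ha x) ?_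
    simpa using hderiv_apply ξ
  ext ξ
  refine fourier_orbit_succ h ha 1 x hone ?_
  convert! hasDerivAt_apply (hderiv ξ) (hderiv_apply ξ) using 1
  simp only [smul_apply, ContinuousLinearMap.comp_apply, map_zero, add_zero, map_smul]
  module

end Inversion

section Analytic

open scoped FourierTransform

variable {X : Type*} [NormedAddCommGroup X] [NormedSpace ℂ X]
  {A : X →ₗ.[ℂ] X} {U V : ℝ → X →L[ℂ] X} {Q : ℂ → X →L[ℂ] X} {K M C : ℝ}

theorem inv_norm_linePt_sq_eq {a : ℝ} (ha : 0 < a) (ξ : ℝ) :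
    (‖linePt a ξ‖ ^ 2)⁻¹ = (a ^ 2)⁻¹ * (1 + (2 * π / a * ξ) ^ 2)⁻¹ := by
  rw [norm_linePt_sq, ← mul_inv]
  congr 1
  field_simp

theorem integrable_inv_norm_linePt_sq {a : ℝ} (ha : 0 < a) :
    Integrable fun ξ => (‖linePt a ξ‖ ^ 2)⁻¹ := by
  simp only [inv_norm_linePt_sq_eq ha]
  exact (integrable_inv_one_add_sq.comp_mul_left' (R := 2 * π / a)
    (by positivity)).const_mul (a ^ 2)⁻¹

theorem integral_inv_norm_linePt_sq {a : ℝ} (ha : 0 < a) :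
    ∫ ξ, (‖linePt a ξ‖ ^ 2)⁻¹ = (2 * a)⁻¹ := by
  simp only [inv_norm_linePt_sq_eq ha]
  rw [integral_const_mul, Measure.integral_comp_mul_left (fun y : ℝ => (1 + y ^ 2)⁻¹),
    integral_univ_inv_one_add_sq, abs_of_pos (by positivity), smul_eq_mul]
  field_simp

theorem norm_pow_apply_le {z : ℂ} (hz : z ≠ 0) {R : X →L[ℂ] X} (hR : ‖z • R‖ ≤ M) (n : ℕ) (x : X) :
    ‖(R ^ n) x‖ ≤ M ^ n * (‖z‖ ^ n)⁻¹ * ‖x‖ := by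
  have hz' : 0 < ‖z‖ := norm_pos_iff.2 hz
  have hRz : ‖R‖ ≤ M * ‖z‖⁻¹ := by
    rwa [norm_smul, ← le_div_iff₀' hz', div_eq_mul_inv] at hR
  induction n with
  | zero => simp
  | succ n ih =>
    rw [pow_succ', mul_apply_eq_comp]
    calc ‖R ((R ^ n) x)‖ ≤ M * ‖z‖⁻¹ * (M ^ n * (‖z‖ ^ n)⁻¹ * ‖x‖) :=
          (R.le_opNorm _).trans (mul_le_mul hRz ih (norm_nonneg _) ((norm_nonneg R).trans hRz))
      _ = M ^ (n + 1) * (‖z‖ ^ (n + 1))⁻¹ * ‖x‖ := by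
          rw [pow_succ', pow_succ', mul_inv]
          ring

theorem norm_sq_apply_sub_smul_cube_apply_le {z : ℂ} (hz : z ≠ 0) {R : X →L[ℂ] X}
    (hR : ‖z • R‖ ≤ M) (x : X) :
    ‖(R ^ 2) x - z • (R ^ 3) x‖ ≤ (M ^ 2 + M ^ 3) * ‖x‖ * (‖z‖ ^ 2)⁻¹ := by
  have hz' : 0 < ‖z‖ := norm_pos_iff.2 hz
  calc ‖(R ^ 2) x - z • (R ^ 3) x‖
      ≤ M ^ 2 * (‖z‖ ^ 2)⁻¹ * ‖x‖ + ‖z‖ * (M ^ 3 * (‖z‖ ^ 3)⁻¹ * ‖x‖) := by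
        refine (norm_sub_le _ _).trans (add_le_add (norm_pow_apply_le hz hR 2 x) ?_)
        rw [norm_smul]
        gcongr
        exact norm_pow_apply_le hz hR 3 x
    _ = (M ^ 2 + M ^ 3) * ‖x‖ * (‖z‖ ^ 2)⁻¹ := by field_simp

theorem integrable_shiftInv_cube_linePt (hQ : ∀ z : ℂ, 0 < z.re → IsShiftInv A z (Q z))
    (hM : ∀ z : ℂ, 0 < z.re → ‖z • Q z‖ ≤ M) {a : ℝ} (ha : 0 < a) (x : X) :
    Integrable fun ξ => (2 : ℂ) • (Q (linePt a ξ) ^ 3) x := by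
  have hM0 : 0 ≤ M := (norm_nonneg _).trans (hM 1 (by simp))
  have hcont : Continuous fun ξ => (2 : ℂ) • (Q (linePt a ξ) ^ 3) x :=
    (((continuous_shiftInv_linePt hQ hM ha).pow 3).clm_apply continuous_const).const_smul _
  refine ((integrable_inv_norm_linePt_sq ha).const_mul (2 * (M ^ 3 * a⁻¹ * ‖x‖))).mono'
    hcont.aestronglyMeasurable (ae_of_all _ fun ξ => ?_)
  have hre : 0 < (linePt a ξ).re := by rwa [linePt_re]
  have hnorm : 0 < ‖linePt a ξ‖ := ha.trans_le (le_norm_linePt a ξ)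
  rw [norm_smul, Complex.norm_ofNat]
  calc 2 * ‖(Q (linePt a ξ) ^ 3) x‖
      ≤ 2 * (M ^ 3 * (‖linePt a ξ‖ ^ 2 * ‖linePt a ξ‖)⁻¹ * ‖x‖) := by
        rw [← pow_succ]
        gcongr
        exact norm_pow_apply_le (norm_pos_iff.1 hnorm) (hM _ hre) 3 x
    _ ≤ 2 * (M ^ 3 * (‖linePt a ξ‖ ^ 2 * a)⁻¹ * ‖x‖) := by
        gcongr
        exact le_norm_linePt a ξ
    _ = 2 * (M ^ 3 * a⁻¹ * ‖x‖) * (‖linePt a ξ‖ ^ 2)⁻¹ := by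
        rw [mul_inv]
        ring

/-- `V s = A U(s)` and `‖V s‖ ≤ C / s` for `s > 0`: the semigroup `U` generated by `-A` is
analytic. -/
structure IsDerivOf (A : X →ₗ.[ℂ] X) (U V : ℝ → X →L[ℂ] X) (C : ℝ) : Prop where
  mem_graph : ∀ s > 0, ∀ x, (U s x, V s x) ∈ A.graph
  bound : ∀ s > 0, ∀ x, ‖V s x‖ ≤ C / s * ‖x‖

namespace IsDerivOf

theorem add_apply (hV : IsDerivOf A U V C) (h : IsBddSemigroup A U K) {s r : ℝ} (hs : 0 ≤ s)
    (hr : 0 < r) (x : X) : V (s + r) x = U s (V r x) := by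
  have hgraph := h.map_graph hs (hV.mem_graph r hr x)
  rw [← h.add s r hs hr.le] at hgraph
  exact A.mem_graph_snd_inj (hV.mem_graph _ (by linarith) x) hgraph rfl

theorem intervalIntegrable (hV : IsDerivOf A U V C) (h : IsBddSemigroup A U K) {s t : ℝ}
    (hs : 0 < s) (hst : s ≤ t) (x : X) : IntervalIntegrable (fun r => V r x) volume s t := by
  have hcont : Continuous fun r => U (r - s) (V s x) := (h.cont (V s x)).comp (by fun_prop)
  refine (hcont.continuousOn.congr fun r hr => ?_).intervalIntegrable
  rw [uIcc_of_le hst] at hr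
  rw [← hV.add_apply h (sub_nonneg.2 hr.1) hs, sub_add_cancel]

end IsDerivOf

variable [CompleteSpace X]

theorem IsShiftInv.fourierInv_mem_graph {z : ℂ} {R : X →L[ℂ] X} (hR : IsShiftInv A z R)
    {f g : ℝ → X} (hf : Integrable f) (hg : Integrable g) (hfg : ∀ ξ, (f ξ, g ξ) ∈ A.graph)
    (s : ℝ) : (𝓕⁻ f s, 𝓕⁻ g s) ∈ A.graph := by
  rw [Real.fourierInv_eq_fourier_neg, Real.fourierInv_eq_fourier_neg, Real.fourier_eq,
    Real.fourier_eq]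
  refine hR.integral_mem_graph ((Real.fourierIntegral_convergent_iff _).2 hf)
    ((Real.fourierIntegral_convergent_iff _).2 hg) (ae_of_all _ fun ξ => ?_)
  exact A.graph.smul_mem (Real.fourierChar (-inner ℝ ξ (-s)) : ℂ) (hfg ξ)

theorem fourierInv_shiftInv_cube (h : IsBddSemigroup A U K)
    (hQ : ∀ z : ℂ, 0 < z.re → IsShiftInv A z (Q z))
    (hM : ∀ z : ℂ, 0 < z.re → ‖z • Q z‖ ≤ M) {a s : ℝ} (ha : 0 < a) (hs : 0 < s) (x : X) :
    𝓕⁻ (fun ξ => (2 : ℂ) • (Q (linePt a ξ) ^ 3) x) s = (s ^ 2 * Real.exp (-a * s)) • U s x := by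
  have hfourier : 𝓕 (orbit U a 2 x) = fun ξ => (2 : ℂ) • (Q (linePt a ξ) ^ 3) x :=
    fourier_orbit_two h hQ hM ha x
  have hcont : ContinuousAt (orbit U a 2 x) s := by
    have hcont' : Continuous fun r : ℝ => (r ^ 2 * Real.exp (-a * r)) • U r x :=
      (by fun_prop : Continuous fun r : ℝ => r ^ 2 * Real.exp (-a * r)).smul (h.cont x)
    refine hcont'.continuousAt.congr ?_
    filter_upwards [Ioi_mem_nhds hs] with r hr
    rw [orbit, indicator_of_mem hr]
  rw [← hfourier, (h.integrable_orbit ha 2 x).fourierInv_fourier_eq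
    (hfourier ▸ integrable_shiftInv_cube_linePt hQ hM ha x) hcont, orbit,
    indicator_of_mem (mem_Ioi.2 hs)]

/-- Fourier inversion on the line `Re z = 1/s` writes `s² e⁻¹ U(s) x` as the inverse transform of
`2 (z + A)⁻³ x`, whose image under `A` is still absolutely integrable. -/
theorem exists_mem_graph_norm_le (h : IsBddSemigroup A U K)
    (hQ : ∀ z : ℂ, 0 < z.re → IsShiftInv A z (Q z))
    (hM : ∀ z : ℂ, 0 < z.re → ‖z • Q z‖ ≤ M) {s : ℝ} (hs : 0 < s) (x : X) :
    ∃ y, (U s x, y) ∈ A.graph ∧ ‖y‖ ≤ Real.exp 1 * (M ^ 2 + M ^ 3) / s * ‖x‖ := by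
  have ha : 0 < s⁻¹ := inv_pos.2 hs
  have hre (ξ : ℝ) : 0 < (linePt s⁻¹ ξ).re := by rwa [linePt_re]
  have hne (ξ : ℝ) : linePt s⁻¹ ξ ≠ 0 := norm_pos_iff.1 (ha.trans_le (le_norm_linePt _ ξ))
  set g : ℝ → X := fun ξ => (2 : ℂ) •
    ((Q (linePt s⁻¹ ξ) ^ 2) x - linePt s⁻¹ ξ • (Q (linePt s⁻¹ ξ) ^ 3) x)
  have hg_norm (ξ : ℝ) :
      ‖g ξ‖ ≤ 2 * ((M ^ 2 + M ^ 3) * ‖x‖) * (‖linePt s⁻¹ ξ‖ ^ 2)⁻¹ := by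
    rw [norm_smul, Complex.norm_ofNat, mul_assoc]
    gcongr
    exact norm_sq_apply_sub_smul_cube_apply_le (hne ξ) (hM _ (hre ξ)) x
  have hbound_int := (integrable_inv_norm_linePt_sq ha).const_mul (2 * ((M ^ 2 + M ^ 3) * ‖x‖))
  have hg_cont : Continuous g := by
    have hQ_cont := continuous_shiftInv_linePt hQ hM ha
    exact (((hQ_cont.pow 2).clm_apply continuous_const).sub ((continuous_linePt _).smul
      ((hQ_cont.pow 3).clm_apply continuous_const))).const_smul _
  have hg_int : Integrable g :=
    hbound_int.mono' hg_cont.aestronglyMeasurable (ae_of_all _ hg_norm)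
  have hg_fourierInv : ‖𝓕⁻ g s‖ ≤ (M ^ 2 + M ^ 3) * ‖x‖ * s := calc
    ‖𝓕⁻ g s‖ ≤ ∫ ξ, ‖g ξ‖ := by
      rw [Real.fourierInv_eq_fourier_neg]
      exact VectorFourier.norm_fourierIntegral_le_integral_norm ..
    _ ≤ ∫ ξ, 2 * ((M ^ 2 + M ^ 3) * ‖x‖) * (‖linePt s⁻¹ ξ‖ ^ 2)⁻¹ :=
      integral_mono hg_int.norm hbound_int hg_norm
    _ = (M ^ 2 + M ^ 3) * ‖x‖ * s := by
      rw [integral_const_mul, integral_inv_norm_linePt_sq ha]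
      field_simp
  have hgraph := (hQ 1 (by simp)).fourierInv_mem_graph (integrable_shiftInv_cube_linePt hQ hM ha x)
    hg_int (fun ξ => A.graph.smul_mem (2 : ℂ) ((hQ _ (hre ξ)).mem_graph _)) s
  rw [fourierInv_shiftInv_cube h hQ hM ha hs, neg_mul, inv_mul_cancel₀ hs.ne'] at hgraph
  have hc : s ^ 2 * Real.exp (-1) ≠ 0 := by positivity
  refine ⟨(((s ^ 2 * Real.exp (-1))⁻¹ : ℝ) : ℂ) • 𝓕⁻ g s, ?_, ?_⟩
  · have hscaled := A.graph.smul_mem (((s ^ 2 * Real.exp (-1))⁻¹ : ℝ) : ℂ) hgraph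
    rwa [Prod.smul_mk, Complex.coe_smul, smul_smul, inv_mul_cancel₀ hc, one_smul] at hscaled
  · rw [norm_smul, Complex.norm_real, Real.norm_of_nonneg (by positivity)]
    calc (s ^ 2 * Real.exp (-1))⁻¹ * ‖𝓕⁻ g s‖
        ≤ (s ^ 2 * Real.exp (-1))⁻¹ * ((M ^ 2 + M ^ 3) * ‖x‖ * s) := by gcongr
      _ = Real.exp 1 * (M ^ 2 + M ^ 3) / s * ‖x‖ := by
        rw [Real.exp_neg]
        field_simp

theorem exists_isDerivOf (h : IsBddSemigroup A U K)
    (hQ : ∀ z : ℂ, 0 < z.re → IsShiftInv A z (Q z))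
    (hM : ∀ z : ℂ, 0 < z.re → ‖z • Q z‖ ≤ M) :
    ∃ V, IsDerivOf A U V (Real.exp 1 * (M ^ 2 + M ^ 3)) := by
  have hpointwise (s : ℝ) : ∃ Vs : X →L[ℂ] X, 0 < s → ∀ x, (U s x, Vs x) ∈ A.graph ∧
      ‖Vs x‖ ≤ Real.exp 1 * (M ^ 2 + M ^ 3) / s * ‖x‖ := by
    by_cases hs : 0 < s
    · choose v hv hbound using exists_mem_graph_norm_le h hQ hM hs
      refine ⟨LinearMap.mkContinuous ⟨⟨v, fun x y => ?_⟩, fun c x => ?_⟩ _ hbound,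
        fun _ x => ⟨hv x, hbound x⟩⟩
      · have hadd := A.graph.add_mem (hv x) (hv y)
        rw [Prod.mk_add_mk, ← map_add] at hadd
        exact A.mem_graph_snd_inj (hv _) hadd rfl
      · have hsmul := A.graph.smul_mem c (hv x)
        rw [Prod.smul_mk, ← map_smul] at hsmul
        exact A.mem_graph_snd_inj (hv _) hsmul rfl
    · exact ⟨0, fun h => absurd h hs⟩
  choose V hV using hpointwise
  exact ⟨V, fun s hs x => (hV s hs x).1, fun s hs x => (hV s hs x).2⟩

namespace IsDerivOf

theorem sub_eq_integral (hV : IsDerivOf A U V C) (h : IsBddSemigroup A U K) {z : ℂ}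
    {R : X →L[ℂ] X} (hR : IsShiftInv A z R) {s t : ℝ} (hs : 0 < s) (hst : s ≤ t) (x : X) :
    U s x - U t x = ∫ r in s..t, V r x := by
  have hgraph := h.integral_mem_graph 0 (sub_nonneg.2 hst) (U s x)
  simp only [neg_zero, zero_mul, Complex.exp_zero, one_smul, zero_smul, sub_zero] at hgraph
  rw [← h.add _ _ (sub_nonneg.2 hst) hs.le, sub_add_cancel] at hgraph
  have hshift : ∫ r in 0..t - s, U r (U s x) = ∫ r in s..t, U r x := calc
    ∫ r in 0..t - s, U r (U s x) = ∫ r in 0..t - s, U (r + s) x := by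
      refine intervalIntegral.integral_congr fun r hr => ?_
      rw [uIcc_of_le (sub_nonneg.2 hst)] at hr
      exact (h.add _ _ hr.1 hs.le x).symm
    _ = ∫ r in s..t, U r x := by
      rw [intervalIntegral.integral_comp_add_right (fun r => U r x), zero_add, sub_add_cancel]
  rw [hshift] at hgraph
  refine A.mem_graph_snd_inj hgraph ?_ rfl
  rw [intervalIntegral.integral_of_le hst, intervalIntegral.integral_of_le hst]
  refine hR.integral_mem_graph ?_ ?_ ?_
  · exact (intervalIntegrable_iff_integrableOn_Ioc_of_le hst).1 ((h.cont x).intervalIntegrable _ _)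
  · exact (intervalIntegrable_iff_integrableOn_Ioc_of_le hst).1 (hV.intervalIntegrable h hs hst x)
  · exact ae_restrict_of_forall_mem measurableSet_Ioc fun r hr => hV.mem_graph r (hs.trans hr.1) x

theorem norm_sub_le (hV : IsDerivOf A U V C) (h : IsBddSemigroup A U K) (hC : 0 ≤ C) {z : ℂ}
    {R : X →L[ℂ] X} (hR : IsShiftInv A z R) {s t : ℝ} (hs : 0 < s) (hst : s ≤ t) (x : X) :
    ‖U s x - U t x‖ ≤ C / s * ‖x‖ * (t - s) := by
  rw [hV.sub_eq_integral h hR hs hst, ← abs_of_nonneg (sub_nonneg.2 hst)]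
  refine intervalIntegral.norm_integral_le_of_norm_le_const fun r hr => ?_
  rw [uIoc_of_le hst] at hr
  exact (hV.bound r (hs.trans hr.1) x).trans (by gcongr; exact hr.1.le)

theorem norm_deriv_sub_le (hV : IsDerivOf A U V C) (h : IsBddSemigroup A U K) (hC : 0 ≤ C) {z : ℂ}
    {R : X →L[ℂ] X} (hR : IsShiftInv A z R) {s t : ℝ} (hs : 0 < s) (hst : s ≤ t) (x : X) :
    ‖V s x - V t x‖ ≤ (2 * C / s) ^ 2 * ‖x‖ * (t - s) := by
  have hVt : V t x = U (t - s / 2) (V (s / 2) x) := by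
    rw [← hV.add_apply h (by linarith) (by positivity), sub_add_cancel]
  have hVs : V s x = U (s / 2) (V (s / 2) x) := by
    rw [← hV.add_apply h (by positivity) (by positivity), add_halves]
  have hst' : 0 ≤ t - s := sub_nonneg.2 hst
  rw [hVs, hVt]
  calc ‖U (s / 2) (V (s / 2) x) - U (t - s / 2) (V (s / 2) x)‖
      ≤ C / (s / 2) * ‖V (s / 2) x‖ * (t - s / 2 - s / 2) :=
        hV.norm_sub_le h hC hR (by positivity) (by linarith) _
    _ ≤ C / (s / 2) * (C / (s / 2) * ‖x‖) * (t - s) := by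
        rw [sub_sub, add_halves]
        gcongr
        exact hV.bound _ (by positivity) x
    _ = (2 * C / s) ^ 2 * ‖x‖ * (t - s) := by field_simp

theorem norm_sub_sub_smul_le (hV : IsDerivOf A U V C) (h : IsBddSemigroup A U K) (hC : 0 ≤ C)
    {z : ℂ} {R : X →L[ℂ] X} (hR : IsShiftInv A z R) {s t : ℝ} (hs : 0 < s) (hst : s ≤ t) (x : X) :
    ‖U s x - U t x - (t - s) • V s x‖ ≤ (2 * C / s) ^ 2 * ‖x‖ * (t - s) ^ 2 := by
  have hconst : ∫ _ in s..t, V s x = (t - s) • V s x := intervalIntegral.integral_const _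
  rw [hV.sub_eq_integral h hR hs hst, ← hconst, ← intervalIntegral.integral_sub
    (hV.intervalIntegrable h hs hst x) intervalIntegrable_const, sq (t - s),
    ← mul_assoc]
  nth_rw 2 [← abs_of_nonneg (sub_nonneg.2 hst)]
  refine intervalIntegral.norm_integral_le_of_norm_le_const fun r hr => ?_
  rw [uIoc_of_le hst] at hr
  rw [norm_sub_rev]
  refine (hV.norm_deriv_sub_le h hC hR hs hr.1.le x).trans ?_
  gcongr
  exact hr.2

/-- Splitting the Laplace transform at `t`, the tail is `e^{-zt} (z + A)⁻¹ U(t)`, in which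
`z (z + A)⁻¹ = 1 - A (z + A)⁻¹` is used once. -/
theorem smul_shiftInv_eq (hV : IsDerivOf A U V C) (h : IsBddSemigroup A U K) {z : ℂ} (hz : z ≠ 0)
    {R : X →L[ℂ] X} (hR : IsShiftInv A z R) {t : ℝ} (ht : 0 < t) (x : X) :
    z • R x = z • (∫ s in 0..t, Complex.exp (-z * s) • U s x) + Complex.exp (-z * t) • U t x -
      (Complex.exp (-z * t) * z⁻¹) • V t (z • R x) := by
  have hR_integral := hR.apply_eq (h.integral_mem_graph z ht.le x)
  rw [add_sub_cancel, map_sub, map_smul] at hR_integral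
  have hU_graph := h.map_graph ht.le (hR.mem_graph x)
  have hVR := A.mem_graph_snd_inj (hV.mem_graph t ht (R x)) hU_graph rfl
  have hRU := hR.apply_eq hU_graph
  simp only [map_sub, map_smul] at hVR hRU
  rw [add_sub_cancel] at hRU
  rw [map_smul, hVR, ← hR_integral, hRU, smul_smul, mul_assoc, inv_mul_cancel₀ hz, mul_one]
  module

end IsDerivOf

end Analytic

section Sector

theorem sin_mul_re_sub_abs_im_mul_cos (φ : ℝ) (z : ℂ) :
    Real.sin φ * z.re - |z.im| * Real.cos φ = ‖z‖ * Real.sin (φ - |z.arg|) := by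
  have him : |z.im| = ‖z‖ * Real.sin |z.arg| := by
    rw [← Complex.norm_mul_sin_arg, abs_mul, abs_norm,
      Real.abs_sin_eq_sin_abs_of_abs_le_pi (Complex.abs_arg_le_pi z)]
  have hre : z.re = ‖z‖ * Real.cos |z.arg| := by rw [Real.cos_abs, Complex.norm_mul_cos_arg]
  rw [Real.sin_sub, him, hre]
  ring

theorem mem_sector_iff {φ : ℝ} (hφ : φ ∈ Ioo 0 π) {z : ℂ} :
    z ∈ sector φ ↔ |z.im| * Real.cos φ < Real.sin φ * z.re := by
  rw [← sub_pos, sin_mul_re_sub_abs_im_mul_cos]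
  refine ⟨fun ⟨hz, harg⟩ => mul_pos (norm_pos_iff.2 hz) ?_, fun hpos => ⟨?_, ?_⟩⟩
  · exact Real.sin_pos_of_pos_of_lt_pi (sub_pos.2 harg) (by linarith [hφ.2, abs_nonneg z.arg])
  · rintro rfl
    simp at hpos
  · by_contra! harg
    exact hpos.not_ge <| mul_nonpos_of_nonneg_of_nonpos (norm_nonneg z) <|
      Real.sin_nonpos_of_nonpos_of_neg_pi_le (by linarith)
        (by linarith [hφ.1, Complex.abs_arg_le_pi z])

theorem mem_closure_sector_iff {φ : ℝ} (hφ : φ ∈ Ioo 0 π) {z : ℂ} :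
    z ∈ closure (sector φ) ↔ |z.im| * Real.cos φ ≤ Real.sin φ * z.re := by
  refine ⟨fun hz => ?_, fun hz => ?_⟩
  · have hclosed : IsClosed {w : ℂ | |w.im| * Real.cos φ ≤ Real.sin φ * w.re} :=
      isClosed_le (by fun_prop) (by fun_prop)
    exact closure_minimal (fun w hw => ((mem_sector_iff hφ).1 hw).le) hclosed hz
  · have hshift : Tendsto (fun ε : ℝ => z + ε) (𝓝[>] 0) (𝓝 z) := by
      have hcont : Continuous fun ε : ℝ => z + (ε : ℂ) := by fun_prop
      exact (hcont.tendsto' 0 z (by simp)).mono_left nhdsWithin_le_nhds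
    refine mem_closure_of_tendsto hshift ?_
    filter_upwards [self_mem_nhdsWithin] with ε (hε : 0 < ε)
    rw [mem_sector_iff hφ, Complex.add_im, Complex.ofReal_im, add_zero, Complex.add_re,
      Complex.ofReal_re, mul_add]
    exact lt_add_of_le_of_pos hz (mul_pos (Real.sin_pos_of_mem_Ioo hφ) hε)

theorem sector_mono {φ θ : ℝ} (h : φ ≤ θ) : sector φ ⊆ sector θ :=
  fun _ hz => ⟨hz.1, hz.2.trans_le h⟩

theorem add_mem_closure_sector {φ ω : ℝ} (hφ : φ ∈ Ioo 0 π) (hω : 0 ≤ ω) {z : ℂ}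
    (hz : z ∈ closure (sector φ)) : z + ω ∈ closure (sector φ) := by
  rw [mem_closure_sector_iff hφ] at hz ⊢
  rw [Complex.add_im, Complex.ofReal_im, add_zero, Complex.add_re, Complex.ofReal_re, mul_add]
  exact le_add_of_le_of_nonneg hz (mul_nonneg (Real.sin_pos_of_mem_Ioo hφ).le hω)

theorem zero_mem_closure_sector {φ : ℝ} (hφ : φ ∈ Ioo 0 π) : 0 ∈ closure (sector φ) :=
  (mem_closure_sector_iff hφ).2 (by simp)

theorem notMem_closure_sector_of_re_neg {φ : ℝ} (hφ : φ ∈ Ioo 0 (π / 2)) {z : ℂ}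
    (hz : z.re < 0) : z ∉ closure (sector φ) := by
  have hφπ : φ ∈ Ioo 0 π := ⟨hφ.1, hφ.2.trans (half_lt_self Real.pi_pos)⟩
  have hcos : 0 < Real.cos φ := Real.cos_pos_of_mem_Ioo ⟨by linarith [hφ.1, Real.pi_pos], hφ.2⟩
  rw [mem_closure_sector_iff hφπ, not_le]
  exact (mul_neg_of_pos_of_neg (Real.sin_pos_of_mem_Ioo hφπ) hz).trans_le (by positivity)

theorem re_le_of_notMem_sector {θ : ℝ} (hθ : 0 ≤ θ) {z : ℂ} (hz : z ∉ sector θ) :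
    z.re ≤ ‖z‖ * Real.cos θ := by
  rcases eq_or_ne z 0 with rfl | hz0
  · simp
  have harg : θ ≤ |z.arg| := not_lt.1 fun h => hz ⟨hz0, h⟩
  rw [← Complex.norm_mul_cos_arg, ← Real.cos_abs z.arg]
  gcongr
  exact Real.cos_le_cos_of_nonneg_of_le_pi hθ (Complex.abs_arg_le_pi z) harg

end Sector

section AddScalar

variable {X : Type*} [NormedAddCommGroup X] [NormedSpace ℂ X] {A : X →ₗ.[ℂ] X} {ω : ℝ} {z : ℂ}

theorem isResolventAt_resolvent (hz : z ∈ resolventSet A) :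
    IsResolventAt A z (resolvent A z) := by
  have hz' : ∃ R : X →L[ℂ] X, IsResolventAt A z R := hz
  rw [resolvent, dif_pos hz']
  exact hz'.choose_spec

theorem IsResolventAt.unique {R R' : X →L[ℂ] X} (h : IsResolventAt A z R)
    (h' : IsResolventAt A z R') : R = R' := by
  ext x
  obtain ⟨hx, hxR'⟩ := h'.1 x
  simpa only [hxR'] using h.2 ⟨R' x, hx⟩

theorem isResolventAt_addScalar_iff {R : X →L[ℂ] X} :
    IsResolventAt (addScalar A ω) z R ↔ IsResolventAt A (z - ω) R := by
  have hsub (y : A.domain) : z • (y : X) - addScalar A ω y = (z - ω) • (y : X) - A y := by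
    change z • (y : X) - ((ω : ℂ) • (y : X) + A y) = _
    module
  exact and_congr
    (forall_congr' fun x => exists_congr fun hx => by rw [← hsub ⟨R x, hx⟩]; rfl)
    (forall_congr' fun y => by rw [← hsub y])

theorem mem_graph_addScalar_iff {x y : X} :
    (x, y) ∈ (addScalar A ω).graph ↔ (x, y - (ω : ℂ) • x) ∈ A.graph := by
  rw [LinearPMap.mem_graph_iff, LinearPMap.mem_graph_iff]
  refine exists_congr fun (w : A.domain) => and_congr_right fun (hw : (w : X) = x) => ?_
  change (ω : ℂ) • (w : X) + A w = y ↔ A w = y - (ω : ℂ) • x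
  rw [hw, eq_sub_iff_add_eq']

theorem mem_graph_neg_iff {x y : X} : (x, y) ∈ (-A).graph ↔ (x, -y) ∈ A.graph := by
  rw [LinearPMap.mem_graph_iff, LinearPMap.mem_graph_iff]
  exact exists_congr fun w => and_congr_right fun _ => neg_eq_iff_eq_neg

theorem mem_resolventSet_addScalar_iff :
    z ∈ resolventSet (addScalar A ω) ↔ z - ω ∈ resolventSet A :=
  exists_congr fun _ => isResolventAt_addScalar_iff

theorem resolvent_addScalar (hz : z - ω ∈ resolventSet A) :
    resolvent (addScalar A ω) z = resolvent A (z - ω) :=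
  (isResolventAt_resolvent (mem_resolventSet_addScalar_iff.2 hz)).unique
    (isResolventAt_addScalar_iff.2 (isResolventAt_resolvent hz))

theorem spectrum_addScalar_subset {φ θ : ℝ} (hφ : φ ∈ Ioo 0 π) (hφθ : φ ≤ θ) (hω : 0 ≤ ω)
    (hσ : spectrum A ⊆ closure (sector φ)) :
    spectrum (addScalar A ω) ⊆ closure (sector θ) := by
  intro z hz
  have hzω : z - ω ∈ closure (sector φ) := hσ fun h => hz (mem_resolventSet_addScalar_iff.2 h)
  have hz_mem := add_mem_closure_sector hφ hω hzω
  rw [sub_add_cancel] at hz_mem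
  exact closure_mono (sector_mono hφθ) hz_mem

end AddScalar

section Rescale

variable {X : Type*} [NormedAddCommGroup X] [NormedSpace ℂ X] {A : X →ₗ.[ℂ] X}

/-- The rescaled semigroup `e^{-ωs} S(s)`, extended by its value at `0` to negative times. -/
def rescale (S : ℝ → X →L[ℂ] X) (ω s : ℝ) : X →L[ℂ] X :=
  ((Real.exp (-ω * max s 0) : ℝ) : ℂ) • S (max s 0)

variable {S : ℝ → X →L[ℂ] X} {ω K : ℝ}

theorem rescale_of_nonneg (S : ℝ → X →L[ℂ] X) (ω : ℝ) {s : ℝ} (hs : 0 ≤ s) :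
    rescale S ω s = ((Real.exp (-ω * s) : ℝ) : ℂ) • S s := by
  rw [rescale, max_eq_left hs]

theorem rescale_max (S : ℝ → X →L[ℂ] X) (ω s : ℝ) : rescale S ω (max s 0) = rescale S ω s := by
  rw [rescale, rescale, max_eq_left (le_max_right s 0)]

theorem rescale_of_nonpos (hS : IsC0Semigroup S) {s : ℝ} (hs : s ≤ 0) (x : X) :
    rescale S ω s x = x := by
  rw [rescale, max_eq_right hs, hS.1, mul_zero, Real.exp_zero, Complex.ofReal_one, one_smul,
    ContinuousLinearMap.id_apply]

theorem rescale_add (hS : IsC0Semigroup S) {s r : ℝ} (hs : 0 ≤ s) (hr : 0 ≤ r) (x : X) :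
    rescale S ω (s + r) x = rescale S ω s (rescale S ω r x) := by
  rw [rescale_of_nonneg S ω hs, rescale_of_nonneg S ω hr, rescale_of_nonneg S ω (add_nonneg hs hr),
    hS.2.1 s r hs hr]
  simp only [smul_apply, ContinuousLinearMap.comp_apply, map_smul, smul_smul]
  rw [← Complex.ofReal_mul, ← Real.exp_add, mul_add, add_comm]

theorem tendsto_rescale (hS : IsC0Semigroup S) (x : X) :
    Tendsto (fun s => rescale S ω s x) (𝓝 0) (𝓝 x) := by
  rw [← nhdsLE_sup_nhdsGT, tendsto_sup]
  constructor
  · refine tendsto_const_nhds.congr' ?_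
    filter_upwards [self_mem_nhdsWithin] with s hs
    exact (rescale_of_nonpos hS hs x).symm
  · have hcont : Continuous fun s : ℝ => ((Real.exp (-ω * s) : ℝ) : ℂ) := by fun_prop
    have hexp := (hcont.tendsto' 0 1 (by simp)).mono_left (nhdsWithin_le_nhds (s := Ioi 0))
    have hlim := hexp.smul (hS.2.2 x)
    rw [one_smul] at hlim
    refine hlim.congr' ?_
    filter_upwards [self_mem_nhdsWithin] with s (hs : 0 < s)
    rw [rescale_of_nonneg S ω hs.le, smul_apply]

theorem norm_rescale_le (hS : IsC0Semigroup S) (hK : ∀ s > 0, ‖rescale S ω s‖ ≤ K) (s : ℝ) (x : X) :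
    ‖rescale S ω s x‖ ≤ K * ‖x‖ := by
  have hpos (r : ℝ) (hr : 0 < r) : ‖rescale S ω r x‖ ≤ K * ‖x‖ :=
    (rescale S ω r).le_of_opNorm_le (hK r hr) x
  rcases lt_or_ge 0 s with hs | hs
  · exact hpos s hs
  · rw [rescale_of_nonpos hS hs]
    have hlim := (tendsto_rescale (ω := ω) hS x).mono_left (nhdsWithin_le_nhds (s := Ioi 0))
    exact le_of_tendsto hlim.norm (eventually_nhdsWithin_of_forall hpos)

theorem norm_rescale_sub_le (hS : IsC0Semigroup S) (hK : ∀ s > 0, ‖rescale S ω s‖ ≤ K) (s r : ℝ)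
    (x : X) : ‖rescale S ω s x - rescale S ω r x‖ ≤
      K * ‖rescale S ω |max s 0 - max r 0| x - x‖ := by
  wlog hrs : r ≤ s generalizing s r
  · rw [norm_sub_rev, abs_sub_comm]
    exact this r s (le_of_not_ge hrs)
  have hsub : 0 ≤ max s 0 - max r 0 := sub_nonneg.2 (max_le_max_right 0 hrs)
  have hsplit : rescale S ω s x = rescale S ω r (rescale S ω (max s 0 - max r 0) x) := by
    rw [← rescale_max S ω r, ← rescale_add hS (le_max_right r 0) hsub, add_sub_cancel, rescale_max]
  rw [abs_of_nonneg hsub, hsplit, ← map_sub]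
  exact norm_rescale_le hS hK r _

theorem continuous_rescale (hS : IsC0Semigroup S) (hK : ∀ s > 0, ‖rescale S ω s‖ ≤ K) (x : X) :
    Continuous fun s => rescale S ω s x := by
  refine continuous_iff_continuousAt.2 fun r => tendsto_iff_norm_sub_tendsto_zero.2 ?_
  have hdist : Tendsto (fun s : ℝ => |max s 0 - max r 0|) (𝓝 r) (𝓝 0) :=
    (by fun_prop : Continuous fun s : ℝ => |max s 0 - max r 0|).tendsto' r 0 (by simp)
  have hbound := ((((tendsto_rescale (ω := ω) hS x).comp hdist).sub_const x).norm).const_mul K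
  rw [sub_self, norm_zero, mul_zero] at hbound
  exact squeeze_zero (fun _ => norm_nonneg _) (fun s => norm_rescale_sub_le hS hK s r x) hbound

theorem tendsto_slope_exp_smul {u : ℝ → X} {x y : X} (c : ℝ)
    (hu : Tendsto (fun s : ℝ => (s : ℂ)⁻¹ • (u s - x)) (𝓝[>] 0) (𝓝 y)) :
    Tendsto (fun s : ℝ => (s : ℂ)⁻¹ • (((Real.exp (c * s) : ℝ) : ℂ) • u s - x)) (𝓝[>] 0)
      (𝓝 (y + (c : ℂ) • x)) := by
  have hexp : HasDerivAt (fun s : ℝ => ((Real.exp (c * s) : ℝ) : ℂ)) c 0 := by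
    simpa using (((hasDerivAt_id (0 : ℝ)).const_mul c).exp).ofReal_comp
  have hexp_lim := hexp.continuousAt.tendsto.mono_left (nhdsWithin_le_nhds (s := Ioi 0))
  have hslope := hexp.tendsto_slope_zero_right
  simp only [zero_add, mul_zero, Real.exp_zero, Complex.ofReal_one] at hexp_lim hslope
  have hlim := (hexp_lim.smul hu).add (hslope.smul_const x)
  rw [one_smul] at hlim
  refine hlim.congr fun s => ?_
  rw [← Complex.coe_smul, Complex.ofReal_inv]
  module

theorem isBddSemigroup_rescale (hS : IsC0Semigroup S) (hgen : IsGeneratorOf (-A) S)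
    (hK : ∀ s > 0, ‖rescale S ω s‖ ≤ K) : IsBddSemigroup (addScalar A ω) (rescale S ω) K where
  zero := rescale_of_nonpos hS le_rfl
  add _ _ hs hr x := rescale_add hS hs hr x
  cont := continuous_rescale hS hK
  bound := norm_rescale_le hS hK
  gen x y := by
    rw [mem_graph_addScalar_iff, ← neg_neg (y - (ω : ℂ) • x), ← mem_graph_neg_iff, hgen]
    constructor <;> intro h
    · have hslope := tendsto_slope_exp_smul (-ω) h
      rw [Complex.ofReal_neg, show -(y - (ω : ℂ) • x) + -(ω : ℂ) • x = -y by module] at hslope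
      refine hslope.congr' ?_
      filter_upwards [self_mem_nhdsWithin] with s (hs : 0 < s)
      rw [rescale_of_nonneg S ω hs.le, smul_apply]
    · have hslope := tendsto_slope_exp_smul ω h
      rw [show -y + (ω : ℂ) • x = -(y - (ω : ℂ) • x) by module] at hslope
      refine hslope.congr' ?_
      filter_upwards [self_mem_nhdsWithin] with s (hs : 0 < s)
      rw [rescale_of_nonneg S ω hs.le, smul_apply, smul_smul, ← Complex.ofReal_mul,
        ← Real.exp_add, neg_mul, add_neg_cancel, Real.exp_zero, Complex.ofReal_one, one_smul]

end Rescale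

section Absorb

variable {X : Type*} [NormedAddCommGroup X] [NormedSpace ℂ X] {A : X →ₗ.[ℂ] X}
  {U V : ℝ → X →L[ℂ] X} {K C : ℝ}

theorem norm_exp_neg_mul_le {m s : ℝ} (hm : 0 < m) {z : ℂ} (hz : z ≠ 0)
    (hre : -(‖z‖ / m) ≤ z.re) (hs : s ∈ Icc 0 (m / ‖z‖)) :
    ‖Complex.exp (-z * s)‖ ≤ Real.exp 1 := by
  have hz' : 0 < ‖z‖ := norm_pos_iff.2 hz
  rw [Complex.norm_exp, Real.exp_le_exp, Complex.re_mul_ofReal, Complex.neg_re]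
  calc -z.re * s ≤ ‖z‖ / m * (m / ‖z‖) :=
        mul_le_mul (neg_le.1 hre) hs.2 hs.1 (by positivity)
    _ = 1 := by field_simp

theorem smul_integral_mem_closure_convexHull [CompleteSpace X] (hU : ∀ x, Continuous fun s => U s x)
    {𝒜 : Set (X →L[ℂ] X)} {z : ℂ} {t : ℝ} (ht : 0 < t)
    (h𝒜 : ∀ s ∈ Ioc 0 t, ((t : ℂ) * z * Complex.exp (-z * s)) • U s ∈ 𝒜) (x : X) :
    z • (∫ s in 0..t, Complex.exp (-z * s) • U s x) ∈
      closure (convexHull ℝ ((fun B => B x) '' 𝒜)) := by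
  have haverage : z • (∫ s in 0..t, Complex.exp (-z * s) • U s x) =
      ⨍ s in Ioc 0 t, ((t : ℂ) * z * Complex.exp (-z * s)) • U s x := by
    simp_rw [setAverage_eq, ← intervalIntegral.integral_of_le ht.le, Measure.real, Real.volume_Ioc,
      sub_zero, ENNReal.toReal_ofReal ht.le, mul_smul, intervalIntegral.integral_smul,
      Complex.coe_smul, inv_smul_smul₀ ht.ne']
  have hcont : Continuous fun s : ℝ => ((t : ℂ) * z * Complex.exp (-z * s)) • U s x :=
    (by fun_prop : Continuous fun s : ℝ => (t : ℂ) * z * Complex.exp (-z * s)).smul (hU x)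
  rw [haverage]
  refine (convex_convexHull ℝ _).set_average_mem_closure (by simp [ht]) (by simp) ?_
    hcont.integrableOn_Ioc
  exact ae_restrict_of_forall_mem measurableSet_Ioc fun s hs =>
    subset_convexHull ℝ _ ⟨_, h𝒜 s hs, rfl⟩

/-- The splitting time is `t = m / ‖z‖`: then `|e^{-zs}| ≤ e` on `[0, t]`, and the coefficient of
`t V(t)` in the last term of `IsDerivOf.smul_shiftInv_eq` has size at most `e / m`. -/
theorem IsDerivOf.exists_decomposition [CompleteSpace X] (hV : IsDerivOf A U V C)
    (h : IsBddSemigroup A U K) {m : ℝ} (hm : 0 < m) {𝒜 ℬ 𝒯 : Set (X →L[ℂ] X)}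
    (h𝒜 : ∀ (c : ℂ) (s : ℝ), 0 < s → ‖c‖ ≤ m * Real.exp 1 → c • U s ∈ 𝒜)
    (hℬ : ∀ (c : ℂ) (s : ℝ), 0 < s → ‖c‖ ≤ Real.exp 1 → c • U s ∈ ℬ)
    (h𝒯 : ∀ (c : ℂ) (s : ℝ), 0 < s → ‖c‖ ≤ 1 → c • (s : ℂ) • V s ∈ 𝒯) {z : ℂ}
    (hz : z ≠ 0) (hre : -(‖z‖ / m) ≤ z.re) {R : X →L[ℂ] X} (hR : IsShiftInv A z R) (x : X) :
    ∃ w ∈ closure (convexHull ℝ ((fun B => B x) '' 𝒜)), ∃ B ∈ ℬ, ∃ T ∈ 𝒯,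
      z • R x = w + B x - (Real.exp 1 / m) • T (z • R x) := by
  have hz' : 0 < ‖z‖ := norm_pos_iff.2 hz
  obtain ⟨t, ht⟩ : ∃ t, t = m / ‖z‖ := ⟨_, rfl⟩
  have ht0 : 0 < t := ht ▸ by positivity
  have hexp (s : ℝ) (hs : s ∈ Icc 0 t) : ‖Complex.exp (-z * s)‖ ≤ Real.exp 1 :=
    norm_exp_neg_mul_le hm hz hre (ht ▸ hs)
  have htz : ‖(t : ℂ) * z‖ = m := by
    rw [norm_mul, Complex.norm_real, Real.norm_of_nonneg ht0.le, ht, div_mul_cancel₀ m hz'.ne']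
  refine ⟨_, smul_integral_mem_closure_convexHull (z := z) h.cont ht0
      (fun s hs => h𝒜 _ s hs.1 ?_) x,
    Complex.exp (-z * t) • U t, hℬ _ t ht0 (hexp t ⟨ht0.le, le_rfl⟩),
    (Complex.exp (-z * t) * ((t : ℂ) * z)⁻¹ * (m / Real.exp 1 : ℝ)) • (t : ℂ) • V t,
    h𝒯 _ t ht0 ?_, ?_⟩
  · rw [norm_mul, htz]
    gcongr
    exact hexp s ⟨hs.1.le, hs.2⟩
  · rw [norm_mul, norm_mul, norm_inv, htz, Complex.norm_real, Real.norm_of_nonneg (by positivity)]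
    calc ‖Complex.exp (-z * t)‖ * m⁻¹ * (m / Real.exp 1)
        ≤ Real.exp 1 * m⁻¹ * (m / Real.exp 1) := by
          gcongr
          exact hexp t ⟨ht0.le, le_rfl⟩
      _ = 1 := by field_simp
  · refine (hV.smul_shiftInv_eq h hz hR ht0 x).trans (congrArg _ ?_)
    have ht_ne : (t : ℂ) ≠ 0 := Complex.ofReal_ne_zero.2 ht0.ne'
    have hm_ne : (m : ℂ) ≠ 0 := Complex.ofReal_ne_zero.2 hm.ne'
    rw [smul_apply, smul_apply, smul_smul, ← Complex.coe_smul, smul_smul]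
    congr 1
    push_cast
    field_simp

/-- Each `P ∈ 𝒮` recurs on the right-hand side, but with a coefficient small enough to be absorbed
on the left. -/
theorem isRBounded_of_absorb {𝒜 ℬ 𝒯 𝒮 : Set (X →L[ℂ] X)} {d r : ℝ} (hr : 0 ≤ r)
    (hrd : r * d ≤ 1 / 2) (h𝒜 : IsRBounded 𝒜) (hℬ : IsRBounded ℬ)
    (h𝒯 : ∀ (n : ℕ) (T : Fin n → X →L[ℂ] X) (x : Fin n → X), (∀ k, T k ∈ 𝒯) →
      radNorm (fun k => T k (x k)) ≤ d * radNorm x)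
    (h𝒮 : ∀ P ∈ 𝒮, ∀ x, ∃ w ∈ closure (convexHull ℝ ((fun B => B x) '' 𝒜)), ∃ B ∈ ℬ, ∃ T ∈ 𝒯,
      P x = w + B x - r • T (P x)) :
    IsRBounded 𝒮 := by
  obtain ⟨a, ha0, h𝒜⟩ := h𝒜
  obtain ⟨b, hb0, hℬ⟩ := hℬ
  refine ⟨2 * (a + b), by positivity, fun n P x hP => ?_⟩
  change radNorm (fun k => P k (x k)) ≤ _ * radNorm x
  choose w hw B hB T hT hPx using fun k => h𝒮 (P k) (hP k) (x k)
  set y : Fin n → X := fun k => P k (x k)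
  have hw_norm : radNorm w ≤ a * radNorm x := by
    refine radNorm_le_of_mem_closure_convexHull (fun u hu => ?_) hw
    choose Q hQ hQu using hu
    obtain rfl : (fun k => Q k (x k)) = u := funext hQu
    exact h𝒜 n Q x hQ
  have hB_norm : radNorm (fun k => B k (x k)) ≤ b * radNorm x := hℬ n B x hB
  have hT_norm : r * radNorm (fun k => T k (y k)) ≤ 1 / 2 * radNorm y := calc
    r * radNorm (fun k => T k (y k)) ≤ r * (d * radNorm y) := by
      gcongr
      exact h𝒯 n T y hT
    _ = r * d * radNorm y := by ring
    _ ≤ 1 / 2 * radNorm y := mul_le_mul_of_nonneg_right hrd (radNorm_nonneg y)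
  have hy : y = w + (fun k => B k (x k)) + (-r) • fun k => T k (y k) := by
    funext k
    rw [neg_smul, ← sub_eq_add_neg]
    exact hPx k
  have hy_norm : radNorm y ≤ radNorm w + radNorm (fun k => B k (x k)) +
      r * radNorm (fun k => T k (y k)) := by
    conv_lhs => rw [hy]
    refine (radNorm_add_le _ _).trans ?_
    rw [radNorm_smul, abs_neg, abs_of_nonneg hr]
    gcongr
    exact radNorm_add_le _ _
  linarith

theorem exists_cos_le {φ m : ℝ} (hφ : φ ∈ Ioo 0 (π / 2)) (hm : 0 < m) :
    ∃ θ ∈ Ioo φ (π / 2), Real.cos θ ≤ 1 / m := by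
  have hlim : Tendsto Real.cos (𝓝[<] (π / 2)) (𝓝 0) :=
    (Real.continuous_cos.tendsto' _ _ Real.cos_pi_div_two).mono_left nhdsWithin_le_nhds
  obtain ⟨θ, hcos, hθ⟩ :=
    ((hlim.eventually_lt_const (by positivity : 0 < 1 / m)).and (Ioo_mem_nhdsLT hφ.2)).exists
  exact ⟨θ, hθ, hcos.le⟩

theorem norm_smul_resolvent_addScalar_le {ω : ℝ} (hω : 0 ≤ ω) {z : ℂ} (hz : z.re ≤ 0)
    (hzω : z - ω ∈ resolventSet A) :
    ‖z • resolvent (addScalar A ω) z‖ ≤ ‖(z - ω) • resolvent A (z - ω)‖ := by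
  rw [resolvent_addScalar hzω, norm_smul, norm_smul]
  gcongr
  rw [Complex.norm_def, Complex.norm_def, Complex.normSq_apply, Complex.normSq_apply,
    Complex.sub_re, Complex.sub_im, Complex.ofReal_re, Complex.ofReal_im, sub_zero]
  gcongr Real.sqrt (?_ + _)
  nlinarith

end Absorb

section GaussDom

open scoped NNReal
open Module (finrank)

variable {E : Type*} [NormedAddCommGroup E] [InnerProductSpace ℝ E] [FiniteDimensional ℝ E]
  [MeasurableSpace E] [BorelSpace E] {Ω : Set E} {p : ℝ≥0∞} [Fact (1 ≤ p)]

theorem IsGivenByKernel.enorm_apply_le {a : ℝ≥0∞} {b : ℝ} (hΩ : MeasurableSet Ω)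
    {B : Lp ℂ p (volume.restrict Ω) →L[ℂ] Lp ℂ p (volume.restrict Ω)} {κ : E → E → ℂ}
    (hκ : IsGivenByKernel B κ)
    (hGauss : ∀ᵐ z ∂((volume.restrict Ω).prod (volume.restrict Ω)),
      ‖κ z.1 z.2‖ₑ ≤ a * gauss b (z.1 - z.2)) (f : Lp ℂ p (volume.restrict Ω)) :
    ∀ᵐ x ∂volume.restrict Ω, ‖B f x‖ₑ ≤ a * ∫⁻ y, gauss b (x - y) * absExt f y := by
  filter_upwards [hκ.2 f, Measure.ae_ae_of_ae_prod hGauss] with x hx hx_gauss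
  rw [hx.2, lintegral_gauss_mul_absExt hΩ, ← lintegral_const_mul'' _ (by fun_prop)]
  refine (enorm_integral_le_lintegral_enorm _).trans (lintegral_mono_ae ?_)
  filter_upwards [hx_gauss] with y hy
  rw [enorm_mul, ← mul_assoc]
  gcongr

variable (E) in
theorem ofReal_exp_mul_le_inv_gaussMass {C β ω₁ ω s : ℝ} (hC : 0 ≤ C) (hβ : 0 < β) (hs : 0 < s)
    (hω : ω₁ ≤ ω) :
    ENNReal.ofReal (Real.exp (-ω * s)) *
        ENNReal.ofReal (C * s ^ (-(finrank ℝ E : ℝ) / 2) * Real.exp (ω₁ * s)) ≤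
      (C * (4 * π * β) ^ (finrank ℝ E / 2 : ℝ)).toNNReal * (gaussMass E (4 * β * s))⁻¹ := by
  rw [gaussMass_eq E (by positivity), ← ENNReal.ofReal_inv_of_pos (by positivity),
    ← ENNReal.ofReal, ← ENNReal.ofReal_mul (by positivity), ← ENNReal.ofReal_mul (by positivity)]
  refine ENNReal.ofReal_le_ofReal ?_
  have hpow : (π * (4 * β * s)) ^ (finrank ℝ E / 2 : ℝ) =
      (4 * π * β) ^ (finrank ℝ E / 2 : ℝ) * s ^ (finrank ℝ E / 2 : ℝ) := by
    rw [← Real.mul_rpow (by positivity) hs.le]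
    congr 1
    ring
  have hexp : Real.exp (-ω * s) * Real.exp (ω₁ * s) ≤ 1 := by
    rw [← Real.exp_add, Real.exp_le_one_iff]
    nlinarith
  rw [hpow, neg_div, Real.rpow_neg hs.le]
  calc Real.exp (-ω * s) * (C * (s ^ (finrank ℝ E / 2 : ℝ))⁻¹ * Real.exp (ω₁ * s))
      = C * (s ^ (finrank ℝ E / 2 : ℝ))⁻¹ * (Real.exp (-ω * s) * Real.exp (ω₁ * s)) := by ring
    _ ≤ C * (s ^ (finrank ℝ E / 2 : ℝ))⁻¹ * 1 := by gcongr
    _ = C * (4 * π * β) ^ (finrank ℝ E / 2 : ℝ) *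
          ((4 * π * β) ^ (finrank ℝ E / 2 : ℝ) * s ^ (finrank ℝ E / 2 : ℝ))⁻¹ := by field_simp

theorem gaussDom_rescale (hΩ : MeasurableSet Ω)
    {S : ℝ → Lp ℂ p (volume.restrict Ω) →L[ℂ] Lp ℂ p (volume.restrict Ω)} {κ : E → E → ℂ}
    {C β ω₁ ω s : ℝ} (hC : 0 ≤ C) (hβ : 0 < β) (hs : 0 < s) (hω : ω₁ ≤ ω)
    (hκ : IsGivenByKernel (S s) κ)
    (hGauss : ∀ᵐ z ∂((volume.restrict Ω).prod (volume.restrict Ω)),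
      ‖κ z.1 z.2‖ ≤ C * s ^ (-(finrank ℝ E : ℝ) / 2) * Real.exp (ω₁ * s) *
        Real.exp (-(‖z.1 - z.2‖ ^ 2 / (4 * β * s)))) :
    GaussDom (C * (4 * π * β) ^ (finrank ℝ E / 2 : ℝ)).toNNReal (4 * β * s) (rescale S ω s) := by
  intro f
  have hGauss' : ∀ᵐ z ∂((volume.restrict Ω).prod (volume.restrict Ω)), ‖κ z.1 z.2‖ₑ ≤
      ENNReal.ofReal (C * s ^ (-(finrank ℝ E : ℝ) / 2) * Real.exp (ω₁ * s)) *
        gauss (4 * β * s) (z.1 - z.2) := by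
    filter_upwards [hGauss] with z hz
    rw [gauss, ← ENNReal.ofReal_mul (by positivity), ← ofReal_norm]
    exact ENNReal.ofReal_le_ofReal hz
  rw [rescale_of_nonneg S ω hs.le]
  filter_upwards [hκ.enorm_apply_le hΩ hGauss' f,
    Lp.coeFn_smul ((Real.exp (-ω * s) : ℝ) : ℂ) (S s f)] with x hx hx_smul
  rw [smul_apply, hx_smul, Pi.smul_apply, enorm_smul, ← ofReal_norm, Complex.norm_real,
    Real.norm_of_nonneg (Real.exp_pos _).le, gaussAvg, ← mul_assoc]
  refine (mul_le_mul_right hx _).trans ?_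
  rw [← mul_assoc]
  exact mul_le_mul_left (ofReal_exp_mul_le_inv_gaussMass E hC hβ hs hω) _

variable {A : Lp ℂ p (volume.restrict Ω) →ₗ.[ℂ] Lp ℂ p (volume.restrict Ω)}
  {U V : ℝ → Lp ℂ p (volume.restrict Ω) →L[ℂ] Lp ℂ p (volume.restrict Ω)} {K₀ : ℝ≥0}
  {K M c C : ℝ}

theorem IsDerivOf.gaussDom (hV : IsDerivOf A U V C) (h : IsBddSemigroup A U K) (hC : 0 ≤ C)
    {z : ℂ} {R : Lp ℂ p (volume.restrict Ω) →L[ℂ] Lp ℂ p (volume.restrict Ω)}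
    (hR : IsShiftInv A z R) (hΩ : MeasurableSet Ω) (hp : p ≠ ∞) (hc : 0 < c)
    (hU : ∀ τ > 0, GaussDom K₀ (c * τ) (U τ)) {s : ℝ} (hs : 0 < s) :
    GaussDom (landauConst E K₀ (36 * C ^ 2).toNNReal) (16 * (c * s)) ((s : ℂ) • V s) := by
  have hs3 : 0 < s / 3 := by positivity
  refine gaussDom_of_second_order hΩ hp hc hs U
    (fun r => U (s / 3) - U (s / 3 + r * s) - ((r * s : ℝ) : ℂ) • V (s / 3)) hU ?_ ?_
  · intro r hr
    have hrs : 0 ≤ r * s := mul_nonneg hr.1.le hs.le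
    refine ContinuousLinearMap.opNorm_le_bound _ (by positivity) fun x => ?_
    have htaylor := hV.norm_sub_sub_smul_le h hC hR hs3 (le_add_of_nonneg_right hrs) x
    rw [add_sub_cancel_left] at htaylor
    refine htaylor.trans_eq ?_
    rw [Real.coe_toNNReal _ (by positivity)]
    field_simp
    ring
  · intro r hr f
    have hrs : 0 ≤ r * s := mul_nonneg hr.1.le hs.le
    have hUs : U s f = U (s / 3) (U (s / 3) (U (s / 3) f)) := by
      rw [← h.add (s / 3) (s / 3) hs3.le hs3.le f, ← h.add _ _ hs3.le (by positivity), ← add_assoc,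
        add_thirds]
    have hUsr : U (s + r * s) f = U (s / 3) (U (s / 3 + r * s) (U (s / 3) f)) := by
      rw [← h.add _ _ (by positivity) hs3.le, ← h.add _ _ hs3.le (by positivity)]
      congr 2
      ring
    have hVs : V s f = U (s / 3) (V (s / 3) (U (s / 3) f)) := by
      have hgraph := hV.mem_graph _ hs3 (U (s / 3) f)
      rw [← h.add _ _ hs3.le hs3.le] at hgraph
      rw [A.mem_graph_snd_inj hgraph (hV.mem_graph _ (by positivity) f) rfl,
        ← hV.add_apply h hs3.le (by positivity), ← add_assoc, add_thirds]
    simp only [sub_apply, smul_apply, map_sub, map_smul]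
    rw [← hUs, ← hUsr, ← hVs, smul_smul, Complex.ofReal_mul]
    abel

theorem exists_smul_resolvent_eq (hΩ : MeasurableSet Ω) (hp : p ≠ ∞) (hc : 0 < c)
    (h : IsBddSemigroup A U K) (hU : ∀ s > 0, GaussDom K₀ (c * s) (U s))
    (hρ : ∀ z : ℂ, z.re < 0 → z ∈ resolventSet A)
    (hM : ∀ z : ℂ, z.re < 0 → ‖z • resolvent A z‖ ≤ M) {m : ℝ} (hm : 0 < m) {z : ℂ} (hz : z ≠ 0)
    (hzρ : z ∈ resolventSet A) (hre : z.re ≤ ‖z‖ / m) (x : Lp ℂ p (volume.restrict Ω)) :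
    ∃ w ∈ closure (convexHull ℝ
        ((fun B => B x) '' gaussClass Ω p ((m * Real.exp 1).toNNReal * K₀))),
      ∃ B ∈ gaussClass Ω p ((Real.exp 1).toNNReal * K₀),
      ∃ T ∈ gaussClass Ω p
        (landauConst E K₀ (36 * (Real.exp 1 * (M ^ 2 + M ^ 3)) ^ 2).toNNReal),
      (z • resolvent A z) x = w + B x - (Real.exp 1 / m) • T ((z • resolvent A z) x) := by
  have hM0 : 0 ≤ M := (norm_nonneg _).trans (hM (-1) (by simp))
  obtain ⟨V, hV⟩ := exists_isDerivOf (M := M) (Q := fun z => -resolvent A (-z)) h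
    (fun z hz => by
      simpa using (isResolventAt_resolvent (hρ (-z) (by simpa using hz))).isShiftInv)
    (fun z hz => by simpa using hM (-z) (by simpa using hz))
  have hR := (isResolventAt_resolvent hzρ).isShiftInv
  have hVGauss (s : ℝ) (hs : 0 < s) := hV.gaussDom h (by positivity) hR hΩ hp hc hU hs
  have hdecomp := hV.exists_decomposition h hm
    (𝒜 := gaussClass Ω p ((m * Real.exp 1).toNNReal * K₀))
    (ℬ := gaussClass Ω p ((Real.exp 1).toNNReal * K₀))
    (𝒯 := gaussClass Ω p (1 * _))
    (fun w s hs hw => ⟨_, mul_pos hc hs, (hU s hs).smul (hw.trans (Real.le_coe_toNNReal _))⟩)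
    (fun w s hs hw => ⟨_, mul_pos hc hs, (hU s hs).smul (hw.trans (Real.le_coe_toNNReal _))⟩)
    (fun w s hs hw => ⟨_, by positivity, (hVGauss s hs).smul (hw.trans_eq NNReal.coe_one.symm)⟩)
    (neg_ne_zero.2 hz) (by simpa using hre) hR x
  rw [one_mul, neg_apply, neg_smul, smul_neg, neg_neg] at hdecomp
  exact hdecomp

/-- The angle `θ` is so close to `π / 2` that the term to be absorbed has norm at most `1 / 2`. -/
theorem exists_isRBounded_resolvent {ι : Type*} {I : Set ι} (hΩ : MeasurableSet Ω) (hp1 : 1 < p)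
    (hp : p ≠ ∞) {A : ι → Lp ℂ p (volume.restrict Ω) →ₗ.[ℂ] Lp ℂ p (volume.restrict Ω)} {φ : ℝ}
    (hφ : φ ∈ Ioo 0 (π / 2)) (hσ : ∀ t ∈ I, spectrum (A t) ⊆ closure (sector φ))
    (hM : ∀ t ∈ I, ∀ z ∉ closure (sector φ), ‖z • resolvent (A t) z‖ ≤ M)
    {S : ι → ℝ → Lp ℂ p (volume.restrict Ω) →L[ℂ] Lp ℂ p (volume.restrict Ω)}
    (hS : ∀ t ∈ I, IsC0Semigroup (S t) ∧ IsGeneratorOf (-(A t)) (S t)) (hc : 0 < c) (K₀ : ℝ≥0) :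
    ∃ θ ∈ Ioo φ (π / 2), ∀ ω : ℝ, 0 ≤ ω →
      (∀ t ∈ I, ∀ s > 0, GaussDom K₀ (c * s) (rescale (S t) ω s)) →
      IsRBounded
        {B | ∃ t ∈ I, ∃ z ∉ closure (sector θ), B = z • resolvent (addScalar (A t) ω) z} := by
  obtain ⟨d, hd0, hd⟩ := isRBounded_gaussClass hΩ hp1 hp
    (landauConst E K₀ (36 * (Real.exp 1 * (M ^ 2 + M ^ 3)) ^ 2).toNNReal)
  obtain ⟨m, hm⟩ : ∃ m, m = 2 * Real.exp 1 * d + 1 := ⟨_, rfl⟩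
  have hm0 : 0 < m := hm ▸ by positivity
  obtain ⟨θ, hθ, hcos⟩ := exists_cos_le hφ hm0
  have hφπ : φ ∈ Ioo 0 π := ⟨hφ.1, hφ.2.trans (half_lt_self Real.pi_pos)⟩
  have hθπ : θ ∈ Ioo 0 π := ⟨hφ.1.trans hθ.1, hθ.2.trans (half_lt_self Real.pi_pos)⟩
  refine ⟨θ, hθ, fun ω hω hU => isRBounded_of_absorb (r := Real.exp 1 / m) (by positivity) ?_
    (isRBounded_gaussClass hΩ hp1 hp ((m * Real.exp 1).toNNReal * K₀))
    (isRBounded_gaussClass hΩ hp1 hp ((Real.exp 1).toNNReal * K₀)) hd ?_⟩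
  · rw [div_mul_eq_mul_div, div_le_iff₀ hm0, hm]
    linarith
  rintro _ ⟨t, ht, z, hz, rfl⟩ x
  have hsemigroup := isBddSemigroup_rescale (hS t ht).1 (hS t ht).2
    fun s hs => (hU t ht s hs).norm_le hΩ hp (mul_pos hc hs)
  have hre_neg (w : ℂ) (hw : w.re < 0) : w - ω ∉ closure (sector φ) :=
    notMem_closure_sector_of_re_neg hφ (by simpa using hw.trans_le hω)
  have hρ (w : ℂ) (hw : w.re < 0) : w - ω ∈ resolventSet (A t) :=
    not_not.1 fun h => hre_neg w hw (hσ t ht h)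
  have hzρ : z ∈ resolventSet (addScalar (A t) ω) :=
    not_not.1 fun h => hz (spectrum_addScalar_subset hφπ hθ.1.le hω (hσ t ht) h)
  have hz0 : z ≠ 0 := fun h => hz (h ▸ zero_mem_closure_sector hθπ)
  have hre : z.re ≤ ‖z‖ / m := calc
    z.re ≤ ‖z‖ * Real.cos θ := re_le_of_notMem_sector hθπ.1.le fun h => hz (subset_closure h)
    _ ≤ ‖z‖ * (1 / m) := by gcongr
    _ = ‖z‖ / m := mul_one_div _ _
  exact exists_smul_resolvent_eq hΩ hp hc hsemigroup (hU t ht)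
    (fun w hw => mem_resolventSet_addScalar_iff.2 (hρ w hw))
    (fun w hw => (norm_smul_resolvent_addScalar_le hω hw.le (hρ w hw)).trans
      (hM t ht _ (hre_neg w hw))) hm0 hz0 hzρ hre x

end GaussDom

end KernelRBound

end

theorem mainTheorem8_general {ι : Type*} {E : Type*} [NormedAddCommGroup E]
    [InnerProductSpace ℝ E] [FiniteDimensional ℝ E] [MeasurableSpace E] [BorelSpace E] {Ω : Set E}
    (hΩ : MeasurableSet Ω) {p : ℝ≥0∞} [Fact (1 ≤ p)] (hp1 : 1 < p) (hp : p ≠ ∞) {I : Set ι}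
    {A : ι → Lp ℂ p (volume.restrict Ω) →ₗ.[ℂ] Lp ℂ p (volume.restrict Ω)}
    {φ : ℝ} (hφ : φ ∈ Ioo 0 (π / 2))
    (hσ : ∀ t ∈ I, KernelRBound.spectrum (A t) ⊆ closure (KernelRBound.sector φ)) {M : ℝ}
    (hM : ∀ t ∈ I, ∀ z ∉ closure (KernelRBound.sector φ),
      ‖z • KernelRBound.resolvent (A t) z‖ ≤ M)
    {S : ι → ℝ → Lp ℂ p (volume.restrict Ω) →L[ℂ] Lp ℂ p (volume.restrict Ω)}
    (hS : ∀ t ∈ I, KernelRBound.IsC0Semigroup (S t) ∧ KernelRBound.IsGeneratorOf (-(A t)) (S t))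
    {k : ι → ℝ → E → E → ℂ}
    (hk : ∀ t ∈ I, ∀ s : ℝ, 0 < s → KernelRBound.IsGivenByKernel (S t s) (k t s))
    {C β ω₁ : ℝ} (hC : 0 ≤ C) (hβ : 0 < β)
    (hGauss : ∀ t ∈ I, ∀ s : ℝ, 0 < s →
      ∀ᵐ z ∂((volume.restrict Ω).prod (volume.restrict Ω)),
        ‖k t s z.1 z.2‖ ≤ C * s ^ (-(Module.finrank ℝ E : ℝ) / 2) * Real.exp (ω₁ * s) *
          Real.exp (-(‖z.1 - z.2‖ ^ 2 / (4 * β * s)))) :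
    ∃ θ ∈ Ioo φ (π / 2), ∀ ω : ℝ, max ω₁ 0 ≤ ω →
      (∀ t ∈ I, KernelRBound.spectrum (KernelRBound.addScalar (A t) ω) ⊆
          closure (KernelRBound.sector θ)) ∧
      KernelRBound.IsRBounded
        {B | ∃ t ∈ I, ∃ z ∉ closure (KernelRBound.sector θ),
          B = z • KernelRBound.resolvent (KernelRBound.addScalar (A t) ω) z} := by
  have hφπ : φ ∈ Ioo 0 π := ⟨hφ.1, hφ.2.trans (half_lt_self Real.pi_pos)⟩
  obtain ⟨θ, hθ, hbounded⟩ := KernelRBound.exists_isRBounded_resolvent hΩ hp1 hp hφ hσ hM hS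
    (c := 4 * β) (by positivity)
    (C * (4 * π * β) ^ (Module.finrank ℝ E / 2 : ℝ)).toNNReal
  refine ⟨θ, hθ, fun ω hω => ⟨fun t ht => ?_, ?_⟩⟩
  · exact KernelRBound.spectrum_addScalar_subset hφπ hθ.1.le ((le_max_right ..).trans hω)
      (hσ t ht)
  · exact hbounded ω ((le_max_right ..).trans hω) fun t ht s hs =>
      KernelRBound.gaussDom_rescale hΩ hC hβ hs ((le_max_left ..).trans hω) (hk t ht s hs)
        (hGauss t ht s hs)

theorem mainTheorem8 (N : ℕ) (Ω : Set (EuclideanSpace ℝ (Fin N))) (hΩ : MeasurableSet Ω)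
    (p : ℝ≥0∞) [Fact (1 ≤ p)] (hp1 : 1 < p) (hp : p ≠ ∞) (T : ℝ)
    (A : ℝ → Lp ℂ p (volume.restrict Ω) →ₗ.[ℂ] Lp ℂ p (volume.restrict Ω))
    (hA : ∀ t ∈ Icc 0 T, KernelRBound.IsSectorial (A t))
    -- uniform sectoriality
    (φ : ℝ) (hφ : φ ∈ Ioo 0 (π / 2))
    (hσ : ∀ t ∈ Icc 0 T, KernelRBound.spectrum (A t) ⊆ closure (KernelRBound.sector φ))
    (hR : ∃ M : ℝ, ∀ t ∈ Icc 0 T, ∀ z ∉ closure (KernelRBound.sector φ),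
      ‖z • KernelRBound.resolvent (A t) z‖ ≤ M)
    -- `S t s = exp (-s A(t))`, the semigroup generated by `-A(t)`
    (S : ℝ → ℝ → Lp ℂ p (volume.restrict Ω) →L[ℂ] Lp ℂ p (volume.restrict Ω))
    (hS : ∀ t ∈ Icc 0 T,
      KernelRBound.IsC0Semigroup (S t) ∧ KernelRBound.IsGeneratorOf (-(A t)) (S t))
    -- uniform Gaussian estimates
    (k : ℝ → ℝ → EuclideanSpace ℝ (Fin N) → EuclideanSpace ℝ (Fin N) → ℂ)
    (hk : ∀ t ∈ Icc 0 T, ∀ s : ℝ, 0 < s → KernelRBound.IsGivenByKernel (S t s) (k t s))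
    (C β ω₁ : ℝ) (hC : 0 ≤ C) (hβ : 0 < β)
    (hGauss : ∀ t ∈ Icc 0 T, ∀ s : ℝ, 0 < s →
      ∀ᵐ z ∂((volume.restrict Ω).prod (volume.restrict Ω)),
        ‖k t s z.1 z.2‖ ≤ C * s ^ (-(N : ℝ) / 2) * Real.exp (ω₁ * s) *
          Real.exp (-(‖z.1 - z.2‖ ^ 2 / (4 * β * s)))) :
    ∃ θ ∈ Ioo φ (π / 2), ∀ ω : ℝ, max ω₁ 0 ≤ ω →
      (∀ t ∈ Icc 0 T,
        KernelRBound.spectrum (KernelRBound.addScalar (A t) ω) ⊆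
          closure (KernelRBound.sector θ)) ∧
      KernelRBound.IsRBounded
        {B | ∃ t ∈ Icc 0 T, ∃ z ∉ closure (KernelRBound.sector θ),
          B = z • KernelRBound.resolvent (KernelRBound.addScalar (A t) ω) z} := by
  obtain ⟨M, hM⟩ := hR
  exact mainTheorem8_general hΩ hp1 hp hφ hσ hM hS hk hC hβ
    (by simpa only [finrank_euclideanSpace_fin] using hGauss)
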